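/- Let $n\ge 1$ and let $0<q<1$, $0<t<1$ be real parameters, $t=q^{\lambda}$ with $\lambda>0$. For $1\le i\le n-1$ let $s_i$ interchange $x_i$ and $x_{i+1}$ and let $$T_i=t+\frac{tx_i-x_{i+1}}{x_i-x_{i+1}}(s_i-1),\qquad T_i^{-1}=t^{-1}-1+t^{-1}T_i,\qquad \omega=s_{n-1}\cdots s_1\tau_1,$$ where $(\tau_1 f)(x_1,\dots,x_n)=f(qx_1,x_2,\dots,x_n)$, and let $$Y_i=t^{-n+i}\,T_i\cdots T_{n-1}\,\omega\,T_1^{-1}\cdots T_{i-1}^{-1}\qquad(1\le i\le n)$$ be the Cherednik operators. For a composition $\eta\in\mathbb{Z}_{\ge0}^n$ put $$l'_\eta(i)=\#\{k<i:\eta_k\ge\eta_i\}+\#\{k>i:\eta_k>\eta_i\},\qquad t^{\bar\eta_i}=q^{\eta_i}t^{-l'_\eta(i)},$$ and let $\eta^+$ be the partition obtained by permuting the parts of $\eta$. For distinct $n$-tuples write $\nu<\eta$ if $\sum_{i\le p}\nu_i\le\sum_{i\le p}\eta_i$ for all $p$. For compositions with $|\nu|=|\eta|$ write $\nu\prec\eta$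 if $\nu^+<\eta^+$, or $\nu^+=\eta^+$ and $\nu<\eta$. The non-symmetric Macdonald polynomial $E_\eta(x;q,t)$ is the polynomial of the form $x^\eta+\sum_{\nu\prec\eta}b_{\eta\nu}x^\nu$ satisfying $Y_iE_\eta=t^{\bar\eta_i}E_\eta$ for $1\le i\le n$; $E_\eta(x;1/q,1/t)$ is given by the same conditions with $q,t$ replaced by $1/q,1/t$. For a node $s=(i,j)$ of $\eta$, that is, $1\le i\le n$ and $1\le j\le\eta_i$, let $$a(s)=\eta_i-j,\quad a'(s)=j-1,\quad l'(s)=l'_\eta(i),\quad l(s)=\#\{k>i: j\le\eta_k\le\eta_i\}+\#\{k<i: j\le\eta_k+1\le\eta_i\},$$ and set $$d_\eta=\prod_{s\in\eta}(1-q^{a(s)+1}t^{l(s)+1}),\qquad d'_\eta=\prod_{s\in\eta}(1-q^{a(s)+1}t^{l(s)}),$$ $$e_\eta=\prod_{s\in\eta}(1-q^{a'(s)+1}t^{n-l'(s)}),\qquad e'_\eta=\prod_{s\in\eta}(1-q^{a'(s)+1}t^{n-1-l'(s)}).$$ Let $(a;q)_\infty=\prod_{k\ge0}(1-aq^k)$,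 $(a;q)_\lambda=(a;q)_\infty/(aq^\lambda;q)_\infty$, and for polynomials $f(x;q,t)$, $g(x;q,t)$ in $x$ define $$\langle f,g\rangle_{q,t}=\mathrm{CT}\bigl(f(x;q,t)\,g(1/x;1/q,1/t)\,W(x)\bigr),\qquad W(x)=\prod_{1\le i<j\le n}\Bigl(\frac{x_i}{x_j};q\Bigr)_\lambda\Bigl(q\frac{x_j}{x_i};q\Bigr)_\lambda,$$ where $\mathrm{CT}(F)=\int_{[0,1]^n}F(e^{2\pi i\theta_1},\dots,e^{2\pi i\theta_n})\,d\theta$ is the constant term, that is, the zeroth Fourier coefficient on the torus $|x_1|=\dots=|x_n|=1$. Then for every composition $\eta$ both $E_\eta(x;q,t)$ and $E_\eta(x;1/q,1/t)$ exist and are unique, and, with $\mathcal N_\eta=\langle E_\eta,E_\eta\rangle_{q,t}$, one has $\mathcal N_0\ne0$ and $$\frac{\mathcal N_\eta}{\mathcal N_0}=\frac{d'_\eta\,e_\eta}{d_\eta\,e'_\eta}.$$ -/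

import Mathlib

open MvPolynomial

namespace NonsymMacdonald

/-! ### Compositions, the order on them, and the combinatorial constants

A composition with `n` parts is a function `η : Fin n → ℕ`.  Rows are indexed from `0`, so the row
called `i` in the usual notation is `i - 1` here.  Columns run over `1, …, η i`. -/

section Combinatorics

variable {n : ℕ}

/-- The unique partition `η⁺` obtained by permuting the parts of `η`. -/
def partitionOf (η : Fin n → ℕ) : Fin n → ℕ :=
  fun i => η (Tuple.sort η (Fin.rev i))

/-- `η⁺` is weakly decreasing. -/
theorem partitionOf_antitone (η : Fin n → ℕ) : Antitone (partitionOf η) := fun _ _ h =>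
  Tuple.monotone_sort η (Fin.rev_le_rev.mpr h)

/-- `η⁺` is a rearrangement of `η`. -/
theorem partitionOf_perm (η : Fin n → ℕ) : ∃ σ : Equiv.Perm (Fin n), partitionOf η = η ∘ σ :=
  ⟨Fin.revPerm.trans (Tuple.sort η), rfl⟩

/-- Strict dominance `ν < η`: the two tuples differ and every partial sum of `ν` is at most the
corresponding partial sum of `η`. -/
def DomLT (ν η : Fin n → ℕ) : Prop :=
  ν ≠ η ∧ ∀ p : Fin n, ∑ i ∈ Finset.Iic p, ν i ≤ ∑ i ∈ Finset.Iic p, η i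

/-- The strict order `ν ≺ η` on compositions of the same modulus. -/
def Prec (ν η : Fin n → ℕ) : Prop :=
  ∑ i, ν i = ∑ i, η i ∧
    (DomLT (partitionOf ν) (partitionOf η) ∨ (partitionOf ν = partitionOf η ∧ DomLT ν η))

/-- The leg colength `l'_η(i)`; it is at most `n - 1`. -/
def legColength (η : Fin n → ℕ) (i : Fin n) : ℕ :=
  (Finset.univ.filter fun k => k < i ∧ η i ≤ η k).card +
    (Finset.univ.filter fun k => i < k ∧ η i < η k).card

/-- The leg length `l(s)` of the node `s = (i, j)`. -/
def legLength (η : Fin n → ℕ) (i : Fin n) (j : ℕ) : ℕ :=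
  (Finset.univ.filter fun k => i < k ∧ j ≤ η k ∧ η k ≤ η i).card +
    (Finset.univ.filter fun k => k < i ∧ j ≤ η k + 1 ∧ η k + 1 ≤ η i).card

/-- The arm length `a(s) = η_i - j` of the node `s = (i, j)` (used for `j ≤ η_i` only). -/
def armLength (η : Fin n → ℕ) (i : Fin n) (j : ℕ) : ℕ := η i - j

/-- The arm colength `a'(s) = j - 1` of a node in column `j` (used for `1 ≤ j` only). -/
def armColength (j : ℕ) : ℕ := j - 1

variable {K : Type*} [Field K]

/-- `d_η(q,t) = ∏_{s ∈ η} (1 - q^{a(s)+1} t^{l(s)+1})`. -/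
def dConst (q t : K) (η : Fin n → ℕ) : K :=
  ∏ i, ∏ j ∈ Finset.Icc 1 (η i), (1 - q ^ (armLength η i j + 1) * t ^ (legLength η i j + 1))

/-- `d'_η(q,t) = ∏_{s ∈ η} (1 - q^{a(s)+1} t^{l(s)})`. -/
def dConst' (q t : K) (η : Fin n → ℕ) : K :=
  ∏ i, ∏ j ∈ Finset.Icc 1 (η i), (1 - q ^ (armLength η i j + 1) * t ^ legLength η i j)

/-- `e_η(q,t) = ∏_{s ∈ η} (1 - q^{a'(s)+1} t^{n-l'(s)})`. -/
def eConst (q t : K) (η : Fin n → ℕ) : K :=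
  ∏ i, ∏ j ∈ Finset.Icc 1 (η i),
    (1 - q ^ (armColength j + 1) * t ^ ((n : ℤ) - legColength η i))

/-- `e'_η(q,t) = ∏_{s ∈ η} (1 - q^{a'(s)+1} t^{n-1-l'(s)})`. -/
def eConst' (q t : K) (η : Fin n → ℕ) : K :=
  ∏ i, ∏ j ∈ Finset.Icc 1 (η i),
    (1 - q ^ (armColength j + 1) * t ^ ((n : ℤ) - 1 - legColength η i))

/-- The eigenvalue `t^{η̄_i} = q^{η_i} t^{-l'_η(i)}`. -/
def eigenvalue (q t : K) (η : Fin n → ℕ) (i : Fin n) : K :=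
  q ^ η i * t ^ (-(legColength η i : ℤ))

end Combinatorics

/-! ### Operators on polynomials

There are `n = m + 1` variables `X 0, …, X m`.  The index `k : Fin m` stands for the adjacent pair
`X k.castSucc`, `X k.succ`.  Products in `Module.End` are compositions, the rightmost factor acting
first. -/

section Operators

variable {K : Type*} [Field K]

theorem X_sub_X_dvd_rename_swap_sub {σ : Type*} [DecidableEq σ] (i j : σ) (f : MvPolynomial σ K) :
    (X i - X j : MvPolynomial σ K) ∣ rename (Equiv.swap i j) f - f := by
  induction f using MvPolynomial.induction_on with
  | C a => simp
  | add p r hp hr =>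
    have h : rename (Equiv.swap i j) (p + r) - (p + r) =
        (rename (Equiv.swap i j) p - p) + (rename (Equiv.swap i j) r - r) := by
      rw [map_add]; ring
    rw [h]; exact dvd_add hp hr
  | mul_X p k hp =>
    have h : rename (Equiv.swap i j) (p * X k) - p * X k =
        (rename (Equiv.swap i j) p - p) * X (Equiv.swap i j k) +
          p * (X (Equiv.swap i j k) - X k) := by
      rw [map_mul, rename_X]; ring
    rw [h]
    refine dvd_add (hp.mul_right _) (Dvd.dvd.mul_left ?_ _)
    by_cases hi : k = i
    · subst hi; rw [Equiv.swap_apply_left, ← dvd_neg, neg_sub]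
    · by_cases hj : k = j
      · subst hj; rw [Equiv.swap_apply_right]
      · rw [Equiv.swap_apply_of_ne_of_ne hi hj, sub_self]; exact dvd_zero _

variable {m : ℕ}

/-- The polynomial `(s_k f - f) / (x_k - x_{k+1})`. -/
noncomputable def divDiff (k : Fin m) (f : MvPolynomial (Fin (m + 1)) K) :
    MvPolynomial (Fin (m + 1)) K :=
  (X_sub_X_dvd_rename_swap_sub k.castSucc k.succ f).choose

theorem divDiff_spec (k : Fin m) (f : MvPolynomial (Fin (m + 1)) K) :
    (X k.castSucc - X k.succ) * divDiff k f =
      rename (Equiv.swap k.castSucc k.succ) f - f :=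
  (X_sub_X_dvd_rename_swap_sub k.castSucc k.succ f).choose_spec.symm

theorem X_castSucc_sub_X_succ_ne_zero (k : Fin m) :
    (X k.castSucc - X k.succ : MvPolynomial (Fin (m + 1)) K) ≠ 0 := by
  rw [sub_ne_zero]
  intro h
  exact absurd (X_injective h) k.castSucc_lt_succ.ne

/-- The divided difference as a linear operator. -/
noncomputable def divDiffHom (k : Fin m) : Module.End K (MvPolynomial (Fin (m + 1)) K) where
  toFun := divDiff k
  map_add' f g := by
    apply mul_left_cancel₀ (X_castSucc_sub_X_succ_ne_zero (K := K) k)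
    rw [mul_add, divDiff_spec, divDiff_spec, divDiff_spec, map_add]; ring
  map_smul' c f := by
    apply mul_left_cancel₀ (X_castSucc_sub_X_succ_ne_zero (K := K) k)
    rw [RingHom.id_apply, mul_smul_comm, divDiff_spec, divDiff_spec, map_smul, smul_sub]

/-- The Demazure–Lustig operator
`T_k = t + (t x_k - x_{k+1}) / (x_k - x_{k+1}) * (s_k - 1)`. -/
noncomputable def opT (t : K) (k : Fin m) : Module.End K (MvPolynomial (Fin (m + 1)) K) :=
  t • 1 + LinearMap.mulLeft K (C t * X k.castSucc - X k.succ) * divDiffHom k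

/-- The inverse operator `T_k⁻¹ = t⁻¹ - 1 + t⁻¹ T_k`. -/
noncomputable def opTinv (t : K) (k : Fin m) : Module.End K (MvPolynomial (Fin (m + 1)) K) :=
  (t⁻¹ - 1) • 1 + t⁻¹ • opT t k

/-- The exchange `s_k` of the variables `x_k` and `x_{k+1}`. -/
noncomputable def opS (k : Fin m) : Module.End K (MvPolynomial (Fin (m + 1)) K) :=
  (rename (R := K) (Equiv.swap k.castSucc k.succ)).toLinearMap

/-- The `q`-shift `τ_1` of the first variable. -/
noncomputable def opTau (q : K) : Module.End K (MvPolynomial (Fin (m + 1)) K) :=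
  (aeval fun j : Fin (m + 1) =>
    if j = 0 then C q * X j else (X j : MvPolynomial (Fin (m + 1)) K)).toLinearMap

/-- `ω = s_{n-1} ⋯ s_2 s_1 τ_1`. -/
noncomputable def opOmega (q : K) : Module.End K (MvPolynomial (Fin (m + 1)) K) :=
  ((List.finRange m).reverse.map opS).prod * opTau q

/-- The Cherednik operator `Y_i = t^{-n+i} T_i ⋯ T_{n-1} ω T_1⁻¹ ⋯ T_{i-1}⁻¹` (with `i` counted
from `1`; here `i` is counted from `0` and `n = m + 1`, so that the exponent reads `i - m`). -/
noncomputable def opY (q t : K) (i : Fin (m + 1)) : Module.End K (MvPolynomial (Fin (m + 1)) K) :=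
  t ^ ((i : ℤ) - (m : ℤ)) •
    ((((List.finRange m).filter fun k : Fin m => (i : ℕ) ≤ (k : ℕ)).map (opT t)).prod * opOmega q *
      (((List.finRange m).filter fun k : Fin m => (k : ℕ) < (i : ℕ)).map (opTinv t)).prod)

/-- The defining conditions of the non-symmetric Macdonald polynomial `E_η(x;q,t)`: it is
`x^η` plus a combination of `x^ν` with `ν ≺ η`, and it is a simultaneous eigenfunction of the
Cherednik operators with eigenvalues `t^{η̄_i}`. -/
structure IsMacdonaldE (η : Fin (m + 1) → ℕ) (q t : K) (E : MvPolynomial (Fin (m + 1)) K) :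
    Prop where
  coeff_self : E.coeff (Finsupp.equivFunOnFinite.symm η) = 1
  triangular : ∀ ν ∈ E.support, (ν : Fin (m + 1) → ℕ) = η ∨ Prec (ν : Fin (m + 1) → ℕ) η
  eigen : ∀ i, opY q t i E = eigenvalue q t η i • E

open Classical in
/-- The non-symmetric Macdonald polynomial `E_η(x;q,t)`: the polynomial that satisfies the defining
conditions (`0` for parameters at which there is none). -/
noncomputable def macdonaldE (η : Fin (m + 1) → ℕ) (q t : K) : MvPolynomial (Fin (m + 1)) K :=
  if h : ∃ E, IsMacdonaldE η q t E then h.choose else 0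

end Operators

/-! ### The scalar product -/

section ScalarProduct

variable {n : ℕ}

/-- `(a;q)_∞ = ∏_{k ≥ 0} (1 - a q^k)`. -/
noncomputable def qPochInf (a : ℂ) (q : ℝ) : ℂ := ∏' k : ℕ, (1 - a * (q : ℂ) ^ k)

/-- `(a;q)_λ = (a;q)_∞ / (a q^λ;q)_∞`, written in terms of `t = q^λ`. -/
noncomputable def qPoch (a : ℂ) (q t : ℝ) : ℂ := qPochInf a q / qPochInf (a * t) q

/-- The weight `W(x;q,t) = ∏_{i<j} (x_i/x_j;q)_λ (q x_j/x_i;q)_λ` with `t = q^λ`. -/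
noncomputable def weight (q t : ℝ) (x : Fin n → ℂ) : ℂ :=
  ∏ i, ∏ j ∈ Finset.Ioi i, (qPoch (x i / x j) q t * qPoch (q * (x j / x i)) q t)

/-- The constant term of a function on the torus `|x_1| = ⋯ = |x_n| = 1`, as a Fourier integral. -/
noncomputable def constantTerm (F : (Fin n → ℂ) → ℂ) : ℂ :=
  ∫ θ in Set.Icc (0 : Fin n → ℝ) 1, F fun i => Complex.exp (2 * Real.pi * Complex.I * θ i)

/-- `⟨f,g⟩_{q,t} = CT (f(x;q,t) g(1/x;1/q,1/t) W(x;q,t))` for polynomials `f(x;q,t)`, `g(x;q,t)` in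
`x` whose coefficients depend on the parameters `q` and `t`. -/
noncomputable def scalarProduct (f g : ℝ → ℝ → MvPolynomial (Fin n) ℝ) (q t : ℝ) : ℂ :=
  constantTerm fun x =>
    aeval x (f q t) * aeval (fun i => (x i)⁻¹) (g q⁻¹ t⁻¹) * weight q t x

/-- `N_η(q,t) = ⟨E_η, E_η⟩_{q,t}`. -/
noncomputable def normE {m : ℕ} (η : Fin (m + 1) → ℕ) (q t : ℝ) : ℂ :=
  scalarProduct (macdonaldE η) (macdonaldE η) q t

end ScalarProduct

end NonsymMacdonald

open NonsymMacdonald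

/-! Every composition arises from 0 by two moves: raising, η ↦ (η_2, …, η_n, η_1 + 1), and
exchanging adjacent parts with η_k < η_{k+1} (`composition_induction`). Each move is realised by an
operator on polynomials. One follows how E_η, its norm and the quotient of products over nodes
change under each.

Algebra. The T_k, ω and multiplication by variables satisfy affine Hecke relations. Hence Φ = x_n ω
carries joint eigenfunctions for η to joint eigenfunctions for the raised composition
(`opY_last_mul_opPsi`, `opY_castSucc_mul_opPsi`), and T_k + c with a suitable constant c does so for
the exchange (`isEigen_opT_add`). Each Y_i is a product of operators triangular for ≺
(`opY_eq_upperG`), with diagonal entries t^{η̄_i} (`isTriangular_opY`). For 0 < q, t < 1 different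
compositions have different joint spectra (`separatesSpectrum`), so a joint eigenfunction is
automatically triangular and is fixed by its leading coefficient. This gives uniqueness, and the two
moves starting from E_0 = 1 give existence. Commutativity of the Y_i with each other is never
needed.

Analysis. In the pairing the second argument carries inverted parameters. The pair T_k(t), T_k(1/t)
preserves it because a pointwise identity holds after symmetrising the integrand in x_k, x_{k+1}
(`pairing_opT`). The pair ω(q), ω(1/q) preserves it because W is invariant under x ↦ (q x_n, x_1, …,
x_{n-1}) and the contour |x_1| = 1 may be moved to |x_1| = q (`pairing_opOmega`). So the Y_i
preserve it, the E_η are orthogonal, raising leaves the norm unchanged, and an exchange multiplies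
it by 1 − c c', where c' is c at inverted parameters.

Combinatorics. Raising adds one node, whose contributions to d', e' and to d, e cancel. An exchange
alters the leg of a single node by one, and the resulting factor is 1 − c c'. This proves
`normE_eq`.

Non-vanishing. If N_0 were 0, all norms would vanish, hence the pairing on all polynomials, since
the E_η span. All Fourier coefficients of W would then be 0, so ∫ |W|² = 0. But W is continuous on
the torus and non-zero where the coordinates are distinct. -/

namespace NonsymMacdonald

/-! ### Demazure–Lusztig operators for an arbitrary pair of variables -/

section DemazureLusztig

variable {K : Type*} [Field K] {n : ℕ}

theorem X_sub_X_ne_zero {i j : Fin n} (h : i ≠ j) : (X i - X j : MvPolynomial (Fin n) K) ≠ 0 :=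
  sub_ne_zero.mpr fun h' => h (X_injective h')

open Classical in
/-- The divided difference `f ↦ (s_{ij} f - f) / (x_i - x_j)` for `i ≠ j`. -/
noncomputable def dividedDifference (i j : Fin n) : Module.End K (MvPolynomial (Fin n) K) :=
  if h : i ≠ j then
    { toFun := fun f => (X_sub_X_dvd_rename_swap_sub i j f).choose
      map_add' := fun f g => by
        apply mul_left_cancel₀ (X_sub_X_ne_zero (K := K) h)
        rw [mul_add, ← (X_sub_X_dvd_rename_swap_sub i j (f + g)).choose_spec,
          ← (X_sub_X_dvd_rename_swap_sub i j f).choose_spec,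
          ← (X_sub_X_dvd_rename_swap_sub i j g).choose_spec, map_add]; ring
      map_smul' := fun c f => by
        apply mul_left_cancel₀ (X_sub_X_ne_zero (K := K) h)
        rw [RingHom.id_apply, mul_smul_comm,
          ← (X_sub_X_dvd_rename_swap_sub i j (c • f)).choose_spec,
          ← (X_sub_X_dvd_rename_swap_sub i j f).choose_spec, map_smul, smul_sub] }
  else 0

theorem dividedDifference_spec {i j : Fin n} (h : i ≠ j) (f : MvPolynomial (Fin n) K) :
    (X i - X j) * dividedDifference i j f = rename (Equiv.swap i j) f - f := by
  rw [dividedDifference, dif_pos h]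
  exact (X_sub_X_dvd_rename_swap_sub i j f).choose_spec.symm

/-- The operator `t + (t x_i - x_j) / (x_i - x_j) * (s_{ij} - 1)`. -/
noncomputable def pairT (t : K) (i j : Fin n) : Module.End K (MvPolynomial (Fin n) K) :=
  t • 1 + LinearMap.mulLeft K (C t * X i - X j) * dividedDifference i j

theorem pairT_spec (t : K) {i j : Fin n} (h : i ≠ j) (f : MvPolynomial (Fin n) K) :
    (X i - X j) * pairT t i j f =
      (C t * X i - X j) * rename (Equiv.swap i j) f + (1 - C t) * X j * f := by
  have h1 := dividedDifference_spec h f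
  simp only [pairT, LinearMap.add_apply, LinearMap.smul_apply, Module.End.one_apply,
    Module.End.mul_apply, LinearMap.mulLeft_apply, smul_eq_C_mul]
  linear_combination (C t * X i - X j) * h1

/-- The polynomial ring is a domain, so a formula for T_{ij} f may be checked after clearing the
denominator x_i − x_j. The Hecke relations below are verified in this way. -/
theorem pairT_eq_of_mul_eq (t : K) {i j : Fin n} (h : i ≠ j) {f g : MvPolynomial (Fin n) K}
    (hg : (X i - X j) * g =
      (C t * X i - X j) * rename (Equiv.swap i j) f + (1 - C t) * X j * f) :
    pairT t i j f = g :=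
  mul_left_cancel₀ (X_sub_X_ne_zero (K := K) h) ((pairT_spec t h f).trans hg.symm)

theorem opT_eq_pairT {m : ℕ} (t : K) (k : Fin m) : opT t k = pairT t k.castSucc k.succ := by
  refine LinearMap.ext fun f => (pairT_eq_of_mul_eq t k.castSucc_lt_succ.ne ?_).symm
  have h1 := divDiff_spec k f
  have h2 : divDiffHom k f = divDiff k f := rfl
  simp only [opT, LinearMap.add_apply, LinearMap.smul_apply, Module.End.one_apply,
    Module.End.mul_apply, LinearMap.mulLeft_apply, smul_eq_C_mul, h2]
  linear_combination (C t * X k.castSucc - X k.succ) * h1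

theorem rename_swap_rename_swap (i j : Fin n) (f : MvPolynomial (Fin n) K) :
    rename (Equiv.swap i j) (rename (Equiv.swap i j) f) = f := by
  rw [rename_rename]
  have : (Equiv.swap i j : Fin n → Fin n) ∘ Equiv.swap i j = id := by
    ext x; simp
  rw [this, rename_id_apply]

/-- Iterating T_{ij} produces s_{ij} T_{ij} f; applying s_{ij} to `pairT_spec` eliminates this term.
-/
theorem pairT_swap_spec (t : K) {i j : Fin n} (h : i ≠ j) (f : MvPolynomial (Fin n) K) :
    (X j - X i) * rename (Equiv.swap i j) (pairT t i j f) =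
      (C t * X j - X i) * f + (1 - C t) * X i * rename (Equiv.swap i j) f := by
  have h1 := congrArg (rename (Equiv.swap i j)) (pairT_spec t h f)
  simpa only [map_mul, map_sub, map_add, map_one, rename_X, rename_C, Equiv.swap_apply_left,
    Equiv.swap_apply_right, rename_swap_rename_swap] using h1

/-- The Hecke relation (T − t)(T + 1) = 0. -/
theorem pairT_quadratic (t : K) {i j : Fin n} (h : i ≠ j) (f : MvPolynomial (Fin n) K) :
    pairT t i j (pairT t i j f) = (t - 1) • pairT t i j f + t • f := by
  refine pairT_eq_of_mul_eq t h ?_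
  apply mul_left_cancel₀ (X_sub_X_ne_zero (K := K) h)
  have h1 := pairT_spec t h f
  have h2 := pairT_swap_spec t h f
  simp only [smul_eq_C_mul, map_sub, map_one]
  linear_combination ((C t - 1) * (X i - X j) - (1 - C t) * X j) * h1 + (C t * X i - X j) * h2

theorem pairT_X_mul_pairT (t : K) {i j : Fin n} (h : i ≠ j) (f : MvPolynomial (Fin n) K) :
    pairT t i j (X i * pairT t i j f) = t • (X j * f) := by
  refine pairT_eq_of_mul_eq t h ?_
  apply mul_left_cancel₀ (X_sub_X_ne_zero (K := K) h)
  have h1 := pairT_spec t h f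
  have h2 := pairT_swap_spec t h f
  simp only [smul_eq_C_mul, map_mul, rename_X, Equiv.swap_apply_left]
  linear_combination (C t * X i - X j) * X j * h2 - (1 - C t) * X j * X i * h1

theorem pairT_X_mul (t : K) {i j l : Fin n} (h : i ≠ j) (hi : l ≠ i) (hj : l ≠ j)
    (f : MvPolynomial (Fin n) K) : pairT t i j (X l * f) = X l * pairT t i j f := by
  refine pairT_eq_of_mul_eq t h ?_
  have h1 := pairT_spec t h f
  simp only [map_mul, rename_X, Equiv.swap_apply_of_ne_of_ne hi hj]
  linear_combination X l * h1

/-- A homomorphism that maps `x_a`, `x_b` to the same multiple of `x_i`, `x_j` and the other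
variables to polynomials symmetric in `x_i`, `x_j` intertwines the Demazure–Lusztig operators. -/
theorem map_pairT (t : K) {c : K} (hc : c ≠ 0) {a b i j : Fin n} (hab : a ≠ b) (hij : i ≠ j)
    (φ : MvPolynomial (Fin n) K →ₐ[K] MvPolynomial (Fin n) K) (ha : φ (X a) = C c * X i)
    (hb : φ (X b) = C c * X j)
    (hl : ∀ l, l ≠ a → l ≠ b → rename (Equiv.swap i j) (φ (X l)) = φ (X l))
    (f : MvPolynomial (Fin n) K) : φ (pairT t a b f) = pairT t i j (φ f) := by
  have hs : φ.comp (rename (Equiv.swap a b)) = (rename (Equiv.swap i j)).comp φ := by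
    refine algHom_ext fun l => ?_
    rw [AlgHom.comp_apply, AlgHom.comp_apply, rename_X]
    by_cases h1 : l = a
    · subst h1
      rw [Equiv.swap_apply_left, ha, hb, map_mul, rename_C, rename_X, Equiv.swap_apply_left]
    by_cases h2 : l = b
    · subst h2
      rw [Equiv.swap_apply_right, ha, hb, map_mul, rename_C, rename_X, Equiv.swap_apply_right]
    rw [Equiv.swap_apply_of_ne_of_ne h1 h2, hl l h1 h2]
  have hs' : φ (rename (Equiv.swap a b) f) = rename (Equiv.swap i j) (φ f) := by
    rw [← AlgHom.comp_apply, hs, AlgHom.comp_apply]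
  refine (pairT_eq_of_mul_eq t hij ?_).symm
  have h1 := congrArg φ (pairT_spec t hab f)
  have hC : φ (C t) = C t := φ.commutes t
  simp only [map_mul, map_sub, map_add, map_one, ha, hb, hs', hC] at h1
  apply mul_left_cancel₀ (C_ne_zero.mpr hc : (C c : MvPolynomial (Fin n) K) ≠ 0)
  linear_combination h1

theorem rename_swap_comm (σ : Equiv.Perm (Fin n)) (a b : Fin n) (f : MvPolynomial (Fin n) K) :
    rename σ (rename (Equiv.swap a b) f) = rename (Equiv.swap (σ a) (σ b)) (rename σ f) := by
  rw [rename_rename, rename_rename]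
  congr 2
  ext x
  simp only [Function.comp_apply]
  rw [← Equiv.Perm.mul_apply, ← Equiv.Perm.mul_apply, Equiv.mul_swap_eq_swap_mul]

theorem rename_pairT (t : K) (σ : Equiv.Perm (Fin n)) {a b : Fin n} (hab : a ≠ b)
    (f : MvPolynomial (Fin n) K) :
    rename σ (pairT t a b f) = pairT t (σ a) (σ b) (rename σ f) :=
  map_pairT t one_ne_zero hab (σ.injective.ne hab) (rename σ) (by simp) (by simp)
    (fun l h1 h2 => by rw [rename_X, rename_X, Equiv.swap_apply_of_ne_of_ne
      (σ.injective.ne h1) (σ.injective.ne h2)]) f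

theorem pairT_comm (t : K) {a b i j : Fin n} (hab : a ≠ b) (hij : i ≠ j) (hai : a ≠ i)
    (haj : a ≠ j) (hbi : b ≠ i) (hbj : b ≠ j) (f : MvPolynomial (Fin n) K) :
    pairT t a b (pairT t i j f) = pairT t i j (pairT t a b f) := by
  refine pairT_eq_of_mul_eq t hab ?_
  rw [rename_pairT t _ hij, Equiv.swap_apply_of_ne_of_ne hai.symm hbi.symm,
    Equiv.swap_apply_of_ne_of_ne haj.symm hbj.symm]
  apply mul_left_cancel₀ (X_sub_X_ne_zero (K := K) hij)
  have h1 := pairT_spec t hij f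
  have h2 := pairT_spec t hij (rename (Equiv.swap a b) f)
  have h3 := pairT_spec t hij (pairT t a b f)
  have h4 := pairT_spec t hab f
  have h5 := congrArg (rename (Equiv.swap i j)) h4
  simp only [map_mul, map_sub, map_add, map_one, rename_X, rename_C,
    Equiv.swap_apply_of_ne_of_ne hai haj, Equiv.swap_apply_of_ne_of_ne hbi hbj] at h5
  have h6 : rename (Equiv.swap i j) (rename (Equiv.swap a b) f) =
      rename (Equiv.swap a b) (rename (Equiv.swap i j) f) := by
    rw [rename_swap_comm (Equiv.swap i j), Equiv.swap_apply_of_ne_of_ne hai haj,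
      Equiv.swap_apply_of_ne_of_ne hbi hbj]
  rw [h6] at h2 h5
  linear_combination (X a - X b) * h3 + (C t * X i - X j) * h5 + (1 - C t) * X j * h4 -
    (C t * X a - X b) * h2 - (1 - C t) * X b * h1

theorem pairT_braid (t : K) {i j k : Fin n} (hij : i ≠ j) (hjk : j ≠ k) (hik : i ≠ k)
    (f : MvPolynomial (Fin n) K) :
    pairT t i j (pairT t j k (pairT t i j f)) = pairT t j k (pairT t i j (pairT t j k f)) := by
  -- A common denominator: the left side needs x_i − x_j twice, the right side x_j − x_k twice. The
  -- relations e1–e7 and g1–g7 then expand both sides in the images of f under permutations of the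
  -- three variables.
  have hD : ((X i - X j) * (X i - X k) * (X j - X k) * ((X i - X j) * (X j - X k)) :
      MvPolynomial (Fin n) K) ≠ 0 := by
    have h1 := X_sub_X_ne_zero (K := K) hij
    have h2 := X_sub_X_ne_zero (K := K) hjk
    have h3 := X_sub_X_ne_zero (K := K) hik
    positivity
  have s1k : Equiv.swap i j k = k := Equiv.swap_apply_of_ne_of_ne hik.symm hjk.symm
  have s2i : Equiv.swap j k i = i := Equiv.swap_apply_of_ne_of_ne hij hik
  have s3j : Equiv.swap i k j = j := Equiv.swap_apply_of_ne_of_ne hij.symm hjk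
  have e1 := pairT_spec t hij (pairT t j k (pairT t i j f))
  rw [rename_pairT t (Equiv.swap i j) hjk, Equiv.swap_apply_right, s1k,
    rename_pairT t (Equiv.swap i j) hij, Equiv.swap_apply_right, Equiv.swap_apply_left] at e1
  have e2 := pairT_spec t hik (rename (Equiv.swap i j) (pairT t i j f))
  rw [rename_pairT t (Equiv.swap i j) hij, Equiv.swap_apply_right, Equiv.swap_apply_left,
    rename_pairT t (Equiv.swap i k) hij.symm, s3j, Equiv.swap_apply_left] at e2
  have e3 := pairT_spec t hjk (rename (Equiv.swap i k) (rename (Equiv.swap i j) f))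
  have e4 := pairT_spec t hij.symm (rename (Equiv.swap i j) f)
  rw [Equiv.swap_comm j i, rename_swap_rename_swap] at e4
  have e5 := pairT_spec t hjk (pairT t i j f)
  rw [rename_pairT t (Equiv.swap j k) hij, Equiv.swap_apply_left, s2i] at e5
  have e6 := pairT_spec t hik (rename (Equiv.swap j k) f)
  have e7 := pairT_spec t hij f
  have g1 := pairT_spec t hjk (pairT t i j (pairT t j k f))
  rw [rename_pairT t (Equiv.swap j k) hij, Equiv.swap_apply_left, s2i,
    rename_pairT t (Equiv.swap j k) hjk, Equiv.swap_apply_right, Equiv.swap_apply_left] at g1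
  have g2 := pairT_spec t hik (rename (Equiv.swap j k) (pairT t j k f))
  rw [rename_pairT t (Equiv.swap j k) hjk, Equiv.swap_apply_right, Equiv.swap_apply_left,
    rename_pairT t (Equiv.swap i k) hjk.symm, s3j, Equiv.swap_apply_right] at g2
  have g3 := pairT_spec t hij (rename (Equiv.swap i k) (rename (Equiv.swap j k) f))
  have g4 := pairT_spec t hjk.symm (rename (Equiv.swap j k) f)
  rw [Equiv.swap_comm k j, rename_swap_rename_swap] at g4
  have g5 := pairT_spec t hij (pairT t j k f)
  rw [rename_pairT t (Equiv.swap i j) hjk, Equiv.swap_apply_right, s1k] at g5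
  have g6 := pairT_spec t hik (rename (Equiv.swap i j) f)
  have g7 := pairT_spec t hjk f
  -- Both words are the transposition of i and k.
  have hV : rename (Equiv.swap j k) (rename (Equiv.swap i k) (rename (Equiv.swap i j) f)) =
      rename (Equiv.swap i j) (rename (Equiv.swap i k) (rename (Equiv.swap j k) f)) := by
    rw [rename_swap_comm (Equiv.swap i j), Equiv.swap_apply_left, s1k,
      rename_swap_comm (Equiv.swap i j), Equiv.swap_apply_right, s1k,
      rename_swap_comm (Equiv.swap j k) i k, Equiv.swap_apply_right, s2i,
      rename_swap_comm (Equiv.swap j k) i j, Equiv.swap_apply_left, s2i,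
      rename_swap_comm (Equiv.swap i j) i k, Equiv.swap_apply_left, s1k]
  rw [hV] at e3
  apply mul_left_cancel₀ hD
  generalize (C t : MvPolynomial (Fin n) K) = c at *
  generalize (X i : MvPolynomial (Fin n) K) = x at *
  generalize (X j : MvPolynomial (Fin n) K) = y at *
  generalize (X k : MvPolynomial (Fin n) K) = z at *
  linear_combination (y - z) * ((x - y) * (x - z) * (y - z) * e1 +
      (x - y) * (y - z) * (c * x - y) * e2 + (x - y) * (c * x - y) * (c * x - z) * e3 -
      (y - z) * (c * x - y) * (1 - c) * z * e4 + (x - y) * (x - z) * (1 - c) * y * e5 +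
      (x - y) * (1 - c) * y * (c * y - z) * e6 + (x - z) * (1 - c) ^ 2 * y * z * e7) -
    (x - y) * ((x - y) * (x - z) * (y - z) * g1 +
      (x - y) * (y - z) * (c * y - z) * g2 + (y - z) * (c * y - z) * (c * x - z) * g3 -
      (x - y) * (c * y - z) * (1 - c) * z * g4 + (x - z) * (y - z) * (1 - c) * z * g5 +
      (y - z) * (1 - c) * z * (c * x - y) * g6 + (x - z) * (1 - c) ^ 2 * y * z * g7)

end DemazureLusztig
/-! ### Initial and final segments of `List.finRange` -/

section FilterFinRange

theorem filter_le_eq_cons {l : List ℕ} (hl : l.Pairwise (· < ·)) {k : ℕ} (hk : k ∈ l) :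
    l.filter (fun a => k ≤ a) = k :: l.filter (fun a => k + 1 ≤ a) := by
  induction l with
  | nil => simp at hk
  | cons b l ih =>
    rw [List.pairwise_cons] at hl
    rcases List.mem_cons.mp hk with rfl | hk'
    · have : ∀ a ∈ l, (decide (k ≤ a)) = decide (k + 1 ≤ a) := fun a ha => by
        have := hl.1 a ha
        simp; omega
      simp [List.filter_congr this]
    · have := hl.1 k hk'
      have h1 : ¬ k ≤ b := by omega
      have h2 : ¬ k + 1 ≤ b := by omega
      simp only [List.filter_cons, h1, h2, decide_false, Bool.false_eq_true, if_false]
      exact ih hl.2 hk'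

theorem filter_lt_succ_eq_append {l : List ℕ} (hl : l.Pairwise (· < ·)) {k : ℕ} (hk : k ∈ l) :
    l.filter (fun a => a < k + 1) = l.filter (fun a => a < k) ++ [k] := by
  induction l with
  | nil => simp at hk
  | cons b l ih =>
    rw [List.pairwise_cons] at hl
    rcases List.mem_cons.mp hk with rfl | hk'
    · have h1 : ∀ a ∈ l, ¬ a < k + 1 := fun a ha => by have := hl.1 a ha; omega
      have h2 : ∀ a ∈ l, ¬ a < k := fun a ha => by have := hl.1 a ha; omega
      rw [List.filter_cons, List.filter_cons, List.filter_eq_nil_iff.mpr (by simpa using h1),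
        List.filter_eq_nil_iff.mpr (by simpa using h2)]
      simp
    · have := hl.1 k hk'
      have h1 : b < k + 1 := by omega
      have h2 : b < k := by omega
      simp only [List.filter_cons, h1, h2, decide_true, if_true, List.cons_append]
      rw [ih hl.2 hk']

theorem map_val_filter {m : ℕ} (p : ℕ → Bool) :
    ((List.finRange m).filter fun a : Fin m => p a).map Fin.val = (List.range m).filter p := by
  rw [← List.map_coe_finRange_eq_range, List.filter_map]
  rfl

/-- Together with `finRange_filter_lt_succ` this compares consecutive Cherednik operators: Y_k has
one more factor T_k in its upper product than Y_{k+1}, and one factor T_k⁻¹ less in its lower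
product. -/
theorem finRange_filter_le {m : ℕ} (k : Fin m) :
    (List.finRange m).filter (fun a : Fin m => (k : ℕ) ≤ (a : ℕ)) =
      k :: (List.finRange m).filter (fun a : Fin m => (k : ℕ) + 1 ≤ (a : ℕ)) := by
  apply List.map_injective_iff.mpr Fin.val_injective
  rw [map_val_filter (fun a => decide ((k : ℕ) ≤ a)), List.map_cons,
    map_val_filter (fun a => decide ((k : ℕ) + 1 ≤ a))]
  exact filter_le_eq_cons List.pairwise_lt_range (by simp)

theorem finRange_filter_lt_succ {m : ℕ} (k : Fin m) :
    (List.finRange m).filter (fun a : Fin m => (a : ℕ) < (k : ℕ) + 1) =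
      (List.finRange m).filter (fun a : Fin m => (a : ℕ) < (k : ℕ)) ++ [k] := by
  apply List.map_injective_iff.mpr Fin.val_injective
  rw [map_val_filter (fun a => decide (a < (k : ℕ) + 1)), List.map_append,
    map_val_filter (fun a => decide (a < (k : ℕ)))]
  exact filter_lt_succ_eq_append List.pairwise_lt_range (by simp)

theorem finRange_filter_le_of_le {m p : ℕ} (h : m ≤ p) :
    (List.finRange m).filter (fun a : Fin m => p ≤ (a : ℕ)) = [] := by
  rw [List.filter_eq_nil_iff]; intro a _; simp; omega

theorem finRange_filter_lt_of_le {m p : ℕ} (h : m ≤ p) :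
    (List.finRange m).filter (fun a : Fin m => (a : ℕ) < p) = List.finRange m := by
  rw [List.filter_eq_self]; intro a _; simp; omega

theorem finRange_filter_lt_zero {m : ℕ} :
    (List.finRange m).filter (fun a : Fin m => (a : ℕ) < 0) = [] := by
  rw [List.filter_eq_nil_iff]; intro a _; simp

theorem finRange_filter_zero_le {m : ℕ} :
    (List.finRange m).filter (fun a : Fin m => 0 ≤ (a : ℕ)) = List.finRange m := by
  rw [List.filter_eq_self]; intro a _; simp

end FilterFinRange

/-! ### The cyclic shift -/

section CyclicShift

variable {K : Type*} [Field K] {m : ℕ}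

/-- The adjacent transposition `s_k`. -/
def adjSwap (k : Fin m) : Equiv.Perm (Fin (m + 1)) := Equiv.swap k.castSucc k.succ

theorem opS_prod_apply (l : List (Fin m)) (f : MvPolynomial (Fin (m + 1)) K) :
    (l.map opS).prod f = rename ((l.map adjSwap).prod : Equiv.Perm (Fin (m + 1))) f := by
  induction l with
  | nil => simp
  | cons k l ih =>
    rw [List.map_cons, List.prod_cons, List.map_cons, List.prod_cons, Module.End.mul_apply, ih]
    simp [opS, rename_rename, adjSwap, Equiv.Perm.coe_mul]

/-- Truncating the cycle at p makes induction possible; only p = m is used afterwards. -/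
theorem adjSwap_prod_apply (p : ℕ) (hp : p ≤ m) (j : Fin (m + 1)) :
    (((((List.finRange m).filter fun a : Fin m => (a : ℕ) < p).reverse.map adjSwap).prod :
      Equiv.Perm (Fin (m + 1))) j : ℕ) = if (j : ℕ) = 0 then p else if (j : ℕ) ≤ p then j - 1
        else j := by
  induction p with
  | zero =>
    rw [finRange_filter_lt_zero]; simp
    split_ifs with h <;> simp [h]
  | succ p ih =>
    have := finRange_filter_lt_succ (⟨p, hp⟩ : Fin m)
    simp only at this
    rw [this, List.reverse_append, List.reverse_singleton, List.singleton_append, List.map_cons,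
      List.prod_cons, Equiv.Perm.mul_apply]
    generalize ((List.map adjSwap ((List.finRange m).filter fun a : Fin m => (a : ℕ) < p).reverse).prod :
      Equiv.Perm (Fin (m + 1))) = π at ih ⊢
    have h1 := ih (by omega)
    rw [adjSwap, Equiv.swap_apply_def]
    have hj := j.isLt
    split_ifs at h1 ⊢ <;> simp only [Fin.ext_iff, Fin.val_castSucc, Fin.val_succ] at * <;> omega

/-- `ω` as an algebra homomorphism: `f ↦ f(q x_n, x_1, …, x_{n-1})`. -/
noncomputable def cyclicShift (q : K) :
    MvPolynomial (Fin (m + 1)) K →ₐ[K] MvPolynomial (Fin (m + 1)) K :=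
  aeval (Fin.cons (C q * X (Fin.last m)) fun j => X j.castSucc)

theorem cyclicShift_X_zero (q : K) :
    cyclicShift q (X 0 : MvPolynomial (Fin (m + 1)) K) = C q * X (Fin.last m) := by
  simp [cyclicShift]

theorem cyclicShift_X_succ (q : K) (j : Fin m) :
    cyclicShift q (X j.succ : MvPolynomial (Fin (m + 1)) K) = X j.castSucc := by
  simp [cyclicShift]

/-- Since ω is an algebra homomorphism, its commutation relations need to be checked on variables
only. -/
theorem opOmega_apply (q : K) (f : MvPolynomial (Fin (m + 1)) K) :
    opOmega q f = cyclicShift q f := by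
  have hval := adjSwap_prod_apply m le_rfl
  rw [finRange_filter_lt_of_le le_rfl] at hval
  rw [opOmega, Module.End.mul_apply, opS_prod_apply]
  generalize ((List.map adjSwap (List.finRange m).reverse).prod :
      Equiv.Perm (Fin (m + 1))) = π at hval ⊢
  change ((rename π).comp (aeval _)) f = cyclicShift q f
  congr 1
  refine algHom_ext fun j => ?_
  rw [AlgHom.comp_apply, aeval_X]
  refine Fin.cases ?_ (fun j => ?_) j
  · have h : π 0 = Fin.last m := Fin.ext (by simpa using hval 0)
    simp [cyclicShift_X_zero, h]
  · have h : π j.succ = j.castSucc := Fin.ext (by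
      have := hval j.succ
      have hj := j.isLt
      simp at this ⊢
      omega)
    simp [cyclicShift_X_succ, h]

end CyclicShift

/-! ### Relations of the affine Hecke algebra -/

section HeckeRelations

variable {K : Type*} [Field K] {m : ℕ}

theorem opT_quadratic (t : K) (k : Fin m) : opT t k * opT t k = (t - 1) • opT t k + t • 1 := by
  refine LinearMap.ext fun f => ?_
  rw [opT_eq_pairT]
  exact pairT_quadratic t k.castSucc_lt_succ.ne f

theorem opT_mul_opTinv {t : K} (ht : t ≠ 0) (k : Fin m) : opT t k * opTinv t k = 1 := by
  rw [opTinv, mul_add, mul_smul_comm, mul_smul_comm, opT_quadratic, mul_one, smul_add, smul_smul,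
    smul_smul, inv_mul_cancel₀ ht, one_smul, ← add_assoc, ← add_smul]
  have : t⁻¹ - 1 + t⁻¹ * (t - 1) = 0 := by field_simp; ring
  rw [this, zero_smul, zero_add]

theorem opTinv_mul_opT {t : K} (ht : t ≠ 0) (k : Fin m) : opTinv t k * opT t k = 1 := by
  rw [← opT_mul_opTinv ht k, opTinv, add_mul, mul_add, smul_mul_assoc, mul_smul_comm, one_mul,
    mul_one, smul_mul_assoc, mul_smul_comm]

theorem commute_opTinv {t : K} {k : Fin m} {A : Module.End K (MvPolynomial (Fin (m + 1)) K)}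
    (h : Commute A (opT t k)) : Commute A (opTinv t k) :=
  ((Commute.one_right A).smul_right _).add_right (h.smul_right _)

theorem opT_braid (t : K) {k l : Fin m} (h : (l : ℕ) = k + 1) :
    opT t k * opT t l * opT t k = opT t l * opT t k * opT t l := by
  have hs : k.succ = l.castSucc := Fin.ext (by simp [h])
  refine LinearMap.ext fun f => ?_
  simp only [opT_eq_pairT, Module.End.mul_apply, hs]
  have := Fin.ext_iff.mp hs
  refine pairT_braid t ?_ ?_ ?_ f <;> simp only [Ne, Fin.ext_iff, Fin.val_castSucc, Fin.val_succ] <;> omega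

theorem opT_comm (t : K) {k l : Fin m} (h : (k : ℕ) + 1 < l) : Commute (opT t k) (opT t l) := by
  refine LinearMap.ext fun f => ?_
  simp only [opT_eq_pairT, Module.End.mul_apply]
  refine pairT_comm t ?_ ?_ ?_ ?_ ?_ ?_ f <;> simp only [Ne, Fin.ext_iff, Fin.val_castSucc, Fin.val_succ] <;> omega

/-- The braid relation in the form in which T_k crosses the two inverses that do not commute with
it, coming out with its index raised by one. -/
theorem opT_mul_opT_comm_opTinv {t : K} (ht : t ≠ 0) {k l : Fin m} (h : (l : ℕ) = k + 1) :
    opTinv t k * opTinv t l * opT t k = opT t l * opTinv t k * opTinv t l := by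
  calc opTinv t k * opTinv t l * opT t k
      = opTinv t k * opTinv t l * opT t k * (opT t l * (opT t k * opTinv t k) * opTinv t l) := by
        rw [opT_mul_opTinv ht, mul_one, opT_mul_opTinv ht, mul_one]
    _ = opTinv t k * opTinv t l * (opT t k * opT t l * opT t k) * opTinv t k * opTinv t l := by
        simp only [mul_assoc]
    _ = opTinv t k * (opTinv t l * opT t l) * opT t k * opT t l * opTinv t k * opTinv t l := by
        rw [opT_braid t h]; simp only [mul_assoc]
    _ = opT t l * opTinv t k * opTinv t l := by
        rw [opTinv_mul_opT ht, mul_one, opTinv_mul_opT ht, one_mul]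

/-- Multiplication by the variable `x_j`. -/
noncomputable def mulX (j : Fin (m + 1)) : Module.End K (MvPolynomial (Fin (m + 1)) K) :=
  LinearMap.mulLeft K (X j)

theorem opT_mul_mulX_mul_opT (t : K) (k : Fin m) :
    opT t k * mulX k.castSucc * opT t k = t • mulX k.succ := by
  refine LinearMap.ext fun f => ?_
  rw [opT_eq_pairT]
  exact pairT_X_mul_pairT t k.castSucc_lt_succ.ne f

theorem opTinv_mul_mulX {t : K} (ht : t ≠ 0) (k : Fin m) :
    opTinv t k * mulX k.succ = t⁻¹ • (mulX k.castSucc * opT t k) := by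
  have h : mulX k.succ = t⁻¹ • (opT t k * mulX k.castSucc * opT t k) := by
    rw [opT_mul_mulX_mul_opT, smul_smul, inv_mul_cancel₀ ht, one_smul]
  rw [h, mul_smul_comm, ← mul_assoc, ← mul_assoc, opTinv_mul_opT ht, one_mul]

theorem opT_mul_mulX {t : K} (ht : t ≠ 0) (k : Fin m) :
    opT t k * mulX k.castSucc = t • (mulX k.succ * opTinv t k) := by
  rw [← smul_mul_assoc, ← opT_mul_mulX_mul_opT, mul_assoc _ (opT t k), opT_mul_opTinv ht, mul_one]

theorem commute_mulX_opT (t : K) {k : Fin m} {j : Fin (m + 1)} (h1 : j ≠ k.castSucc)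
    (h2 : j ≠ k.succ) : Commute (mulX j) (opT t k) := by
  refine LinearMap.ext fun f => ?_
  rw [opT_eq_pairT]
  exact (pairT_X_mul t k.castSucc_lt_succ.ne h1 h2 f).symm

theorem opOmega_mul_mulX_zero (q : K) :
    opOmega q * mulX (0 : Fin (m + 1)) = q • (mulX (Fin.last m) * opOmega q) := by
  refine LinearMap.ext fun f => ?_
  simp [mulX, opOmega_apply, cyclicShift_X_zero, smul_eq_C_mul, mul_assoc]

theorem opOmega_mul_mulX_succ (q : K) (j : Fin m) :
    opOmega q * mulX j.succ = mulX j.castSucc * opOmega q := by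
  refine LinearMap.ext fun f => ?_
  simp [mulX, opOmega_apply, cyclicShift_X_succ]

theorem opOmega_mul_opT (q t : K) {k l : Fin m} (h : (l : ℕ) = k + 1) :
    opOmega q * opT t l = opT t k * opOmega q := by
  obtain ⟨a, ha⟩ : ∃ a : Fin m, l.castSucc = a.succ := ⟨k, Fin.ext (by simp [h])⟩
  have hak : a = k := Fin.ext (by have := Fin.ext_iff.mp ha; simp at this; omega)
  have hkl : k.succ = l.castSucc := Fin.ext (by simp [h])
  subst hak
  refine LinearMap.ext fun f => ?_
  simp only [opT_eq_pairT, Module.End.mul_apply, opOmega_apply, ha]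
  rw [hkl]
  have hne : a.castSucc ≠ l.castSucc := by
    rw [ha]; exact a.castSucc_lt_succ.ne
  refine map_pairT t one_ne_zero (ha ▸ l.castSucc_lt_succ.ne) hne (cyclicShift q)
    (by rw [← hkl, cyclicShift_X_succ, map_one, one_mul])
    (by rw [cyclicShift_X_succ, map_one, one_mul]) (fun j h1 h2 => ?_) f
  induction j using Fin.cases with
  | zero =>
    rw [cyclicShift_X_zero, map_mul, rename_C, rename_X, Equiv.swap_apply_of_ne_of_ne
      (Fin.castSucc_lt_last a).ne' (Fin.castSucc_lt_last l).ne']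
  | succ j =>
    rw [cyclicShift_X_succ, rename_X, Equiv.swap_apply_of_ne_of_ne] <;>
    · intro h
      obtain rfl := Fin.castSucc_injective _ h
      first | exact h1 hkl | exact h2 rfl

/-- `ω² T_1 = T_{n-1} ω²`. -/
theorem opOmega_sq_mul_opT (q t : K) (hq : q ≠ 0) (k0 kl : Fin m) (h0 : (k0 : ℕ) = 0)
    (hl : (kl : ℕ) + 1 = m) :
    opOmega q * opOmega q * opT t k0 = opT t kl * (opOmega q * opOmega q) := by
  refine LinearMap.ext fun f => ?_
  have e0 : k0.castSucc = 0 := Fin.ext (by simp [h0])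
  have el : kl.succ = Fin.last m := Fin.ext (by simp [hl])
  have hlast : Fin.last m = kl.succ := el.symm
  have hX0 : cyclicShift q (cyclicShift q (X 0 : MvPolynomial (Fin (m + 1)) K)) =
      C q * X kl.castSucc := by
    rw [cyclicShift_X_zero, hlast, map_mul, cyclicShift_X_succ]; simp [cyclicShift]
  have hX1 : cyclicShift q (cyclicShift q (X k0.succ : MvPolynomial (Fin (m + 1)) K)) =
      C q * X kl.succ := by
    rw [cyclicShift_X_succ, e0, cyclicShift_X_zero, el]
  have hX : ∀ j : Fin (m + 1), j ≠ 0 → j ≠ k0.succ → ∃ a : Fin (m + 1),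
      cyclicShift q (cyclicShift q (X j : MvPolynomial (Fin (m + 1)) K)) = X a ∧
        a ≠ kl.castSucc ∧ a ≠ kl.succ := by
    intro j hj0 hj1
    obtain ⟨a, rfl⟩ := Fin.exists_succ_eq.mpr hj0
    have ha : a.castSucc ≠ 0 := by
      intro h
      apply hj1
      have := Fin.ext_iff.mp h
      exact Fin.ext (by simp at this ⊢; omega)
    obtain ⟨b, hb⟩ := Fin.exists_succ_eq.mpr ha
    refine ⟨b.castSucc, by rw [cyclicShift_X_succ, ← hb, cyclicShift_X_succ], ?_, ?_⟩ <;>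
    · have := Fin.ext_iff.mp hb
      have := a.isLt
      simp only [Ne, Fin.ext_iff, Fin.val_succ, Fin.val_castSucc] at *
      omega
  simp only [opT_eq_pairT, Module.End.mul_apply, opOmega_apply, e0]
  -- ω scales x_1 but not x_2, so it does not intertwine at this pair. ω² sends both variables to q
  -- times a variable, and `map_pairT` applies with the common factor q.
  have := map_pairT t hq (e0 ▸ k0.castSucc_lt_succ.ne) kl.castSucc_lt_succ.ne
    ((cyclicShift q).comp (cyclicShift q)) hX0 hX1 (fun j h1 h2 => by
      obtain ⟨a, ha, ha1, ha2⟩ := hX j h1 h2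
      rw [AlgHom.comp_apply, ha, rename_X, Equiv.swap_apply_of_ne_of_ne ha1 ha2]) f
  simpa only [AlgHom.comp_apply] using this

end HeckeRelations

/-! ### Relations between the Cherednik operators -/

section CherednikRelations

variable {K : Type*} [Field K] {m : ℕ}

/-- `T_{i+1} ⋯ T_{n-1}`, the indices `k ≥ i` counted from `0`. -/
noncomputable def upperT (t : K) (i : ℕ) : Module.End K (MvPolynomial (Fin (m + 1)) K) :=
  (((List.finRange m).filter fun k : Fin m => i ≤ (k : ℕ)).map (opT t)).prod

/-- `T_1 ⋯ T_i`, the indices `k < i` counted from `0`. -/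
noncomputable def lowerT (t : K) (i : ℕ) : Module.End K (MvPolynomial (Fin (m + 1)) K) :=
  (((List.finRange m).filter fun k : Fin m => (k : ℕ) < i).map (opT t)).prod

/-- `T_1⁻¹ ⋯ T_i⁻¹`, the indices `k < i` counted from `0`. -/
noncomputable def lowerTinv (t : K) (i : ℕ) : Module.End K (MvPolynomial (Fin (m + 1)) K) :=
  (((List.finRange m).filter fun k : Fin m => (k : ℕ) < i).map (opTinv t)).prod

theorem opY_eq (q t : K) (i : Fin (m + 1)) :
    opY q t i = t ^ ((i : ℤ) - (m : ℤ)) • (upperT t i * opOmega q * lowerTinv t i) := rfl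

theorem upperT_eq (t : K) (k : Fin m) : upperT t k = opT t k * upperT t (k + 1) := by
  rw [upperT, finRange_filter_le, List.map_cons, List.prod_cons, upperT]

theorem lowerT_succ (t : K) (k : Fin m) : lowerT t (k + 1) = lowerT t k * opT t k := by
  rw [lowerT, finRange_filter_lt_succ, List.map_append, List.prod_append, lowerT]; simp

theorem lowerTinv_succ (t : K) (k : Fin m) :
    lowerTinv t (k + 1) = lowerTinv t k * opTinv t k := by
  rw [lowerTinv, finRange_filter_lt_succ, List.map_append, List.prod_append, lowerTinv]; simp

theorem lowerT_zero (t : K) : (lowerT t 0 : Module.End K (MvPolynomial (Fin (m + 1)) K)) = 1 := by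
  rw [lowerT, finRange_filter_lt_zero]; simp

theorem lowerTinv_zero (t : K) :
    (lowerTinv t 0 : Module.End K (MvPolynomial (Fin (m + 1)) K)) = 1 := by
  rw [lowerTinv, finRange_filter_lt_zero]; simp

theorem upperT_zero (t : K) :
    (upperT t 0 : Module.End K (MvPolynomial (Fin (m + 1)) K)) = lowerT t m := by
  rw [upperT, finRange_filter_zero_le, lowerT, finRange_filter_lt_of_le le_rfl]

theorem upperT_self (t : K) :
    (upperT t m : Module.End K (MvPolynomial (Fin (m + 1)) K)) = 1 := by
  rw [upperT, finRange_filter_le_of_le le_rfl]; simp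

theorem opY_last (q t : K) : opY q t (Fin.last m) = opOmega q * lowerTinv t m := by
  rw [opY_eq]; simp [upperT_self]

theorem opY_zero (q t : K) :
    opY q t (0 : Fin (m + 1)) = t ^ (-(m : ℤ)) • (lowerT t m * opOmega q) := by
  rw [opY_eq]; simp [upperT_zero, lowerTinv_zero]

/-- The left T_k supplies the missing first factor and the right one cancels the last inverse.
Further relations for the Y_i are derived by downward induction from this recursion. -/
theorem smul_opY_castSucc {t : K} (ht : t ≠ 0) (q : K) (k : Fin m) :
    t • opY q t k.castSucc = opT t k * opY q t k.succ * opT t k := by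
  rw [opY_eq, opY_eq, Fin.val_castSucc, Fin.val_succ, upperT_eq, lowerTinv_succ, mul_smul_comm,
    smul_mul_assoc, smul_smul, ← zpow_one_add₀ ht]
  have h : ((k : ℕ) + 1 : ℕ) - (m : ℤ) = 1 + ((k : ℤ) - m) := by push_cast; ring
  rw [h]
  congr 1
  simp only [mul_assoc]
  rw [opTinv_mul_opT ht, mul_one]

theorem commute_list_prod_map {ι M : Type*} [Monoid M] {a : M} {f : ι → M} {l : List ι}
    (h : ∀ i ∈ l, Commute a (f i)) : Commute a (l.map f).prod := by
  apply Commute.list_prod_right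
  intro x hx
  obtain ⟨i, hi, rfl⟩ := List.mem_map.mp hx
  exact h i hi

theorem opOmega_mul_opTinv (q t : K) {k l : Fin m} (h : (l : ℕ) = k + 1) :
    opOmega q * opTinv t l = opTinv t k * opOmega q := by
  rw [opTinv, opTinv, mul_add, add_mul, mul_smul_comm, mul_smul_comm, smul_mul_assoc,
    smul_mul_assoc, mul_one, one_mul, opOmega_mul_opT q t h]

/-- Only the factors T_k⁻¹ T_{k+1}⁻¹ matter, where the braid relation raises the index. The factors
to their right commute with T_k, those to their left with T_{k+1}. -/
theorem lowerTinv_mul_opT {t : K} (ht : t ≠ 0) {k l : Fin m} (h : (l : ℕ) = k + 1) {i : ℕ}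
    (hi : (l : ℕ) + 1 ≤ i) (him : i ≤ m) :
    lowerTinv t i * opT t k = opT t l * lowerTinv t i := by
  induction i, hi using Nat.le_induction with
  | base =>
    have hc : Commute (opT t l) (lowerTinv t k) := by
      refine commute_list_prod_map fun a ha => commute_opTinv ?_
      have : (a : ℕ) < k := by simpa using ha
      exact (opT_comm t (by omega)).symm
    rw [lowerTinv_succ, h, lowerTinv_succ, mul_assoc, mul_assoc, ← mul_assoc (opTinv t k),
      opT_mul_opT_comm_opTinv ht h, ← mul_assoc, ← mul_assoc, ← hc.eq]
    simp only [mul_assoc]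
  | succ i hi ih =>
    have hc : Commute (opT t k) (opTinv t ⟨i, him⟩) :=
      commute_opTinv (opT_comm t (by simp; omega))
    have := lowerTinv_succ t (⟨i, him⟩ : Fin m)
    simp only at this
    rw [this, mul_assoc, ← hc.eq, ← mul_assoc, ih (by omega), mul_assoc]

/-- For the last operator, ω undoes the index shift of `lowerTinv_mul_opT`. The recursion t Y_k =
T_k Y_{k+1} T_k carries this downwards. The case j = k + 1 is the delicate one: expanding the
recursion twice leaves Y_{k+2}, which commutes with T_k, between two braid words. -/
theorem commute_opT_opY {t : K} (ht : t ≠ 0) (q : K) (j : Fin m) (i : Fin (m + 1))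
    (h1 : i ≠ j.castSucc) (h2 : i ≠ j.succ) : Commute (opT t j) (opY q t i) := by
  -- Here d bounds the distance from i to the last index.
  suffices H : ∀ d : ℕ, ∀ i : Fin (m + 1), m ≤ i + d → ∀ j : Fin m, i ≠ j.castSucc → i ≠ j.succ →
      Commute (opT t j) (opY q t i) from H m i (by omega) j h1 h2
  intro d
  induction d with
  | zero =>
    intro i hi j h1 h2
    obtain rfl : i = Fin.last m := Fin.ext (by have := i.isLt; simp; omega)
    have hj : (j : ℕ) + 1 < m := by
      have := j.isLt
      simp only [Ne, Fin.ext_iff, Fin.val_last, Fin.val_succ] at h2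
      omega
    rw [opY_last, Commute, SemiconjBy, mul_assoc,
      lowerTinv_mul_opT ht (k := j) (l := ⟨j + 1, hj⟩) rfl (by simpa using hj) le_rfl,
      ← mul_assoc, ← mul_assoc, opOmega_mul_opT q t (k := j) (l := ⟨j + 1, hj⟩) rfl]
  | succ d ih =>
    intro i hi j h1 h2
    by_cases hid : m ≤ i + d
    · exact ih i hid j h1 h2
    obtain ⟨k, rfl⟩ : ∃ k : Fin m, i = k.castSucc := ⟨⟨i, by omega⟩, rfl⟩
    rw [Fin.val_castSucc] at hi hid
    simp only [Ne, Fin.ext_iff, Fin.val_castSucc, Fin.val_succ] at h1 h2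
    suffices h : Commute (opT t j) (t • opY q t k.castSucc) by
      have := h.smul_right t⁻¹
      rwa [smul_smul, inv_mul_cancel₀ ht, one_smul] at this
    rw [smul_opY_castSucc ht]
    by_cases hjk : (j : ℕ) = k + 1
    · have hsucc : k.succ = j.castSucc := Fin.ext (by simp [hjk])
      have hY : Commute (opT t k) (opY q t j.succ) := by
        apply ih
        · rw [Fin.val_succ]; omega
        · simp only [Ne, Fin.ext_iff, Fin.val_castSucc, Fin.val_succ]; omega
        · simp only [Ne, Fin.ext_iff, Fin.val_succ]; omega
      suffices h : Commute (opT t j) (opT t k * (t • opY q t k.succ) * opT t k) by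
        have := h.smul_right t⁻¹
        rwa [mul_smul_comm, smul_mul_assoc, smul_smul, inv_mul_cancel₀ ht, one_smul] at this
      rw [hsucc, smul_opY_castSucc ht, Commute, SemiconjBy]
      calc opT t j * (opT t k * (opT t j * opY q t j.succ * opT t j) * opT t k)
          = (opT t j * opT t k * opT t j) * opY q t j.succ * opT t j * opT t k := by
            simp only [mul_assoc]
        _ = opT t k * opT t j * (opT t k * opY q t j.succ) * opT t j * opT t k := by
            rw [← opT_braid t hjk]; simp only [mul_assoc]
        _ = opT t k * opT t j * opY q t j.succ * (opT t k * opT t j * opT t k) := by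
            rw [hY.eq]; simp only [mul_assoc]
        _ = _ := by rw [opT_braid t hjk]; simp only [mul_assoc]
    · have hT : Commute (opT t j) (opT t k) := by
        rcases lt_or_ge (j : ℕ) k with h | h
        · exact opT_comm t (by omega)
        · exact (opT_comm t (by omega)).symm
      have hY : Commute (opT t j) (opY q t k.succ) := by
        apply ih
        · rw [Fin.val_succ]; omega
        · simp only [Ne, Fin.ext_iff, Fin.val_castSucc, Fin.val_succ]; omega
        · simp only [Ne, Fin.ext_iff, Fin.val_succ]; omega
      exact (hT.mul_right hY).mul_right hT

/-- The raising operator `f ↦ x_n f(q x_n, x_1, …, x_{n-1})`. -/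
noncomputable def opPsi (q : K) : Module.End K (MvPolynomial (Fin (m + 1)) K) :=
  mulX (Fin.last m) * opOmega q

theorem lowerTinv_mul_mulX {t : K} (ht : t ≠ 0) (i : Fin (m + 1)) :
    lowerTinv t i * mulX i = t ^ (-(i : ℤ)) • (mulX 0 * lowerT t i) := by
  induction i using Fin.induction with
  | zero => simp [lowerTinv_zero, lowerT_zero]
  | succ k ih =>
    rw [Fin.val_castSucc] at ih
    rw [Fin.val_succ, lowerTinv_succ, lowerT_succ, mul_assoc, opTinv_mul_mulX ht, mul_smul_comm,
      ← mul_assoc, ih, smul_mul_assoc, smul_smul, mul_assoc, ← zpow_neg_one, ← zpow_add₀ ht]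
    congr 2
    push_cast; ring

/-- Moving x_n leftwards through the inverses turns it into x_1 and them into the T_k. Then ω x_1 =
q x_n ω, and what remains is Y_1. -/
theorem opY_last_mul_opPsi {t : K} (ht : t ≠ 0) (q : K) :
    opY q t (Fin.last m) * opPsi q = q • (opPsi q * opY q t 0) := by
  have h := lowerTinv_mul_mulX ht (Fin.last m)
  rw [Fin.val_last] at h
  rw [opY_last, opPsi, opY_zero, mul_assoc, ← mul_assoc (lowerTinv t m), h, smul_mul_assoc,
    mul_smul_comm, mul_assoc, ← mul_assoc (opOmega q), opOmega_mul_mulX_zero, smul_mul_assoc,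
    mul_smul_comm, smul_comm]

theorem lowerTinv_mul_opOmega {t : K} (ht : t ≠ 0) (q : K) (k0 : Fin m) (h0 : (k0 : ℕ) = 0)
    {i : ℕ} (hi : i + 1 ≤ m) :
    lowerTinv t i * opOmega q = opOmega q * opT t k0 * lowerTinv t (i + 1) := by
  induction i with
  | zero =>
    have := lowerTinv_succ t k0
    rw [h0] at this
    rw [this, lowerTinv_zero, one_mul, one_mul, mul_assoc, opT_mul_opTinv ht, mul_one]
  | succ i ih =>
    have e1 := lowerTinv_succ t (⟨i, by omega⟩ : Fin m)
    have e2 := lowerTinv_succ t (⟨i + 1, by omega⟩ : Fin m)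
    simp only at e1 e2
    have e3 := opOmega_mul_opTinv q t (k := (⟨i, by omega⟩ : Fin m)) (l := ⟨i + 1, by omega⟩) rfl
    rw [e2, e1, mul_assoc, ← e3, ← mul_assoc, ih (by omega), e1]
    simp only [mul_assoc]

/-- Downward induction from the last pair. The base case rests on the wrap-around relation
`opOmega_sq_mul_opT`. The step uses T_k Φ = Φ T_{k+1} with the recursion for the Y_i. -/
theorem opY_castSucc_mul_opPsi {q t : K} (ht : t ≠ 0) (hq : q ≠ 0) (k : Fin m) :
    opY q t k.castSucc * opPsi q = opPsi q * opY q t k.succ := by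
  suffices H : ∀ d : ℕ, ∀ k : Fin m, m ≤ k + 1 + d →
      opY q t k.castSucc * opPsi q = opPsi q * opY q t k.succ from H m k (by omega)
  intro d
  induction d with
  | zero =>
    intro k hk
    have hkm : (k : ℕ) + 1 = m := by omega
    have hlast : k.succ = Fin.last m := Fin.ext (by simp [hkm])
    have hc : Commute (mulX k.succ) (lowerTinv t k) := by
      refine commute_list_prod_map fun a ha => commute_opTinv (commute_mulX_opT t ?_ ?_) <;>
      · have : (a : ℕ) < k := by simpa using ha
        simp only [Ne, Fin.ext_iff, Fin.val_castSucc, Fin.val_succ]; omega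
    have e1 := lowerTinv_mul_opOmega ht q (⟨0, by omega⟩ : Fin m) rfl hkm.le
    have e2 := opOmega_sq_mul_opT q t hq (⟨0, by omega⟩ : Fin m) k rfl hkm
    have e3 : ((k : ℕ) : ℤ) - m = -1 := by omega
    rw [hkm] at e1
    rw [hlast, opY_last, opY_eq, Fin.val_castSucc, upperT_eq, hkm, upperT_self, mul_one, opPsi,
      ← hlast, e3]
    calc t ^ (-1 : ℤ) • (opT t k * opOmega q * lowerTinv t k) * (mulX k.succ * opOmega q)
        = t ^ (-1 : ℤ) • (opT t k * opOmega q * (lowerTinv t k * mulX k.succ) * opOmega q) := by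
          rw [smul_mul_assoc]; simp only [mul_assoc]
      _ = t ^ (-1 : ℤ) • (opT t k * (opOmega q * mulX k.succ) * (lowerTinv t k * opOmega q)) := by
          rw [← hc.eq]; simp only [mul_assoc]
      _ = t ^ (-1 : ℤ) • ((opT t k * mulX k.castSucc) * opOmega q * (lowerTinv t k * opOmega q)) := by
          rw [opOmega_mul_mulX_succ]; simp only [mul_assoc]
      _ = mulX k.succ * opTinv t k * (opOmega q * opOmega q * opT t ⟨0, by omega⟩) *
            lowerTinv t m := by
          rw [opT_mul_mulX ht, e1, smul_mul_assoc, smul_mul_assoc, smul_smul, zpow_neg_one,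
            inv_mul_cancel₀ ht, one_smul]
          simp only [mul_assoc]
      _ = mulX k.succ * (opTinv t k * opT t k) * (opOmega q * opOmega q) * lowerTinv t m := by
          rw [e2]; simp only [mul_assoc]
      _ = mulX k.succ * opOmega q * (opOmega q * lowerTinv t m) := by
          rw [opTinv_mul_opT ht, mul_one]; simp only [mul_assoc]
  | succ d ih =>
    intro k hk
    by_cases hkd : m ≤ k + 1 + d
    · exact ih k hkd
    obtain ⟨l, hl⟩ : ∃ l : Fin m, (l : ℕ) = k + 1 := ⟨⟨k + 1, by omega⟩, rfl⟩
    have hsucc : k.succ = l.castSucc := Fin.ext (by simp [hl])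
    have hT : opT t k * opPsi q = opPsi q * opT t l := by
      have hc : Commute (mulX (Fin.last m)) (opT t k) := by
        apply commute_mulX_opT <;>
        · simp only [Ne, Fin.ext_iff, Fin.val_castSucc, Fin.val_succ, Fin.val_last]; omega
      rw [opPsi, ← mul_assoc, ← hc.eq, mul_assoc, ← opOmega_mul_opT q t hl, mul_assoc]
    have hY := ih l (by omega)
    have e1 := smul_opY_castSucc ht q k
    have e2 := smul_opY_castSucc ht q l
    have : t • (opY q t k.castSucc * opPsi q) = t • (opPsi q * opY q t k.succ) := by
      rw [← smul_mul_assoc, e1, ← mul_smul_comm, hsucc, e2]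
      rw [mul_assoc, hT, mul_assoc, ← mul_assoc _ (opPsi q), hY, ← mul_assoc, ← mul_assoc, hT]
      simp only [mul_assoc]
    have := congrArg (t⁻¹ • ·) this
    simpa only [smul_smul, inv_mul_cancel₀ ht, one_smul] using this

end CherednikRelations

/-! ### The order on compositions -/

section Order

variable {n : ℕ}

theorem sum_Iic_eq_sum_Iio_add (η : Fin n → ℕ) (p : Fin n) :
    ∑ i ∈ Finset.Iic p, η i = ∑ i ∈ Finset.Iio p, η i + η p := by
  rw [← Finset.Iio_insert, Finset.sum_insert (by simp), add_comm]

theorem sum_Iio_zero {m : ℕ} (η : Fin (m + 1) → ℕ) : ∑ i ∈ Finset.Iio 0, η i = 0 :=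
  Finset.sum_eq_zero fun i hi => absurd (Finset.mem_Iio.mp hi) (Fin.not_lt_zero i)

theorem sum_Iio_succ {m : ℕ} (η : Fin (m + 1) → ℕ) (k : Fin m) :
    ∑ i ∈ Finset.Iio k.succ, η i = ∑ i ∈ Finset.Iic k.castSucc, η i := by
  refine Finset.sum_congr (Finset.ext fun i => ?_) fun _ _ => rfl
  simp [Fin.lt_def, Fin.le_def]

theorem eq_of_sum_Iic_eq {ν η : Fin n → ℕ}
    (h : ∀ p, ∑ i ∈ Finset.Iic p, ν i = ∑ i ∈ Finset.Iic p, η i) : ν = η := by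
  cases n with
  | zero => exact Subsingleton.elim _ _
  | succ m =>
    funext p
    have hp := h p
    rw [sum_Iic_eq_sum_Iio_add, sum_Iic_eq_sum_Iio_add] at hp
    cases p using Fin.cases with
    | zero => simpa [sum_Iio_zero] using hp
    | succ k => rwa [sum_Iio_succ, sum_Iio_succ, h, Nat.add_left_cancel_iff] at hp

/-- A numerical rank for dominance; it yields irreflexivity and well-foundedness of ≺ and the
existence of maximal exponents. -/
theorem DomLT.sum_lt {ν η : Fin n → ℕ} (h : DomLT ν η) :
    ∑ p, ∑ i ∈ Finset.Iic p, ν i < ∑ p, ∑ i ∈ Finset.Iic p, η i := by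
  refine Finset.sum_lt_sum (fun p _ => h.2 p) ?_
  by_contra! hc
  exact h.1 (eq_of_sum_Iic_eq fun p => le_antisymm (h.2 p) (hc p (Finset.mem_univ p)))

theorem DomLT.trans {μ ν η : Fin n → ℕ} (h : DomLT μ ν) (h' : DomLT ν η) : DomLT μ η := by
  refine ⟨?_, fun p => (h.2 p).trans (h'.2 p)⟩
  rintro rfl
  exact lt_asymm h.sum_lt h'.sum_lt

theorem Prec.trans {μ ν η : Fin n → ℕ} (h : Prec μ ν) (h' : Prec ν η) : Prec μ η := by
  refine ⟨h.1.trans h'.1, ?_⟩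
  rcases h.2 with h1 | ⟨h1, h2⟩ <;> rcases h'.2 with h3 | ⟨h3, h4⟩
  · exact Or.inl (h1.trans h3)
  · exact Or.inl (h3 ▸ h1)
  · exact Or.inl (h1 ▸ h3)
  · exact Or.inr ⟨h1.trans h3, h2.trans h4⟩

/-- A statistic that increases strictly along `≺`. -/
def precRank (η : Fin n → ℕ) : ℕ ×ₗ ℕ :=
  toLex (∑ p, ∑ i ∈ Finset.Iic p, partitionOf η i, ∑ p, ∑ i ∈ Finset.Iic p, η i)

theorem Prec.rank_lt {ν η : Fin n → ℕ} (h : Prec ν η) : precRank ν < precRank η := by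
  rw [precRank, precRank, Prod.Lex.toLex_lt_toLex]
  rcases h.2 with h1 | ⟨h1, h2⟩
  · exact Or.inl h1.sum_lt
  · exact Or.inr ⟨by simp [h1], h2.sum_lt⟩

theorem Prec.irrefl (η : Fin n → ℕ) : ¬ Prec η η := fun h => lt_irrefl _ h.rank_lt

theorem wellFounded_prec : WellFounded (Prec (n := n)) :=
  Subrelation.wf (fun h => Prec.rank_lt h) (InvImage.wf precRank wellFounded_lt)

theorem partitionOf_comp_perm (η : Fin n → ℕ) (σ : Equiv.Perm (Fin n)) :
    partitionOf (η ∘ σ) = partitionOf η := by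
  funext i
  exact congrFun (Tuple.comp_perm_comp_sort_eq_comp_sort (f := η) (σ := σ)) (Fin.rev i)

theorem sum_comp_partitionOf (η : Fin n → ℕ) (g : ℕ → ℕ) :
    ∑ i, g (partitionOf η i) = ∑ i, g (η i) := by
  obtain ⟨σ, hσ⟩ := partitionOf_perm η
  rw [hσ]
  exact Equiv.sum_comp σ fun i => g (η i)

/-- Exchange argument: entries of S beyond p are at most f p, and they are replaced by equally many
entries that are at least f p. -/
theorem sum_le_sum_Iic_of_antitone {f : Fin n → ℕ} (hf : Antitone f) {p : Fin n}
    {S : Finset (Fin n)} (hS : S.card = (Finset.Iic p).card) :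
    ∑ i ∈ S, f i ≤ ∑ i ∈ Finset.Iic p, f i := by
  rw [← Finset.sum_inter_add_sum_sdiff S (Finset.Iic p) f,
    ← Finset.sum_inter_add_sum_sdiff (Finset.Iic p) S f, Finset.inter_comm]
  have h1 : ∑ i ∈ S \ Finset.Iic p, f i ≤ (S \ Finset.Iic p).card • f p :=
    Finset.sum_le_card_nsmul _ _ _ fun i hi => hf (by
      simp only [Finset.mem_sdiff, Finset.mem_Iic, not_le] at hi; exact hi.2.le)
  have h2 : (Finset.Iic p \ S).card • f p ≤ ∑ i ∈ Finset.Iic p \ S, f i :=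
    Finset.card_nsmul_le_sum _ _ _ fun i hi => hf (by
      simp only [Finset.mem_sdiff, Finset.mem_Iic] at hi; exact hi.1)
  rw [Finset.card_sdiff_comm hS] at h1
  exact Nat.add_le_add_left (h1.trans h2) _

/-- With `exists_sum_eq_sum_partitionOf`, the partial sums of η⁺ become maxima of sums of η over
sets of given size, so dominance of partitions can be tested without sorting. -/
theorem sum_le_sum_partitionOf (η : Fin n → ℕ) {p : Fin n} {S : Finset (Fin n)}
    (hS : S.card = (Finset.Iic p).card) :
    ∑ i ∈ S, η i ≤ ∑ i ∈ Finset.Iic p, partitionOf η i := by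
  obtain ⟨σ, hσ⟩ := partitionOf_perm η
  have := sum_le_sum_Iic_of_antitone (partitionOf_antitone η) (p := p)
    (S := S.map σ.symm.toEmbedding) (by rw [Finset.card_map, hS])
  refine le_trans (le_of_eq ?_) this
  rw [Finset.sum_map]
  simp [hσ]

theorem exists_sum_eq_sum_partitionOf (η : Fin n → ℕ) (p : Fin n) :
    ∃ S : Finset (Fin n), S.card = (Finset.Iic p).card ∧
      ∑ i ∈ Finset.Iic p, partitionOf η i = ∑ i ∈ S, η i := by
  obtain ⟨σ, hσ⟩ := partitionOf_perm η
  exact ⟨(Finset.Iic p).map σ.toEmbedding, Finset.card_map _, by rw [Finset.sum_map, hσ]; rfl⟩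

theorem sum_eq_sum_sdiff_add_ite (η : Fin n → ℕ) (S : Finset (Fin n)) {i j : Fin n}
    (hij : i ≠ j) : ∑ l ∈ S, η l = ∑ l ∈ S \ {i, j}, η l + (if i ∈ S then η i else 0) +
      (if j ∈ S then η j else 0) := by
  rw [← Finset.sum_inter_add_sum_sdiff S {i, j} η, Finset.inter_comm, ← Finset.sum_ite_mem,
    Finset.sum_pair hij]
  ring

/-- `ν` arises from `η` by moving the parts `i` and `j` closer together, or exchanging them. -/
theorem sum_partitionOf_le_of_move {ν η : Fin n → ℕ} {i j : Fin n} (hij : i ≠ j)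
    (hne : ∀ l, l ≠ i → l ≠ j → ν l = η l) (hsum : ν i + ν j = η i + η j)
    (hi : ν i ≤ max (η i) (η j)) (hj : ν j ≤ max (η i) (η j)) (p : Fin n) :
    ∑ l ∈ Finset.Iic p, partitionOf ν l ≤ ∑ l ∈ Finset.Iic p, partitionOf η l := by
  obtain ⟨S, hS, hν⟩ := exists_sum_eq_sum_partitionOf ν p
  rw [hν]
  -- If S contains just one of i and j, either S or its image under the transposition contains the
  -- row where η is larger, and that entry bounds the one of ν.
  have h1 := sum_le_sum_partitionOf η hS
  have h2 := sum_le_sum_partitionOf η (S := S.map (Equiv.swap i j).toEmbedding)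
    (by rw [Finset.card_map, hS])
  rw [Finset.sum_map, sum_eq_sum_sdiff_add_ite _ S hij] at h2
  rw [sum_eq_sum_sdiff_add_ite _ S hij] at h1 ⊢
  have e1 : ∑ l ∈ S \ {i, j}, ν l = ∑ l ∈ S \ {i, j}, η l :=
    Finset.sum_congr rfl fun l hl => by
      simp at hl; exact hne l (by tauto) (by tauto)
  have e2 : ∑ l ∈ S \ {i, j}, η ((Equiv.swap i j).toEmbedding l) = ∑ l ∈ S \ {i, j}, η l :=
    Finset.sum_congr rfl fun l hl => by
      simp at hl
      simp only [Equiv.coe_toEmbedding]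
      rw [Equiv.swap_apply_of_ne_of_ne (by tauto) (by tauto)]
  simp only [Equiv.coe_toEmbedding, Equiv.swap_apply_left, Equiv.swap_apply_right] at h2 e2
  rw [e2] at h2
  rw [e1]
  split_ifs at * <;> omega

theorem sum_eq_of_move {ν η : Fin n → ℕ} {i j : Fin n} (hij : i ≠ j)
    (hne : ∀ l, l ≠ i → l ≠ j → ν l = η l) (g : ℕ → ℕ) :
    ∑ l, g (ν l) + (g (η i) + g (η j)) = ∑ l, g (η l) + (g (ν i) + g (ν j)) := by
  rw [sum_eq_sum_sdiff_add_ite (fun l => g (ν l)) _ hij,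
    sum_eq_sum_sdiff_add_ite (fun l => g (η l)) _ hij]
  have e1 : ∑ l ∈ Finset.univ \ {i, j}, g (ν l) = ∑ l ∈ Finset.univ \ {i, j}, g (η l) :=
    Finset.sum_congr rfl fun l hl => by
      simp at hl; rw [hne l (by tauto) (by tauto)]
  rw [e1]; simp; ring

/-- Strictness comes from the sum of squares, which depends only on the partition and drops when two
parts move strictly closer. -/
theorem prec_of_move {ν η : Fin n → ℕ} {i j : Fin n} (hij : i ≠ j)
    (hne : ∀ l, l ≠ i → l ≠ j → ν l = η l) (hsum : ν i + ν j = η i + η j)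
    (hi : ν i < max (η i) (η j)) (hj : ν j < max (η i) (η j)) : Prec ν η := by
  refine ⟨?_, Or.inl ⟨fun h => ?_, sum_partitionOf_le_of_move hij hne hsum hi.le hj.le⟩⟩
  · have := sum_eq_of_move hij hne id
    simp only [id] at this
    omega
  · have h1 := sum_eq_of_move hij hne fun a => a ^ 2
    have h2 := sum_comp_partitionOf ν fun a => a ^ 2
    have h3 := sum_comp_partitionOf η fun a => a ^ 2
    rw [h] at h2
    beta_reduce at h1 h2 h3
    rw [← h2, ← h3] at h1
    rcases le_total (η i) (η j) with h4 | h4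
    · rw [max_eq_right h4] at hi hj
      nlinarith
    · rw [max_eq_left h4] at hi hj
      nlinarith

theorem prec_comp_swap {η : Fin n → ℕ} {i j : Fin n} (hij : i < j) (h : η j < η i) :
    Prec (η ∘ Equiv.swap i j) η := by
  refine ⟨Equiv.sum_comp (Equiv.swap i j) η, Or.inr ⟨partitionOf_comp_perm η _, fun h' => ?_,
    fun p => ?_⟩⟩
  · have := congrFun h' i
    simp at this
    omega
  · rw [sum_eq_sum_sdiff_add_ite _ _ hij.ne, sum_eq_sum_sdiff_add_ite η _ hij.ne]
    have e2 : ∑ l ∈ Finset.Iic p \ {i, j}, (η ∘ Equiv.swap i j) l =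
        ∑ l ∈ Finset.Iic p \ {i, j}, η l :=
      Finset.sum_congr rfl fun l hl => by
        simp at hl
        rw [Function.comp_apply, Equiv.swap_apply_of_ne_of_ne (by tauto) (by tauto)]
    rw [e2]
    simp only [Function.comp_apply, Equiv.swap_apply_left, Equiv.swap_apply_right, Finset.mem_Iic]
    have : j ≤ p → i ≤ p := hij.le.trans
    split_ifs <;> omega

/-- Both relations together would force η⁺ = ν⁺ and equality of all partial sums except the one
ending at k. Then ν and η differ in rows k, k + 1 at most, with equal sum and equal sum of squares
there. As ν_k ≤ η_k < η_{k+1}, this means ν = η. The lemma makes s_k η maximal among the exponents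
of s_k E_η. -/
theorem not_prec_comp_adjSwap {m : ℕ} {ν η : Fin (m + 1) → ℕ} (k : Fin m)
    (hk : η k.castSucc < η k.succ) (h : Prec ν η) :
    ¬ Prec (η ∘ adjSwap k) (ν ∘ adjSwap k) := by
  intro h'
  have hr := h.2
  have hr' := h'.2
  rw [partitionOf_comp_perm, partitionOf_comp_perm] at hr'
  have hp : partitionOf ν = partitionOf η ∧ DomLT ν η := by
    rcases hr with h1 | h1
    · rcases hr' with h2 | h2
      · exact absurd h1.sum_lt h2.sum_lt.asymm
      · exact absurd h2.1.symm h1.1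
    · exact h1
  have hp' : DomLT (η ∘ adjSwap k) (ν ∘ adjSwap k) := by
    rcases hr' with h1 | h1
    · exact absurd hp.1.symm h1.1
    · exact h1.2
  have hne : k.castSucc ≠ k.succ := k.castSucc_lt_succ.ne
  have hswap : ∀ (f : Fin (m + 1) → ℕ) (p : Fin (m + 1)), p ≠ k.castSucc →
      ∑ i ∈ Finset.Iic p, (f ∘ adjSwap k) i = ∑ i ∈ Finset.Iic p, f i := by
    intro f p hpk
    have hiff : k.castSucc ≤ p ↔ k.succ ≤ p := by
      simp only [Ne, Fin.ext_iff, Fin.le_def, Fin.val_castSucc, Fin.val_succ] at *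
      omega
    rw [sum_eq_sum_sdiff_add_ite _ _ hne, sum_eq_sum_sdiff_add_ite f _ hne]
    have e2 : ∑ l ∈ Finset.Iic p \ {k.castSucc, k.succ}, (f ∘ adjSwap k) l =
        ∑ l ∈ Finset.Iic p \ {k.castSucc, k.succ}, f l :=
      Finset.sum_congr rfl fun l hl => by
        simp at hl
        rw [Function.comp_apply, adjSwap, Equiv.swap_apply_of_ne_of_ne (by tauto) (by tauto)]
    rw [e2]
    simp only [Function.comp_apply, adjSwap, Equiv.swap_apply_left, Equiv.swap_apply_right,
      Finset.mem_Iic, hiff]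
    split_ifs <;> omega
  have heq : ∀ p, p ≠ k.castSucc → ∑ i ∈ Finset.Iic p, ν i = ∑ i ∈ Finset.Iic p, η i := by
    intro p hpk
    have h1 := hp.2.2 p
    have h2 := hp'.2 p
    rw [hswap _ p hpk, hswap _ p hpk] at h2
    omega
  have hval : ∀ l, l ≠ k.castSucc → l ≠ k.succ → ν l = η l := by
    intro l h1 h2
    have h3 := heq l h1
    rw [sum_Iic_eq_sum_Iio_add, sum_Iic_eq_sum_Iio_add] at h3
    cases l using Fin.cases with
    | zero => simpa [sum_Iio_zero] using h3
    | succ a =>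
      rw [sum_Iio_succ, sum_Iio_succ, heq a.castSucc (fun hc => h2 (by
        rw [Fin.castSucc_injective _ hc])), Nat.add_left_cancel_iff] at h3
      exact h3
  have h1 := sum_eq_of_move hne hval fun a => a ^ 2
  have h1' := sum_eq_of_move hne hval id
  have h2 := sum_comp_partitionOf ν fun a => a ^ 2
  have h3 := sum_comp_partitionOf η fun a => a ^ 2
  rw [hp.1] at h2
  beta_reduce at h1 h2 h3
  rw [← h2, ← h3] at h1
  have h4 := h.1
  simp only [id] at h1'
  have h5 : ν k.castSucc ≤ η k.castSucc := by
    have h6 := hp.2.2 k.castSucc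
    have h7 : ∑ i ∈ Finset.Iio k.castSucc, ν i = ∑ i ∈ Finset.Iio k.castSucc, η i :=
      Finset.sum_congr rfl fun l hl => by
        have hl' := Finset.mem_Iio.mp hl
        exact hval l hl'.ne (hl'.trans k.castSucc_lt_succ).ne
    rw [sum_Iic_eq_sum_Iio_add, sum_Iic_eq_sum_Iio_add, h7] at h6
    omega
  have h6 : ν k.castSucc = η k.castSucc := by
    by_contra hc
    have : ν k.castSucc < η k.castSucc := lt_of_le_of_ne h5 hc
    nlinarith
  refine hp.2.1 (funext fun l => ?_)
  by_cases hl1 : l = k.castSucc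
  · rw [hl1, h6]
  by_cases hl2 : l = k.succ
  · rw [hl2]; omega
  · exact hval l hl1 hl2

end Order

/-! ### Triangular operators -/

section Triangular

variable {K : Type*} [Field K] {n : ℕ}

/-- The span of the monomials `x^μ` with `μ ≺ ν`. -/
def lowerSpan (K : Type*) [Field K] (ν : Fin n →₀ ℕ) : Submodule K (MvPolynomial (Fin n) K) where
  carrier := {r | ∀ μ, coeff μ r ≠ 0 → Prec μ ν}
  zero_mem' := fun μ h => absurd (coeff_zero μ) h
  add_mem' := fun {a b} ha hb μ h => by
    rw [coeff_add] at h
    by_cases h1 : coeff μ a = 0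
    · exact hb μ (by simpa [h1] using h)
    · exact ha μ h1
  smul_mem' := fun c a ha μ h => ha μ (right_ne_zero_of_mul (by simpa [coeff_smul] using h))

theorem monomial_mem_lowerSpan {μ ν : Fin n →₀ ℕ} (h : Prec μ ν) (c : K) :
    monomial μ c ∈ lowerSpan K ν := by
  classical
  intro κ hκ
  rw [coeff_monomial] at hκ
  split_ifs at hκ with h'
  · exact h' ▸ h
  · exact absurd rfl hκ

theorem lowerSpan_mono {μ ν : Fin n →₀ ℕ} (h : Prec μ ν) : lowerSpan K μ ≤ lowerSpan K ν :=
  fun _ hr κ hκ => (hr κ hκ).trans h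

/-- `A x^ν = d_ν x^ν + ∑_{μ ≺ ν} c_μ x^μ` for all `ν`. -/
def IsTriangular (A : Module.End K (MvPolynomial (Fin n) K)) (d : (Fin n →₀ ℕ) → K) : Prop :=
  ∀ ν, A (monomial ν 1) - d ν • monomial ν 1 ∈ lowerSpan K ν

theorem map_eq_sum_monomial (A : Module.End K (MvPolynomial (Fin n) K))
    (f : MvPolynomial (Fin n) K) :
    A f = ∑ μ ∈ f.support, coeff μ f • A (monomial μ 1) := by
  conv_lhs => rw [f.as_sum]
  rw [map_sum]
  refine Finset.sum_congr rfl fun μ _ => ?_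
  rw [← map_smul, smul_monomial, smul_eq_mul, mul_one]

theorem IsTriangular.map_mem {A : Module.End K (MvPolynomial (Fin n) K)}
    {d : (Fin n →₀ ℕ) → K} (hA : IsTriangular A d) {ν : Fin n →₀ ℕ}
    {r : MvPolynomial (Fin n) K} (hr : r ∈ lowerSpan K ν) : A r ∈ lowerSpan K ν := by
  rw [map_eq_sum_monomial]
  refine Submodule.sum_mem _ fun μ hμ => Submodule.smul_mem _ _ ?_
  have hp : Prec μ ν := hr μ (mem_support_iff.mp hμ)
  have h := lowerSpan_mono hp (hA μ)
  have h' := Submodule.add_mem _ h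
    (Submodule.smul_mem _ (d μ) (monomial_mem_lowerSpan (K := K) hp 1))
  rwa [sub_add_cancel] at h'

theorem IsTriangular.mul {A B : Module.End K (MvPolynomial (Fin n) K)}
    {d e : (Fin n →₀ ℕ) → K} (hA : IsTriangular A d) (hB : IsTriangular B e) :
    IsTriangular (A * B) fun ν => d ν * e ν := by
  intro ν
  have h1 := hA.map_mem (hB ν)
  have h2 := Submodule.smul_mem _ (e ν) (hA ν)
  have h3 := Submodule.add_mem _ h1 h2
  rw [map_sub, map_smul] at h3
  beta_reduce
  rw [Module.End.mul_apply, mul_comm, mul_smul]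
  convert h3 using 1
  rw [smul_sub]; abel

theorem IsTriangular.one : IsTriangular (1 : Module.End K (MvPolynomial (Fin n) K)) fun _ => 1 := by
  intro ν
  simp

theorem IsTriangular.smul {A : Module.End K (MvPolynomial (Fin n) K)}
    {d : (Fin n →₀ ℕ) → K} (hA : IsTriangular A d) (c : K) :
    IsTriangular (c • A) fun ν => c * d ν := by
  intro ν
  have := Submodule.smul_mem _ c (hA ν)
  rwa [smul_sub, smul_smul] at this

theorem IsTriangular.list_prod {ι : Type*} {A : ι → Module.End K (MvPolynomial (Fin n) K)}
    {d : ι → (Fin n →₀ ℕ) → K} {l : List ι} (h : ∀ a ∈ l, IsTriangular (A a) (d a)) :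
    IsTriangular (l.map A).prod fun ν => (l.map fun a => d a ν).prod := by
  induction l with
  | nil => exact IsTriangular.one
  | cons a l ih =>
    simp only [List.map_cons, List.prod_cons]
    exact (h a List.mem_cons_self).mul (ih fun b hb => h b (List.mem_cons_of_mem _ hb))

/-- An off-diagonal contribution of x^μ to x^ν would need ν ≺ μ, so only the diagonal entry
survives. -/
theorem IsTriangular.coeff_map {A : Module.End K (MvPolynomial (Fin n) K)}
    {d : (Fin n →₀ ℕ) → K} (hA : IsTriangular A d) {f : MvPolynomial (Fin n) K}
    {ν : Fin n →₀ ℕ} (hν : ∀ μ, coeff μ f ≠ 0 → ¬ Prec ν μ) :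
    coeff ν (A f) = d ν * coeff ν f := by
  classical
  have hm : ∀ μ ∈ f.support, coeff ν (coeff μ f • A (monomial μ 1)) =
      if μ = ν then d ν * coeff ν f else 0 := by
    intro μ hμ
    have h1 : coeff ν (A (monomial μ 1) - d μ • monomial μ 1) = 0 := by
      by_contra hc
      exact hν μ (mem_support_iff.mp hμ) (hA μ ν hc)
    rw [coeff_sub, sub_eq_zero, coeff_smul, coeff_monomial] at h1
    rw [coeff_smul, h1]
    split_ifs with h
    · subst h; simp [mul_comm]
    · simp
  rw [map_eq_sum_monomial, coeff_sum, Finset.sum_congr rfl hm, Finset.sum_ite_eq']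
  split_ifs with h
  · rfl
  · rw [notMem_support_iff.mp h, mul_zero]

end Triangular

/-! ### Triangularity of the factors of the Cherednik operators -/

section Factors

variable {K : Type*} [Field K] {n : ℕ}

/-- The exchange of `x_i` and `x_j`. -/
noncomputable def pairS (i j : Fin n) : Module.End K (MvPolynomial (Fin n) K) :=
  (rename (R := K) (Equiv.swap i j)).toLinearMap

/-- `T_{ij} s_{ij}`. -/
noncomputable def pairG (t : K) (i j : Fin n) : Module.End K (MvPolynomial (Fin n) K) :=
  pairT t i j * pairS i j

/-- `(T_{ij} s_{ij})⁻¹`. -/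
noncomputable def pairGinv (t : K) (i j : Fin n) : Module.End K (MvPolynomial (Fin n) K) :=
  pairS i j * ((t⁻¹ - 1) • 1 + t⁻¹ • pairT t i j)

theorem pairS_apply (i j : Fin n) (f : MvPolynomial (Fin n) K) :
    pairS i j f = rename (Equiv.swap i j) f := rfl

theorem pairG_apply (t : K) (i j : Fin n) (f : MvPolynomial (Fin n) K) :
    pairG t i j f = pairT t i j (rename (Equiv.swap i j) f) := rfl

theorem pairGinv_apply (t : K) (i j : Fin n) (f : MvPolynomial (Fin n) K) :
    pairGinv t i j f = (t⁻¹ - 1) • rename (Equiv.swap i j) f +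
      t⁻¹ • rename (Equiv.swap i j) (pairT t i j f) := by
  simp [pairGinv, pairS]

/-- The exponent obtained by exchanging two parts. -/
noncomputable def swapExp (i j : Fin n) (ν : Fin n →₀ ℕ) : Fin n →₀ ℕ :=
  ν.mapDomain (Equiv.swap i j)

theorem coe_swapExp (i j : Fin n) (ν : Fin n →₀ ℕ) : ⇑(swapExp i j ν) = ν ∘ Equiv.swap i j := by
  funext l
  rw [swapExp, Finsupp.mapDomain_equiv_apply, Equiv.symm_swap, Function.comp_apply]

theorem rename_swap_monomial (i j : Fin n) (ν : Fin n →₀ ℕ) (c : K) :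
    rename (Equiv.swap i j) (monomial ν c) = monomial (swapExp i j ν) c :=
  rename_monomial _ _ _

theorem swapExp_swapExp (i j : Fin n) (ν : Fin n →₀ ℕ) : swapExp i j (swapExp i j ν) = ν := by
  ext l; simp [coe_swapExp]

theorem swapExp_of_eq {i j : Fin n} {ν : Fin n →₀ ℕ} (h : ν i = ν j) : swapExp i j ν = ν := by
  ext l
  rw [coe_swapExp, Function.comp_apply, Equiv.swap_apply_def]
  split_ifs with h1 h2
  · rw [h1, h]
  · rw [h2, h]
  · rfl

/-- The action of `T_{ij}` on the pair of monomials `x^ν`, `s_{ij} x^ν` with `ν_j < ν_i`. -/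
theorem pairT_monomial (t : K) {i j : Fin n} (hij : i ≠ j) {ν : Fin n →₀ ℕ} (h : ν j < ν i) :
    ∃ M : MvPolynomial (Fin n) K, M ∈ lowerSpan K ν ∧ M ∈ lowerSpan K (swapExp i j ν) ∧
      rename (Equiv.swap i j) M = M ∧
      pairT t i j (monomial ν 1) = monomial (swapExp i j ν) 1 - (t - 1) • M ∧
      pairT t i j (monomial (swapExp i j ν) 1) =
        t • monomial ν 1 + (t - 1) • M + (t - 1) • monomial (swapExp i j ν) 1 := by
  classical
  obtain ⟨e, he⟩ : ∃ e, ν i = ν j + e + 1 := ⟨ν i - ν j - 1, by omega⟩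
  set b := ν j with hb
  set ρ : Fin n →₀ ℕ := (ν.erase i).erase j with hρ
  have hρi : ρ i = 0 := by simp [hρ, Finsupp.erase_apply]
  have hρj : ρ j = 0 := by simp [hρ]
  have hρl : ∀ l, l ≠ i → l ≠ j → ρ l = ν l := fun l h1 h2 => by
    simp [hρ, h1, h2]
  have hmon : ∀ a c : ℕ, (monomial (ρ + Finsupp.single i a + Finsupp.single j c) 1 :
      MvPolynomial (Fin n) K) = monomial ρ 1 * X i ^ a * X j ^ c := fun a c => by
    rw [X_pow_eq_monomial, X_pow_eq_monomial, monomial_mul, monomial_mul, mul_one, mul_one]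
  have hvi : ∀ a c : ℕ, (ρ + Finsupp.single i a + Finsupp.single j c) i = a := fun a c => by
    simp [hρi, hij]
  have hvj : ∀ a c : ℕ, (ρ + Finsupp.single i a + Finsupp.single j c) j = c := fun a c => by
    simp [hρj, hij]
  have hvl : ∀ a c : ℕ, ∀ l, l ≠ i → l ≠ j →
      (ρ + Finsupp.single i a + Finsupp.single j c) l = ν l := fun a c l h1 h2 => by
    simp [hρl l h1 h2, h1.symm, h2.symm]
  have hν : ν = ρ + Finsupp.single i (b + e + 1) + Finsupp.single j b := by
    ext l
    by_cases h1 : l = i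
    · subst h1; rw [hvi, he]
    by_cases h2 : l = j
    · subst h2; rw [hvj]
    rw [hvl _ _ l h1 h2]
  have hsR : rename (Equiv.swap i j) (monomial ρ 1 : MvPolynomial (Fin n) K) = monomial ρ 1 := by
    rw [rename_swap_monomial, swapExp_of_eq (hρi.trans hρj.symm)]
  set R : MvPolynomial (Fin n) K := monomial ρ 1 with hR
  set x : MvPolynomial (Fin n) K := X i with hx
  set y : MvPolynomial (Fin n) K := X j with hy
  have hsx : rename (Equiv.swap i j) x = y := by rw [hx, rename_X, Equiv.swap_apply_left]
  have hsy : rename (Equiv.swap i j) y = x := by rw [hy, rename_X, Equiv.swap_apply_right]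
  have hmν : (monomial ν 1 : MvPolynomial (Fin n) K) = R * x ^ (b + e + 1) * y ^ b := by
    rw [hν]; exact hmon _ _
  have hmsν : (monomial (swapExp i j ν) 1 : MvPolynomial (Fin n) K) =
      R * y ^ (b + e + 1) * x ^ b := by
    rw [← rename_swap_monomial, hmν]
    simp only [map_mul, map_pow, hsR, hsx, hsy]
  -- The sum of the monomials strictly between x^ν and its image, that is x^ρ (xy)^{b+1} (x^e −
  -- y^e)/(x − y). It is symmetric in the two variables, and 0 when the two parts differ by one.
  set M : MvPolynomial (Fin n) K :=
    R * (x * y) ^ (b + 1) * ∑ k ∈ Finset.range e, x ^ k * y ^ (e - 1 - k) with hM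
  have hxy : x - y ≠ 0 := X_sub_X_ne_zero hij
  have hMe : (x - y) * M = R * (x * y) ^ (b + 1) * (x ^ e - y ^ e) := by
    have := (Commute.all x y).mul_geom_sum₂ e
    rw [hM, ← this]; ring
  have hsM : rename (Equiv.swap i j) M = M := by
    apply mul_left_cancel₀ hxy
    have := congrArg (rename (Equiv.swap i j)) hMe
    simp only [map_mul, map_sub, map_pow, hsR, hsx, hsy] at this
    linear_combination -this - hMe
  have hterm : ∀ k ∈ Finset.range e, R * (x * y) ^ (b + 1) * (x ^ k * y ^ (e - 1 - k)) =
      monomial (ρ + Finsupp.single i (b + 1 + k) + Finsupp.single j (b + e - k)) 1 := by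
    intro k hk
    have hk' := Finset.mem_range.mp hk
    rw [hmon, mul_pow, show b + e - k = (b + 1) + (e - 1 - k) by omega, pow_add, pow_add]
    ring
  refine ⟨M, ?_, ?_, hsM, ?_, ?_⟩
  · rw [hM, Finset.mul_sum]
    refine Submodule.sum_mem _ fun k hk => ?_
    rw [hterm k hk]
    have hk' := Finset.mem_range.mp hk
    refine monomial_mem_lowerSpan (prec_of_move hij (hvl _ _) ?_ ?_ ?_) 1
    · rw [hvi, hvj]; omega
    · rw [hvi]; omega
    · rw [hvj]; omega
  · rw [hM, Finset.mul_sum]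
    refine Submodule.sum_mem _ fun k hk => ?_
    rw [hterm k hk]
    have hk' := Finset.mem_range.mp hk
    refine monomial_mem_lowerSpan (prec_of_move hij (fun l h1 h2 => ?_) ?_ ?_ ?_) 1
    · rw [hvl _ _ l h1 h2, coe_swapExp, Function.comp_apply, Equiv.swap_apply_of_ne_of_ne h1 h2]
    all_goals
      simp only [coe_swapExp, Function.comp_apply, Equiv.swap_apply_left, Equiv.swap_apply_right,
        hvi, hvj]
      omega
  · refine pairT_eq_of_mul_eq t hij ?_
    rw [rename_swap_monomial, hmν, hmsν]
    simp only [smul_eq_C_mul, map_sub, map_one]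
    rw [mul_pow] at hMe
    linear_combination (1 - C t) * hMe
  · refine pairT_eq_of_mul_eq t hij ?_
    rw [rename_swap_monomial, swapExp_swapExp, hmν, hmsν]
    simp only [smul_eq_C_mul, map_sub, map_one]
    rw [mul_pow] at hMe
    linear_combination (C t - 1) * hMe

theorem pairT_monomial_of_eq (t : K) {i j : Fin n} (hij : i ≠ j) {ν : Fin n →₀ ℕ}
    (h : ν i = ν j) : pairT t i j (monomial ν 1) = t • monomial ν 1 := by
  refine pairT_eq_of_mul_eq t hij ?_
  rw [rename_swap_monomial, swapExp_of_eq h, smul_eq_C_mul]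
  ring

theorem prec_swapExp {i j : Fin n} (hij : i < j) {ν : Fin n →₀ ℕ} (h : ν j < ν i) :
    Prec (swapExp i j ν) ν := by
  rw [coe_swapExp]; exact prec_comp_swap hij h

/-- T_{ij} alone interchanges x^ν and s_{ij} x^ν to leading order; composing with s_{ij} puts the
leading term back on the diagonal. The condition i < j decides which of the two exponents is lower.
-/
theorem isTriangular_pairG (t : K) {i j : Fin n} (hij : i < j) :
    IsTriangular (pairG t i j) fun ν => if ν j ≤ ν i then t else 1 := by
  intro ν
  beta_reduce
  rw [pairG_apply, rename_swap_monomial]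
  rcases lt_trichotomy (ν j) (ν i) with h | h | h
  · obtain ⟨M, hM, -, -, -, hT⟩ := pairT_monomial t hij.ne h
    rw [if_pos h.le, hT, add_assoc, add_sub_cancel_left]
    exact add_mem (Submodule.smul_mem _ _ hM)
      (Submodule.smul_mem _ _ (monomial_mem_lowerSpan (prec_swapExp hij h) 1))
  · rw [if_pos h.le, swapExp_of_eq h.symm, pairT_monomial_of_eq t hij.ne h.symm, sub_self]
    exact zero_mem _
  · obtain ⟨M, -, hM, -, hT, -⟩ := pairT_monomial t hij.ne (ν := swapExp i j ν)
      (by simpa [coe_swapExp] using h)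
    rw [swapExp_swapExp] at hM hT
    rw [if_neg h.not_ge, one_smul, hT, sub_sub_cancel_left]
    exact neg_mem (Submodule.smul_mem _ _ hM)

theorem isTriangular_pairGinv {t : K} (ht : t ≠ 0) {i j : Fin n} (hij : i < j) :
    IsTriangular (pairGinv t i j) fun ν => if ν j ≤ ν i then t⁻¹ else 1 := by
  intro ν
  beta_reduce
  rw [pairGinv_apply, rename_swap_monomial]
  rcases lt_trichotomy (ν j) (ν i) with h | h | h
  · obtain ⟨M, hM, -, hs, hT, -⟩ := pairT_monomial t hij.ne h
    rw [if_pos h.le, hT, map_sub, map_smul, hs, rename_swap_monomial, swapExp_swapExp]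
    have e : (t⁻¹ - 1) • monomial (swapExp i j ν) (1 : K) +
        t⁻¹ • (monomial ν 1 - (t - 1) • M) - t⁻¹ • monomial ν 1 =
        (t⁻¹ - 1) • monomial (swapExp i j ν) 1 + (-(t⁻¹ * (t - 1))) • M := by module
    rw [e]
    exact add_mem (Submodule.smul_mem _ _ (monomial_mem_lowerSpan (prec_swapExp hij h) 1))
      (Submodule.smul_mem _ _ hM)
  · rw [if_pos h.le, swapExp_of_eq h.symm, pairT_monomial_of_eq t hij.ne h.symm, map_smul,
      rename_swap_monomial, swapExp_of_eq h.symm, smul_smul, inv_mul_cancel₀ ht, ← add_smul,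
      ← sub_smul]
    simp
  · obtain ⟨M, -, hM, hs, -, hT⟩ := pairT_monomial t hij.ne (ν := swapExp i j ν)
      (by simpa [coe_swapExp] using h)
    rw [swapExp_swapExp] at hM hT
    rw [if_neg h.not_ge, hT]
    simp only [map_add, map_smul, hs, rename_swap_monomial, swapExp_swapExp, smul_add, smul_smul,
      inv_mul_cancel₀ ht, one_smul]
    have e : (t⁻¹ - 1) • monomial (swapExp i j ν) (1 : K) + (monomial ν 1 + (t⁻¹ * (t - 1)) • M +
        (t⁻¹ * (t - 1)) • monomial (swapExp i j ν) 1) - monomial ν 1 =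
        (t⁻¹ - 1 + t⁻¹ * (t - 1)) • monomial (swapExp i j ν) 1 + (t⁻¹ * (t - 1)) • M := by module
    have e0 : t⁻¹ - 1 + t⁻¹ * (t - 1) = 0 := by field_simp; ring
    rw [e, e0, zero_smul, zero_add]
    exact Submodule.smul_mem _ _ hM

end Factors

/-! ### Triangularity of the Cherednik operators -/

section CherednikTriangular

variable {K : Type*} [Field K] {n m : ℕ}

/-- The `q`-shift of the variable `x_i`. -/
noncomputable def shiftAt (q : K) (i : Fin n) : Module.End K (MvPolynomial (Fin n) K) :=
  (aeval fun j : Fin n =>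
    if j = i then C q * X j else (X j : MvPolynomial (Fin n) K)).toLinearMap

theorem pairS_mul_self (i j : Fin n) :
    pairS i j * pairS i j = (1 : Module.End K (MvPolynomial (Fin n) K)) :=
  LinearMap.ext fun f => rename_swap_rename_swap i j f

theorem pairS_conj_pairG (t : K) (i j : Fin n) {a b : Fin n} (hab : a ≠ b) :
    pairS i j * pairG t a b * pairS i j =
      pairG t (Equiv.swap i j a) (Equiv.swap i j b) := by
  refine LinearMap.ext fun f => ?_
  simp only [Module.End.mul_apply, pairS_apply, pairG_apply]
  rw [rename_pairT t _ hab, rename_swap_comm (Equiv.swap i j) a b, rename_swap_rename_swap]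

theorem pairS_conj_pairGinv (t : K) (i j : Fin n) {a b : Fin n} (hab : a ≠ b) :
    pairS i j * pairGinv t a b * pairS i j =
      pairGinv t (Equiv.swap i j a) (Equiv.swap i j b) := by
  refine LinearMap.ext fun f => ?_
  simp only [Module.End.mul_apply, pairS_apply, pairGinv_apply, map_add, map_smul]
  rw [rename_swap_comm (Equiv.swap i j) a b, rename_swap_comm (Equiv.swap i j) a b,
    rename_pairT t _ hab, rename_swap_rename_swap]

theorem pairS_conj_shiftAt (q : K) (i j a : Fin n) :
    pairS i j * shiftAt q a * pairS i j = shiftAt q (Equiv.swap i j a) := by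
  have H : ((rename (Equiv.swap i j)).comp (aeval fun l : Fin n =>
      if l = a then C q * X l else (X l : MvPolynomial (Fin n) K))).comp
        (rename (Equiv.swap i j)) =
      aeval fun l : Fin n =>
        if l = Equiv.swap i j a then C q * X l else (X l : MvPolynomial (Fin n) K) := by
    refine algHom_ext fun l => ?_
    have hiff : Equiv.swap i j l = a ↔ l = Equiv.swap i j a := by
      rw [Equiv.swap_apply_eq_iff]
    simp only [AlgHom.comp_apply, rename_X, aeval_X, hiff]
    split_ifs <;> simp
  exact congrArg AlgHom.toLinearMap H

theorem conj_list_prod {M ι : Type*} [Monoid M] {s : M} (hs : s * s = 1) (f g : ι → M)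
    (l : List ι) (h : ∀ a ∈ l, s * f a * s = g a) :
    s * (l.map f).prod * s = (l.map g).prod := by
  induction l with
  | nil => simp [hs]
  | cons a l ih =>
    rw [List.map_cons, List.prod_cons, List.map_cons, List.prod_cons, ← h a List.mem_cons_self,
      ← ih fun b hb => h b (List.mem_cons_of_mem _ hb)]
    calc s * (f a * (l.map f).prod) * s = s * f a * 1 * (l.map f).prod * s := by
          simp only [mul_assoc, one_mul]
      _ = _ := by rw [← hs]; simp only [mul_assoc]

/-- `∏_{j > i} T_{ij} s_{ij}`. -/
noncomputable def upperG (t : K) (i : Fin (m + 1)) :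
    Module.End K (MvPolynomial (Fin (m + 1)) K) :=
  (((List.finRange (m + 1)).filter fun j : Fin (m + 1) => (i : ℕ) + 1 ≤ (j : ℕ)).map
    (pairG t i)).prod

/-- `∏_{j < i} (T_{ji} s_{ji})⁻¹`. -/
noncomputable def lowerGinv (t : K) (i : Fin (m + 1)) :
    Module.End K (MvPolynomial (Fin (m + 1)) K) :=
  (((List.finRange (m + 1)).filter fun j : Fin (m + 1) => (j : ℕ) < (i : ℕ)).map
    fun j => pairGinv t j i).prod

theorem opT_eq_pairG_mul (t : K) (k : Fin m) :
    opT t k = pairG t k.castSucc k.succ * pairS k.castSucc k.succ := by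
  rw [pairG, mul_assoc, pairS_mul_self, mul_one, opT_eq_pairT]

theorem pairGinv_mul_opT {t : K} (ht : t ≠ 0) (k : Fin m) :
    pairGinv t k.castSucc k.succ * opT t k = pairS k.castSucc k.succ := by
  rw [pairGinv, ← opT_eq_pairT, ← opTinv, mul_assoc, opTinv_mul_opT ht, mul_one]

theorem upperG_castSucc (t : K) (k : Fin m) :
    upperG t k.castSucc = pairG t k.castSucc k.succ *
      (pairS k.castSucc k.succ * upperG t k.succ * pairS k.castSucc k.succ) := by
  have h := finRange_filter_le k.succ
  rw [Fin.val_succ] at h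
  rw [upperG, Fin.val_castSucc, h, List.map_cons, List.prod_cons, upperG,
    conj_list_prod (pairS_mul_self _ _) _ (pairG t k.castSucc)]
  · rfl
  · intro a ha
    have ha' : (k : ℕ) + 1 + 1 ≤ a := by simpa using ha
    have h1 : a ≠ k.castSucc := by simp only [Ne, Fin.ext_iff, Fin.val_castSucc]; omega
    have h2 : a ≠ k.succ := by simp only [Ne, Fin.ext_iff, Fin.val_succ]; omega
    rw [pairS_conj_pairG t _ _ h2.symm, Equiv.swap_apply_right, Equiv.swap_apply_of_ne_of_ne h1 h2]

theorem lowerGinv_succ_mul_opT {t : K} (ht : t ≠ 0) (k : Fin m) :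
    lowerGinv t k.succ * opT t k =
      pairS k.castSucc k.succ * lowerGinv t k.castSucc := by
  have h := finRange_filter_lt_succ k.castSucc
  rw [Fin.val_castSucc] at h
  have hc := conj_list_prod (pairS_mul_self k.castSucc k.succ) (fun j => pairGinv t j k.castSucc)
    (fun j => pairGinv t j k.succ)
    ((List.finRange (m + 1)).filter fun j : Fin (m + 1) => (j : ℕ) < (k : ℕ)) (fun a ha => by
      have ha' : (a : ℕ) < k := by simpa using ha
      have h1 : a ≠ k.castSucc := by simp only [Ne, Fin.ext_iff, Fin.val_castSucc]; omega
      have h2 : a ≠ k.succ := by simp only [Ne, Fin.ext_iff, Fin.val_succ]; omega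
      rw [pairS_conj_pairGinv t _ _ h1, Equiv.swap_apply_left,
        Equiv.swap_apply_of_ne_of_ne h1 h2])
  rw [lowerGinv, Fin.val_succ, h, List.map_append, List.prod_append, List.map_singleton,
    List.prod_singleton, mul_assoc, pairGinv_mul_opT ht, ← hc, lowerGinv, Fin.val_castSucc,
    mul_assoc, pairS_mul_self, mul_one]

/-- Writing T_k as (T_k s_k) s_k and conjugating the later factors by s_k moves all reflections to
the right, where they cancel those of ω. -/
theorem upperT_mul_opS_prod (t : K) (p : Fin (m + 1)) :
    upperT t p * (((List.finRange m).filter fun k : Fin m => (p : ℕ) ≤ (k : ℕ)).reverse.map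
      (opS (K := K))).prod = upperG t p := by
  induction p using Fin.reverseInduction with
  | last =>
    rw [Fin.val_last, upperT_self, finRange_filter_le_of_le le_rfl, upperG, Fin.val_last,
      finRange_filter_le_of_le le_rfl]
    simp
  | cast k ih =>
    rw [Fin.val_succ] at ih
    rw [Fin.val_castSucc, finRange_filter_le, List.reverse_cons, List.map_append, List.prod_append,
      upperT_eq, upperG_castSucc, ← ih, opT_eq_pairG_mul]
    simp only [List.map_singleton, List.prod_singleton, mul_assoc]
    rfl

/-- The T_k are not triangular, and this rewrites Y_i in factors that are. The induction goes
upwards from the first operator, where the reflections of ω complete the upper product. -/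
theorem opY_eq_upperG {t : K} (ht : t ≠ 0) (q : K) (i : Fin (m + 1)) :
    opY q t i = t ^ ((i : ℤ) - (m : ℤ)) • (upperG t i * shiftAt q i * lowerGinv t i) := by
  induction i using Fin.induction with
  | zero =>
    have h := upperT_mul_opS_prod t (0 : Fin (m + 1))
    rw [Fin.val_zero, finRange_filter_zero_le] at h
    have h0 : lowerGinv t (0 : Fin (m + 1)) = 1 := by
      rw [lowerGinv, Fin.val_zero, finRange_filter_lt_zero]; simp
    rw [opY_eq, Fin.val_zero, lowerTinv_zero, mul_one, opOmega, ← mul_assoc, h, h0, mul_one]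
    rfl
  | succ k ih =>
    have h1 := smul_opY_castSucc ht q k
    rw [ih, Fin.val_castSucc, upperG_castSucc, smul_smul] at h1
    -- It suffices to compare both sides between two copies of T_k, which is invertible.
    have h2 : opT t k * (t ^ ((k.succ : ℕ) - (m : ℤ)) •
        (upperG t k.succ * shiftAt q k.succ * lowerGinv t k.succ)) * opT t k =
        opT t k * opY q t k.succ * opT t k := by
      have hsh := pairS_conj_shiftAt q k.castSucc k.succ k.succ
      rw [Equiv.swap_apply_right] at hsh
      rw [← h1, mul_smul_comm, smul_mul_assoc, ← zpow_one_add₀ ht, ← hsh, mul_assoc (opT t k),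
        mul_assoc _ _ (opT t k), lowerGinv_succ_mul_opT ht, opT_eq_pairG_mul]
      have e : ((k.succ : ℕ) : ℤ) - m = 1 + ((k : ℤ) - m) := by
        rw [Fin.val_succ]; push_cast; ring
      rw [e]
      congr 1
      simp only [mul_assoc]
      rw [← mul_assoc (pairS k.castSucc k.succ) (pairS k.castSucc k.succ), pairS_mul_self, one_mul]
    have h3 := congrArg (fun A => opTinv t k * A * opTinv t k) h2
    simp only [mul_assoc, opT_mul_opTinv ht, mul_one] at h3
    simp only [← mul_assoc, opTinv_mul_opT ht, one_mul] at h3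
    exact h3.symm

theorem list_prod_map_filter_finRange {M : Type*} [CommMonoid M] (p : Fin n → Prop)
    [DecidablePred p] (f : Fin n → M) :
    (((List.finRange n).filter fun a => p a).map f).prod = ∏ a with p a, f a := by
  rw [Finset.prod_filter, Fin.prod_univ_def]
  generalize List.finRange n = l
  induction l with
  | nil => simp
  | cons a l ih =>
    rw [List.filter_cons, List.map_cons, List.prod_cons, ← ih]
    by_cases h : p a <;> simp [h]

theorem isTriangular_shiftAt (q : K) (i : Fin n) :
    IsTriangular (shiftAt q i) fun ν => q ^ ν i := by
  intro ν
  beta_reduce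
  suffices h : shiftAt q i (monomial ν 1) = q ^ ν i • monomial ν 1 by
    rw [h, sub_self]; exact zero_mem _
  rw [shiftAt, AlgHom.toLinearMap_apply, aeval_monomial, map_one, one_mul, monomial_eq, C_1,
    one_mul, smul_eq_C_mul, Finsupp.prod_fintype _ _ (fun _ => pow_zero _),
    Finsupp.prod_fintype _ _ (fun _ => pow_zero _), map_pow]
  have : ∀ l, (if l = i then C q * X l else (X l : MvPolynomial (Fin n) K)) ^ ν l =
      (if l = i then C q ^ ν l else 1) * X l ^ ν l := by
    intro l
    split_ifs <;> simp [mul_pow]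
  simp only [this, Finset.prod_mul_distrib]
  simp

/-- There are m − i rows below row i, so the prefactor turns the count of those with ν_j ≤ ν_i into
minus the count of those with ν_j > ν_i, one half of the leg colength. -/
theorem opY_diagonal {t : K} (ht : t ≠ 0) (q : K) (ν : Fin (m + 1) → ℕ) (i : Fin (m + 1)) :
    t ^ ((i : ℤ) - (m : ℤ)) * ((∏ j ∈ Finset.univ.filter fun j : Fin (m + 1) => (i : ℕ) + 1 ≤ (j : ℕ), if ν j ≤ ν i then t else 1) *
      q ^ ν i * ∏ j ∈ Finset.univ.filter fun j : Fin (m + 1) => (j : ℕ) < (i : ℕ), if ν i ≤ ν j then t⁻¹ else 1) =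
      eigenvalue q t ν i := by
  have h1 : (∏ j ∈ Finset.univ.filter fun j : Fin (m + 1) => (i : ℕ) + 1 ≤ (j : ℕ), if ν j ≤ ν i then t else 1) =
      t ^ (((m : ℤ) - i) - (Finset.univ.filter fun k => i < k ∧ ν i < ν k).card) := by
    rw [← Finset.prod_filter, Finset.prod_const, ← zpow_natCast]
    congr 1
    have hc := Finset.card_filter_add_card_filter_not (s := Finset.univ.filter
      fun j : Fin (m + 1) => (i : ℕ) + 1 ≤ (j : ℕ)) (fun j => ν j ≤ ν i)
    have e1 : (Finset.univ.filter fun j : Fin (m + 1) => (i : ℕ) + 1 ≤ (j : ℕ)) =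
        Finset.Ioi i := by
      ext j; simp
    have e2 : ((Finset.univ.filter fun j : Fin (m + 1) => (i : ℕ) + 1 ≤ (j : ℕ)).filter
        fun j => ¬ ν j ≤ ν i) = Finset.univ.filter fun k => i < k ∧ ν i < ν k := by
      ext j; simp
    rw [e2] at hc
    have e3 : (Finset.univ.filter fun j : Fin (m + 1) => (i : ℕ) + 1 ≤ (j : ℕ)).card = m - i := by
      rw [e1, Fin.card_Ioi]; omega
    rw [e3] at hc
    have := i.isLt
    omega
  have h2 : (∏ j ∈ Finset.univ.filter fun j : Fin (m + 1) => (j : ℕ) < (i : ℕ), if ν i ≤ ν j then t⁻¹ else 1) =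
      t ^ (-((Finset.univ.filter fun k => k < i ∧ ν i ≤ ν k).card : ℤ)) := by
    rw [← Finset.prod_filter, Finset.prod_const, zpow_neg, zpow_natCast, inv_pow,
      Finset.filter_filter]
    rfl
  rw [h1, h2, eigenvalue, legColength, mul_comm _ (q ^ ν i), mul_assoc (q ^ ν i), mul_left_comm,
    ← zpow_add₀ ht, ← zpow_add₀ ht]
  congr 2
  push_cast
  ring

theorem isTriangular_opY {t : K} (ht : t ≠ 0) (q : K) (i : Fin (m + 1)) :
    IsTriangular (opY q t i) fun ν => eigenvalue q t ν i := by
  have h1 : IsTriangular (upperG t i) _ := IsTriangular.list_prod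
    (d := fun j ν => if ν j ≤ ν i then t else 1) fun j hj =>
      isTriangular_pairG t (show i < j by simpa [Nat.succ_le_iff] using hj)
  have h2 : IsTriangular (lowerGinv t i) _ := IsTriangular.list_prod
    (d := fun j ν => if ν i ≤ ν j then t⁻¹ else 1) fun j hj =>
      isTriangular_pairGinv ht (show j < i by simpa using hj)
  have h3 := ((h1.mul (isTriangular_shiftAt q i)).mul h2).smul (t ^ ((i : ℤ) - (m : ℤ)))
  rw [← opY_eq_upperG ht] at h3
  convert h3 using 2 with ν
  rw [← opY_diagonal ht, list_prod_map_filter_finRange, list_prod_map_filter_finRange]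

end CherednikTriangular

/-! ### Joint eigenfunctions -/

section Eigenfunctions

variable {K : Type*} [Field K] {m : ℕ}

/-- The parameters separate the joint spectrum of the Cherednik operators. -/
def SeparatesSpectrum (m : ℕ) (q t : K) : Prop :=
  ∀ ⦃ν η : Fin (m + 1) → ℕ⦄, eigenvalue q t ν = eigenvalue q t η → ν = η

variable {q t : K} {η : Fin (m + 1) → ℕ}

/-- `f` is a joint eigenfunction of the Cherednik operators with the eigenvalues of `η`. -/
def IsEigen (q t : K) (η : Fin (m + 1) → ℕ) (f : MvPolynomial (Fin (m + 1)) K) : Prop :=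
  ∀ i, opY q t i f = eigenvalue q t η i • f

/-- Comparing the coefficient of x^ν in each eigenvalue equation identifies the spectrum of η with
that of ν. -/
theorem IsEigen.eq_of_maximal (ht : t ≠ 0) (hsep : SeparatesSpectrum m q t)
    {f : MvPolynomial (Fin (m + 1)) K} (hf : IsEigen q t η f) {ν : Fin (m + 1) →₀ ℕ}
    (hν : coeff ν f ≠ 0) (hmax : ∀ μ, coeff μ f ≠ 0 → ¬ Prec ν μ) : ⇑ν = η := by
  refine hsep (funext fun i => ?_)
  have h := (isTriangular_opY ht q i).coeff_map hmax
  rw [hf i, coeff_smul, smul_eq_mul] at h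
  exact (mul_right_cancel₀ hν h).symm

theorem exists_maximal_coeff {n : ℕ} {f : MvPolynomial (Fin n) K} {μ : Fin n →₀ ℕ}
    (hμ : coeff μ f ≠ 0) : ∃ ν, coeff ν f ≠ 0 ∧ (ν = μ ∨ Prec μ ν) ∧
      ∀ κ, coeff κ f ≠ 0 → ¬ Prec ν κ := by
  classical
  obtain ⟨ν, hν, hmax⟩ := Finset.exists_max_image (f.support.filter fun ν => ν = μ ∨ Prec μ ν)
    (fun ν => precRank ν) ⟨μ, by simp [hμ]⟩
  simp only [Finset.mem_filter, mem_support_iff] at hν hmax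
  refine ⟨ν, hν.1, hν.2, fun κ hκ hp => ?_⟩
  refine (hmax κ ⟨hκ, Or.inr ?_⟩).not_gt hp.rank_lt
  rcases hν.2 with rfl | h
  · exact hp
  · exact h.trans hp

/-- Above every exponent of f lies a maximal one, which must be η. Hence triangularity never has to
be checked for the operators that construct E_η. -/
theorem IsEigen.triangular (ht : t ≠ 0) (hsep : SeparatesSpectrum m q t)
    {f : MvPolynomial (Fin (m + 1)) K} (hf : IsEigen q t η f) {μ : Fin (m + 1) →₀ ℕ}
    (hμ : coeff μ f ≠ 0) : ⇑μ = η ∨ Prec μ η := by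
  obtain ⟨ν, hν, h, hmax⟩ := exists_maximal_coeff hμ
  have := hf.eq_of_maximal ht hsep hν hmax
  rcases h with rfl | h
  · exact Or.inl this
  · exact Or.inr (this ▸ h)

theorem IsEigen.coeff_ne_zero (ht : t ≠ 0) (hsep : SeparatesSpectrum m q t)
    {f : MvPolynomial (Fin (m + 1)) K} (hf : IsEigen q t η f) (h0 : f ≠ 0) :
    coeff (Finsupp.equivFunOnFinite.symm η) f ≠ 0 := by
  obtain ⟨μ, hμ⟩ := ne_zero_iff.mp h0
  obtain ⟨ν, hν, -, hmax⟩ := exists_maximal_coeff hμ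
  have := hf.eq_of_maximal ht hsep hν hmax
  rwa [← this, Finsupp.equivFunOnFinite_symm_coe]

theorem IsEigen.isMacdonaldE (ht : t ≠ 0) (hsep : SeparatesSpectrum m q t)
    {f : MvPolynomial (Fin (m + 1)) K} (hf : IsEigen q t η f)
    (h1 : coeff (Finsupp.equivFunOnFinite.symm η) f = 1) : IsMacdonaldE η q t f :=
  ⟨h1, fun _ hν => hf.triangular ht hsep (mem_support_iff.mp hν), hf⟩

theorem IsMacdonaldE.unique (ht : t ≠ 0) (hsep : SeparatesSpectrum m q t)
    {E F : MvPolynomial (Fin (m + 1)) K} (hE : IsMacdonaldE η q t E)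
    (hF : IsMacdonaldE η q t F) : E = F := by
  by_contra hne
  have h : IsEigen q t η (E - F) := fun i => by rw [map_sub, hE.eigen, hF.eigen, smul_sub]
  refine h.coeff_ne_zero ht hsep (sub_ne_zero.mpr hne) ?_
  rw [coeff_sub, hE.coeff_self, hF.coeff_self, sub_self]

end Eigenfunctions

/-! ### Recursion on compositions -/

section Recursion

variable {m : ℕ}

/-- Row `k` precedes row `i` in the rearrangement of `η` to a partition. -/
def RowPrecedes {n : ℕ} (η : Fin n → ℕ) (k i : Fin n) : Prop := η i < η k ∨ (η i = η k ∧ k < i)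

instance {n : ℕ} (η : Fin n → ℕ) (k i : Fin n) : Decidable (RowPrecedes η k i) := by
  unfold RowPrecedes; infer_instance

/-- The leg colength is the rank of row i in a total order of the rows, so it is transported by
every order-preserving relabelling. -/
theorem legColength_eq_card {n : ℕ} (η : Fin n → ℕ) (i : Fin n) :
    legColength η i = (Finset.univ.filter fun k => RowPrecedes η k i).card := by
  rw [legColength, ← Finset.card_union_of_disjoint]
  · congr 1
    ext k
    simp only [Finset.mem_union, Finset.mem_filter, Finset.mem_univ, true_and, RowPrecedes,
      Fin.lt_def]
    have : k = i ↔ (k : ℕ) = i := Fin.ext_iff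
    by_cases h : k = i
    · subst h; simp
    · omega
  · rw [Finset.disjoint_filter]
    rintro k - ⟨h1, -⟩ ⟨h2, -⟩
    exact h1.asymm h2

theorem legColength_eq_of_equiv {n : ℕ} {ν η : Fin n → ℕ} (σ : Equiv.Perm (Fin n))
    (h : ∀ k i, RowPrecedes ν k i ↔ RowPrecedes η (σ k) (σ i)) (i : Fin n) :
    legColength ν i = legColength η (σ i) := by
  rw [legColength_eq_card, legColength_eq_card, ← Finset.card_map σ.toEmbedding]
  congr 1
  ext k
  simp only [Finset.mem_map_equiv, Finset.mem_filter, Finset.mem_univ, true_and, h,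
    Equiv.apply_symm_apply]

theorem adjSwap_castSucc (k : Fin m) : adjSwap k k.castSucc = k.succ := Equiv.swap_apply_left _ _

theorem adjSwap_succ (k : Fin m) : adjSwap k k.succ = k.castSucc := Equiv.swap_apply_right _ _

theorem adjSwap_adjSwap (k : Fin m) (i : Fin (m + 1)) : adjSwap k (adjSwap k i) = i := by
  rw [adjSwap, ← Equiv.Perm.mul_apply, Equiv.swap_mul_self, Equiv.Perm.one_apply]

theorem comp_adjSwap_comp_adjSwap {α : Type*} (k : Fin m) (f : Fin (m + 1) → α) :
    (f ∘ adjSwap k) ∘ adjSwap k = f := by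
  funext i; simp [adjSwap_adjSwap]

theorem adjSwap_val (k : Fin m) (i : Fin (m + 1)) : (adjSwap k i : ℕ) =
    if (i : ℕ) = k then (k : ℕ) + 1 else if (i : ℕ) = (k : ℕ) + 1 then (k : ℕ) else (i : ℕ) := by
  rw [adjSwap, Equiv.swap_apply_def]
  simp only [Fin.ext_iff, Fin.val_castSucc, Fin.val_succ]
  split_ifs <;> simp

/-- An adjacent transposition preserves the order of all pairs but one. -/
theorem adjSwap_lt_iff (k : Fin m) {a b : Fin (m + 1)}
    (h : ¬ (a = k.castSucc ∧ b = k.succ)) (h' : ¬ (a = k.succ ∧ b = k.castSucc)) :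
    adjSwap k a < adjSwap k b ↔ a < b := by
  simp only [Fin.lt_def, adjSwap_val, Fin.ext_iff, Fin.val_castSucc, Fin.val_succ] at *
  split_ifs <;> omega

theorem legColength_comp_adjSwap {η : Fin (m + 1) → ℕ} {k : Fin m}
    (hk : η k.castSucc ≠ η k.succ) (i : Fin (m + 1)) :
    legColength (η ∘ adjSwap k) i = legColength η (adjSwap k i) := by
  refine legColength_eq_of_equiv (adjSwap k) (fun a b => ?_) i
  simp only [RowPrecedes, Function.comp_apply]
  refine or_congr_right (and_congr_right fun h => (adjSwap_lt_iff k ?_ ?_).symm)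
  · rintro ⟨rfl, rfl⟩
    rw [adjSwap_castSucc, adjSwap_succ] at h
    exact hk h
  · rintro ⟨rfl, rfl⟩
    rw [adjSwap_castSucc, adjSwap_succ] at h
    exact hk h.symm

/-- The composition `(η_2, …, η_n, η_1 + 1)`. -/
def raise (η : Fin (m + 1) → ℕ) : Fin (m + 1) → ℕ :=
  Fin.snoc (α := fun _ => ℕ) (fun i => η i.succ) (η 0 + 1)

@[simp] theorem raise_castSucc (η : Fin (m + 1) → ℕ) (i : Fin m) :
    raise η i.castSucc = η i.succ := Fin.snoc_castSucc (α := fun _ => ℕ) _ _ _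

@[simp] theorem raise_last (η : Fin (m + 1) → ℕ) : raise η (Fin.last m) = η 0 + 1 :=
  Fin.snoc_last (α := fun _ => ℕ) _ _

theorem finRotate_castSucc (i : Fin m) : finRotate (m + 1) i.castSucc = i.succ := by
  rw [finRotate_apply, Fin.coeSucc_eq_succ]

/-- The first row wins ties by position; once it is last, the added box wins the same ties by size.
-/
theorem rowPrecedes_raise (η : Fin (m + 1) → ℕ) (k i : Fin (m + 1)) :
    RowPrecedes (raise η) k i ↔ RowPrecedes η (finRotate (m + 1) k) (finRotate (m + 1) i) := by
  induction k using Fin.lastCases with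
  | last =>
    induction i using Fin.lastCases with
    | last => simp [RowPrecedes]
    | cast i =>
      simp only [RowPrecedes, raise_castSucc, raise_last, finRotate_last, finRotate_castSucc,
        Fin.succ_pos, and_true, (Fin.castSucc_lt_last i).asymm, and_false, or_false]
      omega
  | cast k =>
    induction i using Fin.lastCases with
    | last =>
      simp only [RowPrecedes, raise_castSucc, raise_last, finRotate_last, finRotate_castSucc,
        Fin.castSucc_lt_last, and_true, Fin.not_lt_zero, and_false, or_false]
      omega
    | cast i => simp [RowPrecedes]

theorem legColength_raise_castSucc (η : Fin (m + 1) → ℕ) (i : Fin m) :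
    legColength (raise η) i.castSucc = legColength η i.succ := by
  rw [legColength_eq_of_equiv _ (rowPrecedes_raise η), finRotate_castSucc]

theorem legColength_raise_last (η : Fin (m + 1) → ℕ) :
    legColength (raise η) (Fin.last m) = legColength η 0 := by
  rw [legColength_eq_of_equiv _ (rowPrecedes_raise η), finRotate_last]

theorem sum_raise (η : Fin (m + 1) → ℕ) : ∑ i, raise η i = ∑ i, η i + 1 := by
  rw [Fin.sum_univ_castSucc, Fin.sum_univ_succ]
  simp; ring

theorem exists_eq_raise {η : Fin (m + 1) → ℕ} (h : η (Fin.last m) ≠ 0) : ∃ ν, η = raise ν := by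
  refine ⟨Fin.cons (η (Fin.last m) - 1) fun i => η i.castSucc, funext fun i => ?_⟩
  induction i using Fin.lastCases with
  | last => simp; omega
  | cast i => simp

theorem sum_mul_comp_adjSwap_lt {η : Fin (m + 1) → ℕ} {k : Fin m}
    (hk : η k.succ < η k.castSucc) :
    ∑ i : Fin (m + 1), (m - i) * (η ∘ adjSwap k) i < ∑ i : Fin (m + 1), (m - i) * η i := by
  have hne : k.castSucc ≠ k.succ := k.castSucc_lt_succ.ne
  rw [sum_eq_sum_sdiff_add_ite _ _ hne,
    sum_eq_sum_sdiff_add_ite (fun i : Fin (m + 1) => (m - (i : ℕ)) * η i) _ hne]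
  have e : ∑ l ∈ Finset.univ \ {k.castSucc, k.succ}, (m - (l : ℕ)) * (η ∘ adjSwap k) l =
      ∑ l ∈ Finset.univ \ {k.castSucc, k.succ}, (m - (l : ℕ)) * η l :=
    Finset.sum_congr rfl fun l hl => by
      simp at hl
      rw [Function.comp_apply, adjSwap, Equiv.swap_apply_of_ne_of_ne (by tauto) (by tauto)]
  rw [e]
  simp only [Finset.mem_univ, if_true, Function.comp_apply, adjSwap_castSucc, adjSwap_succ,
    Fin.val_castSucc, Fin.val_succ]
  have := k.isLt
  obtain ⟨r, hr⟩ : ∃ r, m - (k : ℕ) = r + 1 := ⟨m - k - 1, by omega⟩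
  have hr' : m - ((k : ℕ) + 1) = r := by omega
  rw [hr, hr']
  nlinarith

/-- Every composition is reached from `0` by raising operations and by exchanges of adjacent
parts `η_k < η_{k+1}`. -/
theorem composition_induction {P : (Fin (m + 1) → ℕ) → Prop} (zero : P 0)
    (raise : ∀ η, P η → P (raise η))
    (swap : ∀ η (k : Fin m), η k.castSucc < η k.succ → P η → P (η ∘ adjSwap k)) (η) : P η := by
  -- Lexicographic induction on the modulus and on a weighted sum. A non-zero last part lets one
  -- undo a raising. Otherwise, unless η = 0, there is a descent, and removing it lowers the
  -- weighted sum.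
  suffices H : ∀ N M : ℕ, ∀ η : Fin (m + 1) → ℕ, ∑ i, η i = N →
      ∑ i : Fin (m + 1), (m - i) * η i = M → P η from H _ _ η rfl rfl
  intro N
  induction N using Nat.strong_induction_on with
  | _ N ihN =>
  intro M
  induction M using Nat.strong_induction_on with
  | _ M ihM =>
  intro η hN hM
  by_cases h : η (Fin.last m) = 0
  · by_cases hmono : Monotone η
    · have : η = 0 := funext fun i => Nat.le_zero.mp (h ▸ hmono (Fin.le_last i))
      exact this ▸ zero
    · rw [Fin.monotone_iff_le_succ] at hmono
      push Not at hmono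
      obtain ⟨k, hk⟩ := hmono
      rw [← comp_adjSwap_comp_adjSwap k η]
      refine swap _ k (by simpa [adjSwap_castSucc, adjSwap_succ] using hk) ?_
      exact ihM _ (hM ▸ sum_mul_comp_adjSwap_lt hk) _
        ((Equiv.sum_comp (adjSwap k) η).trans hN) rfl
  · obtain ⟨ν, rfl⟩ := exists_eq_raise h
    rw [sum_raise] at hN
    exact raise ν (ihN _ (by omega) _ ν rfl rfl)

end Recursion

/-! ### Existence of the non-symmetric Macdonald polynomials -/

section Existence

variable {K : Type*} [Field K] {m : ℕ} {q t : K} {η : Fin (m + 1) → ℕ}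

theorem eigenvalue_comp_adjSwap (q t : K) {k : Fin m} (hk : η k.castSucc ≠ η k.succ)
    (i : Fin (m + 1)) : eigenvalue q t (η ∘ adjSwap k) i = eigenvalue q t η (adjSwap k i) := by
  rw [eigenvalue, legColength_comp_adjSwap hk]; rfl

theorem eigenvalue_raise_castSucc (q t : K) (η : Fin (m + 1) → ℕ) (i : Fin m) :
    eigenvalue q t (raise η) i.castSucc = eigenvalue q t η i.succ := by
  rw [eigenvalue, legColength_raise_castSucc, raise_castSucc]; rfl

theorem eigenvalue_raise_last (q t : K) (η : Fin (m + 1) → ℕ) :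
    eigenvalue q t (raise η) (Fin.last m) = q * eigenvalue q t η 0 := by
  rw [eigenvalue, legColength_raise_last, raise_last, eigenvalue]; ring

theorem eigenvalue_ne_zero (hq : q ≠ 0) (ht : t ≠ 0) (η : Fin (m + 1) → ℕ) (i : Fin (m + 1)) :
    eigenvalue q t η i ≠ 0 := mul_ne_zero (pow_ne_zero _ hq) (zpow_ne_zero _ ht)

/-- If the two eigenvalues agreed, η and s_k η would have the same joint spectrum. -/
theorem SeparatesSpectrum.ne (hsep : SeparatesSpectrum m q t) {k : Fin m}
    (hk : η k.castSucc ≠ η k.succ) :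
    eigenvalue q t η k.castSucc ≠ eigenvalue q t η k.succ := by
  intro h
  have h1 : eigenvalue q t (η ∘ adjSwap k) = eigenvalue q t η := by
    funext i
    rw [eigenvalue_comp_adjSwap q t hk, adjSwap, Equiv.swap_apply_def]
    split_ifs with h1 h2
    · rw [h1, h]
    · rw [h2, h]
    · rfl
  have h2 := congrFun (hsep h1) k.castSucc
  rw [Function.comp_apply, adjSwap_castSucc] at h2
  exact hk h2.symm

/-- No exponent of modulus 0 lies below 0, so triangularity of Y_i already says that 1 is an
eigenfunction. -/
theorem isMacdonaldE_zero (ht : t ≠ 0) (q : K) :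
    IsMacdonaldE (0 : Fin (m + 1) → ℕ) q t (1 : MvPolynomial (Fin (m + 1)) K) := by
  classical
  have h0 : (Finsupp.equivFunOnFinite.symm (0 : Fin (m + 1) → ℕ)) = 0 := by ext; simp
  refine ⟨by rw [h0, coeff_zero_one], fun ν hν => ?_, fun i => ?_⟩
  · rw [mem_support_iff, coeff_one] at hν
    by_cases h : 0 = ν
    · subst h; exact Or.inl rfl
    · exact absurd (if_neg h) hν
  · have h := isTriangular_opY ht q i 0
    rw [monomial_zero', C_1] at h
    rw [← sub_eq_zero]
    by_contra hne
    obtain ⟨μ, hμ⟩ := ne_zero_iff.mp hne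
    have hp : Prec μ ((0 : Fin (m + 1) →₀ ℕ)) := h μ hμ
    have hs := hp.1
    have hz : ⇑μ = ⇑(0 : Fin (m + 1) →₀ ℕ) := by
      funext l
      simp only [Finsupp.coe_zero, Pi.zero_apply, Finset.sum_const_zero,
        Finset.sum_eq_zero_iff, Finset.mem_univ, true_imp_iff] at hs
      simp [hs l]
    rw [hz] at hp
    exact Prec.irrefl _ hp

/-- The exponent of `Φ x^ν`. -/
noncomputable def raiseExp (ν : Fin (m + 1) →₀ ℕ) : Fin (m + 1) →₀ ℕ :=
  Finsupp.equivFunOnFinite.symm (raise ν)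

theorem raise_injective : Function.Injective (raise (m := m)) := by
  intro ν η h
  funext i
  induction i using Fin.cases with
  | zero => simpa using congrFun h (Fin.last m)
  | succ i => simpa using congrFun h i.castSucc

theorem opPsi_monomial (q : K) (ν : Fin (m + 1) →₀ ℕ) :
    opPsi q (monomial ν 1) = q ^ ν 0 • monomial (raiseExp ν) 1 := by
  have h : opPsi q (monomial ν 1) = X (Fin.last m) * cyclicShift q (monomial ν 1) := by
    rw [opPsi, Module.End.mul_apply, opOmega_apply]; rfl
  have h1 : (monomial (raiseExp ν) 1 : MvPolynomial (Fin (m + 1)) K) =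
      (∏ i : Fin m, X i.castSucc ^ ν i.succ) * X (Fin.last m) ^ (ν 0 + 1) := by
    rw [monomial_eq, C_1, one_mul, Finsupp.prod_fintype _ _ (fun _ => pow_zero _),
      Fin.prod_univ_castSucc]
    simp [raiseExp]
  rw [h, h1, cyclicShift, aeval_monomial, map_one, one_mul,
    Finsupp.prod_fintype _ _ (fun _ => pow_zero _), Fin.prod_univ_succ, smul_eq_C_mul, map_pow]
  simp only [Fin.cons_zero, Fin.cons_succ, mul_pow]
  ring

theorem coeff_opPsi (q : K) (η : Fin (m + 1) → ℕ) (f : MvPolynomial (Fin (m + 1)) K) :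
    coeff (Finsupp.equivFunOnFinite.symm (raise η)) (opPsi q f) =
      q ^ η 0 * coeff (Finsupp.equivFunOnFinite.symm η) f := by
  classical
  rw [map_eq_sum_monomial, coeff_sum]
  have : ∀ μ ∈ f.support, coeff (Finsupp.equivFunOnFinite.symm (raise η))
      (coeff μ f • opPsi q (monomial μ 1)) = if μ = Finsupp.equivFunOnFinite.symm η then
        q ^ η 0 * coeff (Finsupp.equivFunOnFinite.symm η) f else 0 := by
    intro μ _
    rw [opPsi_monomial, coeff_smul, coeff_smul, coeff_monomial, raiseExp]
    by_cases h : μ = Finsupp.equivFunOnFinite.symm η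
    · subst h
      simp [mul_comm]
    · have h' : ¬ Finsupp.equivFunOnFinite.symm (raise μ) =
          Finsupp.equivFunOnFinite.symm (raise η) := fun hc => h (by
        rw [← raise_injective (Finsupp.equivFunOnFinite.symm.injective hc),
          Finsupp.equivFunOnFinite_symm_coe])
      rw [if_neg h', if_neg h, smul_zero, smul_zero]
  rw [Finset.sum_congr rfl this, Finset.sum_ite_eq']
  split_ifs with h
  · rfl
  · rw [notMem_support_iff.mp h, mul_zero]

theorem isMacdonaldE_raise (hq : q ≠ 0) (ht : t ≠ 0) (hsep : SeparatesSpectrum m q t)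
    {E : MvPolynomial (Fin (m + 1)) K} (hE : IsMacdonaldE η q t E) :
    IsMacdonaldE (raise η) q t ((q ^ η 0)⁻¹ • opPsi q E) := by
  have h : IsEigen q t (raise η) (opPsi q E) := by
    intro i
    induction i using Fin.lastCases with
    | last =>
      rw [← Module.End.mul_apply, opY_last_mul_opPsi ht, LinearMap.smul_apply,
        Module.End.mul_apply, hE.eigen, map_smul, eigenvalue_raise_last, smul_smul]
    | cast i =>
      rw [← Module.End.mul_apply, opY_castSucc_mul_opPsi ht hq, Module.End.mul_apply, hE.eigen,
        map_smul, eigenvalue_raise_castSucc]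
  refine IsEigen.isMacdonaldE ht hsep (fun i => ?_) ?_
  · rw [map_smul, h i, smul_comm]
  · rw [coeff_smul, coeff_opPsi, hE.coeff_self, mul_one, smul_eq_mul,
      inv_mul_cancel₀ (pow_ne_zero _ hq)]

/-- The coefficient in `T_k E_η + c E_η = t E_{s_k η}` for `η_k < η_{k+1}`. -/
noncomputable def swapCoeff (q t : K) (η : Fin (m + 1) → ℕ) (k : Fin m) : K :=
  (1 - t) / (1 - eigenvalue q t η k.succ / eigenvalue q t η k.castSucc)

/-- The linear equation for c under which the E-terms in Y_k (T_k E + c E) and Y_{k+1} (T_k E + c E)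
take the required form. -/
theorem swapCoeff_spec (hq : q ≠ 0) (ht : t ≠ 0) (hsep : SeparatesSpectrum m q t) {k : Fin m}
    (hk : η k.castSucc ≠ η k.succ) :
    swapCoeff q t η k * eigenvalue q t η k.castSucc =
      (1 - t) * eigenvalue q t η k.castSucc + swapCoeff q t η k * eigenvalue q t η k.succ := by
  have h1 := hsep.ne hk
  have h2 := eigenvalue_ne_zero hq ht η k.castSucc
  have h3 : eigenvalue q t η k.castSucc - eigenvalue q t η k.succ ≠ 0 := sub_ne_zero.mpr h1
  have h4 : swapCoeff q t η k = (1 - t) * eigenvalue q t η k.castSucc /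
      (eigenvalue q t η k.castSucc - eigenvalue q t η k.succ) := by
    rw [swapCoeff, one_sub_div h2, div_div_eq_mul_div]
  rw [h4]
  field_simp
  ring

theorem isEigen_opT_add (hq : q ≠ 0) (ht : t ≠ 0) (hsep : SeparatesSpectrum m q t) {k : Fin m}
    (hk : η k.castSucc ≠ η k.succ) {E : MvPolynomial (Fin (m + 1)) K}
    (hE : IsEigen q t η E) :
    IsEigen q t (η ∘ adjSwap k) (opT t k E + swapCoeff q t η k • E) := by
  intro i
  have hc := swapCoeff_spec hq ht hsep hk
  set c := swapCoeff q t η k with hcdef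
  rw [eigenvalue_comp_adjSwap q t hk]
  have hY := smul_opY_castSucc ht q k
  have hTi : ∀ f : MvPolynomial (Fin (m + 1)) K, opTinv t k f = (t⁻¹ - 1) • f + t⁻¹ • opT t k f :=
    fun f => by simp [opTinv]
  -- These two forms of the recursion express Y_{k+1} T_k E and Y_k T_k E through T_k E and E; the
  -- other Y_i commute with T_k.
  have hs : opY q t k.succ * opT t k = t • (opTinv t k * opY q t k.castSucc) := by
    rw [← mul_smul_comm, hY, ← mul_assoc, ← mul_assoc, opTinv_mul_opT ht, one_mul]
  have hc' : t • (opY q t k.castSucc * opTinv t k) = opT t k * opY q t k.succ := by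
    rw [← smul_mul_assoc, hY, mul_assoc _ _ (opTinv t k), opT_mul_opTinv ht, mul_one]
  by_cases h1 : i = k.castSucc
  · subst h1
    have h := congrArg (fun A => A E) hc'
    simp only [LinearMap.smul_apply, Module.End.mul_apply, hTi, hE k.succ, map_smul, map_add,
      hE k.castSucc, smul_add, smul_smul, mul_inv_cancel₀ ht, one_smul] at h
    have h' : opY q t k.castSucc (opT t k E) = eigenvalue q t η k.succ • opT t k E -
        (t * ((t⁻¹ - 1) * eigenvalue q t η k.castSucc)) • E := by
      rw [← h]; abel
    have e : t * ((t⁻¹ - 1) * eigenvalue q t η k.castSucc) =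
        (1 - t) * eigenvalue q t η k.castSucc := by field_simp
    rw [map_add, map_smul, hE, h', e, adjSwap_castSucc]
    have hc2 : c * eigenvalue q t η k.castSucc - (1 - t) * eigenvalue q t η k.castSucc =
      eigenvalue q t η k.succ * c := by linear_combination hc
    rw [smul_add, smul_smul (eigenvalue q t η k.succ) c E, ← hc2]
    module
  by_cases h2 : i = k.succ
  · subst h2
    have h := congrArg (fun A => A E) hs
    simp only [LinearMap.smul_apply, Module.End.mul_apply, hTi, hE k.castSucc, map_smul,
      smul_add, smul_smul] at h
    have e : t * ((t⁻¹ - 1) * eigenvalue q t η k.castSucc) =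
        (1 - t) * eigenvalue q t η k.castSucc := by field_simp
    have e' : t * (t⁻¹ * eigenvalue q t η k.castSucc) = eigenvalue q t η k.castSucc := by
      field_simp
    rw [e, e'] at h
    rw [map_add, map_smul, hE, h, adjSwap_succ]
    have hc2 : eigenvalue q t η k.castSucc * c = (1 - t) * eigenvalue q t η k.castSucc +
      c * eigenvalue q t η k.succ := by linear_combination hc
    rw [smul_add, smul_smul (eigenvalue q t η k.castSucc) c E, hc2]
    module
  · have hcomm := (commute_opT_opY ht q k i h1 h2).eq
    rw [map_add, map_smul, hE, ← Module.End.mul_apply, ← hcomm, Module.End.mul_apply, hE,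
      map_smul, adjSwap, Equiv.swap_apply_of_ne_of_ne h1 h2]
    module

theorem coeff_rename_swap (i j : Fin (m + 1)) (f : MvPolynomial (Fin (m + 1)) K)
    (μ : Fin (m + 1) →₀ ℕ) : coeff μ (rename (Equiv.swap i j) f) = coeff (swapExp i j μ) f := by
  conv_lhs => rw [← swapExp_swapExp i j μ]
  exact coeff_rename_mapDomain _ (Equiv.injective _) f _

theorem isMacdonaldE_swap (hq : q ≠ 0) (ht : t ≠ 0) (hsep : SeparatesSpectrum m q t) {k : Fin m}
    (hk : η k.castSucc < η k.succ) {E : MvPolynomial (Fin (m + 1)) K}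
    (hE : IsMacdonaldE η q t E) :
    IsMacdonaldE (η ∘ adjSwap k) q t (t⁻¹ • (opT t k E + swapCoeff q t η k • E)) := by
  have h := isEigen_opT_add hq ht hsep hk.ne hE.eigen
  have hlt : k.castSucc < k.succ := k.castSucc_lt_succ
  set ση : Fin (m + 1) →₀ ℕ := Finsupp.equivFunOnFinite.symm (η ∘ adjSwap k) with hση
  have hcoe : ⇑ση = η ∘ adjSwap k := by simp [hση]
  have hsw : swapExp k.castSucc k.succ ση = Finsupp.equivFunOnFinite.symm η := by
    apply DFunLike.coe_injective
    rw [coe_swapExp, hcoe]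
    exact comp_adjSwap_comp_adjSwap k η
  have hsup : ∀ μ : Fin (m + 1) →₀ ℕ, coeff μ E ≠ 0 → ⇑μ = η ∨ Prec μ η := fun μ hμ =>
    hE.triangular μ (mem_support_iff.mpr hμ)
  -- E_η involves only η and exponents below it, whereas η ≺ s_k η.
  have h1 : coeff ση E = 0 := by
    by_contra hne
    have hp : Prec η (η ∘ adjSwap k) := by
      have := prec_comp_swap (η := η ∘ adjSwap k) hlt
        (by simpa [adjSwap_castSucc, adjSwap_succ] using hk)
      rwa [← adjSwap, comp_adjSwap_comp_adjSwap] at this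
    rcases hsup _ hne with h' | h' <;> rw [hcoe] at h'
    · rw [h'] at hp; exact Prec.irrefl _ hp
    · exact Prec.irrefl _ (hp.trans h')
  -- Write T_k E = (T_k s_k)(s_k E). The first operator is triangular with diagonal entry t at s_k
  -- η, and no exponent of s_k E lies above s_k η.
  have h2 : coeff ση (opT t k E) = t := by
    have hG := (isTriangular_pairG t hlt).coeff_map (f := rename (Equiv.swap k.castSucc k.succ) E)
      (ν := ση) (fun μ hμ hp => by
        rw [coeff_rename_swap] at hμ
        rw [hcoe] at hp
        rcases hsup _ hμ with h' | h'
        · rw [coe_swapExp, ← adjSwap] at h'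
          rw [← h', comp_adjSwap_comp_adjSwap] at hp
          exact Prec.irrefl _ hp
        · have := not_prec_comp_adjSwap k hk h'
          rw [coe_swapExp, ← adjSwap, comp_adjSwap_comp_adjSwap] at this
          exact this hp)
    rw [pairG_apply, rename_swap_rename_swap, ← opT_eq_pairT, coeff_rename_swap, hsw,
      hE.coeff_self, mul_one, hcoe] at hG
    simpa [adjSwap_castSucc, adjSwap_succ, hk.le] using hG
  refine IsEigen.isMacdonaldE ht hsep (fun i => ?_) ?_
  · rw [map_smul, h i, smul_comm]
  · rw [coeff_smul, coeff_add, coeff_smul, h1, h2, smul_zero, add_zero, smul_eq_mul,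
      inv_mul_cancel₀ ht]

theorem exists_isMacdonaldE (hq : q ≠ 0) (ht : t ≠ 0) (hsep : SeparatesSpectrum m q t)
    (η : Fin (m + 1) → ℕ) : ∃ E, IsMacdonaldE η q t E := by
  induction η using composition_induction with
  | zero => exact ⟨1, isMacdonaldE_zero ht q⟩
  | raise η ih =>
    obtain ⟨E, hE⟩ := ih
    exact ⟨_, isMacdonaldE_raise hq ht hsep hE⟩
  | swap η k hk ih =>
    obtain ⟨E, hE⟩ := ih
    exact ⟨_, isMacdonaldE_swap hq ht hsep hk hE⟩

theorem existsUnique_isMacdonaldE (hq : q ≠ 0) (ht : t ≠ 0) (hsep : SeparatesSpectrum m q t)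
    (η : Fin (m + 1) → ℕ) : ∃! E, IsMacdonaldE η q t E := by
  obtain ⟨E, hE⟩ := exists_isMacdonaldE hq ht hsep η
  exact ⟨E, hE, fun F hF => hF.unique ht hsep hE⟩

theorem isMacdonaldE_macdonaldE (hq : q ≠ 0) (ht : t ≠ 0) (hsep : SeparatesSpectrum m q t)
    (η : Fin (m + 1) → ℕ) : IsMacdonaldE η q t (macdonaldE η q t) := by
  have h := exists_isMacdonaldE hq ht hsep η
  rw [macdonaldE, dif_pos h]
  exact h.choose_spec

theorem IsMacdonaldE.eq_macdonaldE (hq : q ≠ 0) (ht : t ≠ 0) (hsep : SeparatesSpectrum m q t)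
    {E : MvPolynomial (Fin (m + 1)) K} (hE : IsMacdonaldE η q t E) : macdonaldE η q t = E :=
  (isMacdonaldE_macdonaldE hq ht hsep η).unique ht hsep hE

end Existence

/-! ### Real parameters -/

section RealParameters

variable {m : ℕ} {q t : ℝ}

theorem RowPrecedes.legColength_lt {n : ℕ} {η : Fin n → ℕ} {k i : Fin n}
    (h : RowPrecedes η k i) : legColength η k < legColength η i := by
  rw [legColength_eq_card, legColength_eq_card]
  refine Finset.card_lt_card (Finset.ssubset_iff_of_subset (fun l hl => ?_) |>.mpr ⟨k, ?_, ?_⟩)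
  · simp only [Finset.mem_filter, Finset.mem_univ, true_and, RowPrecedes, Fin.lt_def] at *
    omega
  · simpa using h
  · rw [Finset.mem_filter]
    rintro ⟨-, h'⟩
    simp [RowPrecedes] at h'

theorem RowPrecedes.eigenvalue_lt (hq0 : 0 < q) (hq1 : q < 1) (ht0 : 0 < t) (ht1 : t < 1)
    {η : Fin (m + 1) → ℕ} {k i : Fin (m + 1)} (h : RowPrecedes η k i) :
    eigenvalue q t η k < eigenvalue q t η i := by
  have h1 : q ^ η k ≤ q ^ η i := by
    apply pow_le_pow_of_le_one hq0.le hq1.le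
    rcases h with h | h
    · exact h.le
    · exact h.1.le
  have h2 : t ^ (-(legColength η k : ℤ)) < t ^ (-(legColength η i : ℤ)) := by
    apply zpow_lt_zpow_right_of_lt_one₀ ht0 ht1
    have := h.legColength_lt
    omega
  have h3 : 0 < t ^ (-(legColength η k : ℤ)) := zpow_pos ht0 _
  have h4 : 0 < q ^ η i := pow_pos hq0 _
  unfold eigenvalue
  nlinarith

theorem rowPrecedes_iff_eigenvalue_lt (hq0 : 0 < q) (hq1 : q < 1) (ht0 : 0 < t) (ht1 : t < 1)
    {η : Fin (m + 1) → ℕ} {k i : Fin (m + 1)} :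
    RowPrecedes η k i ↔ eigenvalue q t η k < eigenvalue q t η i := by
  refine ⟨fun h => h.eigenvalue_lt hq0 hq1 ht0 ht1, fun h => ?_⟩
  by_contra hc
  by_cases hki : k = i
  · subst hki; exact lt_irrefl _ h
  · have : RowPrecedes η i k := by
      simp only [RowPrecedes, Fin.lt_def, Fin.ext_iff] at *
      omega
    exact h.asymm (this.eigenvalue_lt hq0 hq1 ht0 ht1)

/-- The order of the eigenvalues recovers the order of the rows, hence the leg colengths; dividing
out the powers of t leaves q^{η_i}, which determines η_i. -/
theorem separatesSpectrum (hq0 : 0 < q) (hq1 : q < 1) (ht0 : 0 < t) (ht1 : t < 1) :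
    SeparatesSpectrum m q t := by
  intro ν η h
  funext i
  have hl : legColength ν i = legColength η i := by
    simp only [legColength_eq_card, rowPrecedes_iff_eigenvalue_lt hq0 hq1 ht0 ht1, h]
  have h1 := congrFun h i
  rw [eigenvalue, eigenvalue, hl] at h1
  have h2 := mul_right_cancel₀ (zpow_ne_zero _ ht0.ne') h1
  exact pow_right_injective₀ hq0 hq1.ne h2

theorem eigenvalue_inv {K : Type*} [Field K] (q t : K) (η : Fin (m + 1) → ℕ) (i : Fin (m + 1)) :
    eigenvalue q⁻¹ t⁻¹ η i = (eigenvalue q t η i)⁻¹ := by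
  rw [eigenvalue, eigenvalue, mul_inv, inv_pow, inv_zpow]

theorem SeparatesSpectrum.inv {K : Type*} [Field K] {q t : K} (h : SeparatesSpectrum m q t) :
    SeparatesSpectrum m q⁻¹ t⁻¹ := fun ν η he => h (funext fun i => by
  have := congrFun he i
  rwa [eigenvalue_inv, eigenvalue_inv, inv_inj] at this)

end RealParameters

/-! ### The infinite products -/

section InfiniteProducts

variable {q t : ℝ}

theorem summable_geometric_ofReal (hq0 : 0 < q) (hq1 : q < 1) (R : ℝ) :
    Summable fun k : ℕ => R * q ^ k :=
  (summable_geometric_of_lt_one hq0.le hq1).mul_left R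

theorem norm_neg_mul_pow (hq0 : 0 < q) (a : ℂ) (k : ℕ) : ‖-(a * (q : ℂ) ^ k)‖ = ‖a‖ * q ^ k := by
  rw [norm_neg, norm_mul, norm_pow, Complex.norm_real, Real.norm_of_nonneg hq0.le]

theorem multipliable_qPochInf (hq0 : 0 < q) (hq1 : q < 1) (a : ℂ) :
    Multipliable fun k : ℕ => 1 - a * (q : ℂ) ^ k := by
  simp_rw [sub_eq_add_neg]
  apply multipliable_one_add_of_summable
  simp_rw [norm_neg_mul_pow hq0]
  exact summable_geometric_ofReal hq0 hq1 _

theorem differentiable_qPochInf (hq0 : 0 < q) (hq1 : q < 1) :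
    Differentiable ℂ fun a => qPochInf a q := by
  intro a
  have hopen : IsOpen (Metric.ball (0 : ℂ) (‖a‖ + 1)) := Metric.isOpen_ball
  have h := (summable_geometric_ofReal hq0 hq1 (‖a‖ + 1)).hasProdLocallyUniformlyOn_nat_one_add
    hopen (f := fun k a => -(a * (q : ℂ) ^ k)) (.of_forall fun k x hx => by
      rw [norm_neg_mul_pow hq0]
      have : ‖x‖ < ‖a‖ + 1 := by simpa using hx
      gcongr) (fun _ => by fun_prop)
  have h2 := h.differentiableOn (.of_forall fun _ => by
    simpa [Finset.prod_fn] using DifferentiableOn.finsetProd (fun _ _ => by fun_prop)) hopen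
  have h3 := h2.differentiableAt (hopen.mem_nhds (show a ∈ Metric.ball (0 : ℂ) (‖a‖ + 1) by simp))
  simpa only [qPochInf, sub_eq_add_neg] using h3

theorem qPochInf_ne_zero (hq0 : 0 < q) (hq1 : q < 1) {a : ℂ}
    (ha : ∀ k : ℕ, 1 - a * (q : ℂ) ^ k ≠ 0) : qPochInf a q ≠ 0 := by
  simp_rw [qPochInf, sub_eq_add_neg] at *
  apply tprod_one_add_ne_zero_of_summable ha
  simp_rw [norm_neg_mul_pow hq0]
  exact summable_geometric_ofReal hq0 hq1 _

theorem qPochInf_eq_mul (hq0 : 0 < q) (hq1 : q < 1) (a : ℂ) :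
    qPochInf a q = (1 - a) * qPochInf (q * a) q := by
  have h := (multipliable_qPochInf hq0 hq1 (q * a))
  rw [qPochInf, tprod_eq_zero_mul' (by
    convert h using 2 with k
    ring)]
  simp only [pow_zero, mul_one, qPochInf]
  congr 2
  funext k
  ring

theorem qPochInf_ne_zero_of_norm_lt (hq0 : 0 < q) (hq1 : q < 1) {a : ℂ} (ha : ‖a‖ < 1) :
    qPochInf a q ≠ 0 := by
  refine qPochInf_ne_zero hq0 hq1 fun k h => ?_
  have h1 : a * (q : ℂ) ^ k = 1 := (sub_eq_zero.mp h).symm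
  have h2 : ‖a‖ * q ^ k = 1 := by rw [← norm_neg_mul_pow hq0, h1]; simp
  have h3 : q ^ k ≤ 1 := pow_le_one₀ hq0.le hq1.le
  nlinarith [norm_nonneg a]

theorem qPochInf_ne_zero_of_norm_eq (hq0 : 0 < q) (hq1 : q < 1) {a : ℂ} (ha : ‖a‖ = 1)
    (ha1 : a ≠ 1) : qPochInf a q ≠ 0 := by
  rw [qPochInf_eq_mul hq0 hq1]
  refine mul_ne_zero (sub_ne_zero.mpr ha1.symm) (qPochInf_ne_zero_of_norm_lt hq0 hq1 ?_)
  rw [norm_mul, ha, mul_one, Complex.norm_real, Real.norm_of_nonneg hq0.le]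
  exact hq1

/-- The factor `(u;q)_λ (q/u;q)_λ` of the weight. -/
noncomputable def pairWeight (q t : ℝ) (u : ℂ) : ℂ := qPoch u q t * qPoch (q * u⁻¹) q t

/-- The part of `pairWeight` that is symmetric under `u ↦ u⁻¹`. -/
noncomputable def pairWeightSymm (q t : ℝ) (u : ℂ) : ℂ :=
  qPochInf (q * u) q * qPochInf (q * u⁻¹) q / (qPochInf (t * u) q * qPochInf (t * u⁻¹) q)

theorem pairWeightSymm_inv (q t : ℝ) (u : ℂ) :
    pairWeightSymm q t u⁻¹ = pairWeightSymm q t u := by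
  rw [pairWeightSymm, pairWeightSymm, inv_inv, mul_comm (qPochInf _ q),
    mul_comm (qPochInf (t * u⁻¹) q)]

theorem norm_ofReal_mul_lt {r : ℝ} (h0 : 0 < r) {u : ℂ} {b : ℝ} (h : r * ‖u‖ < b) :
    ‖(r : ℂ) * u‖ < b := by
  rwa [norm_mul, Complex.norm_real, Real.norm_of_nonneg h0.le]

/-- Isolates the part not symmetric under u ↦ 1/u, so that invariance under T_k becomes an identity
of rational functions. -/
theorem pairWeight_eq (hq0 : 0 < q) (hq1 : q < 1) (ht0 : 0 < t) (ht1 : t < 1) {u : ℂ}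
    (hu : ‖u‖ = 1) :
    pairWeight q t u = (1 - u) * (1 - t * u⁻¹) * pairWeightSymm q t u := by
  have h1 := qPochInf_eq_mul hq0 hq1 u
  have h2 := qPochInf_eq_mul hq0 hq1 (t * u⁻¹)
  have h3 : qPochInf (t * u⁻¹) q ≠ 0 := qPochInf_ne_zero_of_norm_lt hq0 hq1
    (norm_ofReal_mul_lt ht0 (by rw [norm_inv, hu]; simpa))
  have h4 : qPochInf (t * u) q ≠ 0 := qPochInf_ne_zero_of_norm_lt hq0 hq1
    (norm_ofReal_mul_lt ht0 (by rw [hu]; simpa))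
  have h5 : qPochInf (q * (t * u⁻¹)) q ≠ 0 := fun h => h3 (by rw [h2, h, mul_zero])
  have h6 : (1 : ℂ) - t * u⁻¹ ≠ 0 := fun h => h3 (by rw [h2, h, zero_mul])
  rw [pairWeight, qPoch, qPoch, pairWeightSymm, h1, h2, mul_comm u, show (q : ℂ) * u⁻¹ * t =
    q * (t * u⁻¹) by ring, div_mul_div_comm, ← mul_div_assoc,
    div_eq_div_iff (mul_ne_zero h4 h5) (mul_ne_zero h4 (mul_ne_zero h6 h5))]
  ring

/-- The substitution u ↦ qu interchanges the two q-shifted factorials up to u ↦ 1/u. The cyclic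
invariance of the weight is this identity applied to each pair containing x_n. -/
theorem pairWeight_mul (hq0 : 0 < q) (t : ℝ) (u : ℂ) :
    pairWeight q t (q * u) = pairWeight q t u⁻¹ := by
  have : (q : ℂ) ≠ 0 := by exact_mod_cast hq0.ne'
  rw [pairWeight, pairWeight, inv_inv, mul_comm, mul_inv, mul_inv_cancel_left₀ this]

/-- The denominators (tu;q)_∞ and (qt/u;q)_∞ have no zeros for qt < |u| < 1/t; this annulus contains
q ≤ |u| ≤ 1, which the contour shift sweeps out. -/
theorem differentiableAt_pairWeight (hq0 : 0 < q) (hq1 : q < 1) (ht0 : 0 < t) {u : ℂ}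
    (h0 : u ≠ 0) (h1 : t * ‖u‖ < 1) (h2 : q * t < ‖u‖) :
    DifferentiableAt ℂ (pairWeight q t) u := by
  have hd := differentiable_qPochInf hq0 hq1
  have hinv : DifferentiableAt ℂ (fun u : ℂ => (q : ℂ) * u⁻¹) u :=
    (differentiableAt_inv h0).const_mul _
  have hP : ∀ a : ℂ, ‖a * t‖ < 1 → DifferentiableAt ℂ (fun a => qPoch a q t) a := by
    intro a ha
    have h : Differentiable ℂ fun a : ℂ => qPochInf (a * t) q :=
      hd.comp (differentiable_id.mul_const _)
    exact (hd a).div (h a) (qPochInf_ne_zero_of_norm_lt hq0 hq1 ha)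
  refine (hP u ?_).mul
    (DifferentiableAt.comp u (g := fun a => qPoch a q t) (hP (q * u⁻¹) ?_) hinv)
  · rw [mul_comm]; exact norm_ofReal_mul_lt ht0 h1
  · have hu : 0 < ‖u‖ := norm_pos_iff.mpr h0
    rw [mul_comm]
    refine norm_ofReal_mul_lt ht0 ?_
    rw [norm_mul, Complex.norm_real, Real.norm_of_nonneg hq0.le, norm_inv, ← mul_assoc,
      mul_comm t, ← div_eq_mul_inv, div_lt_one hu]
    exact h2

theorem pairWeight_ne_zero (hq0 : 0 < q) (hq1 : q < 1) (ht0 : 0 < t) (ht1 : t < 1) {u : ℂ}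
    (hu : ‖u‖ = 1) (hu1 : u ≠ 1) : pairWeight q t u ≠ 0 := by
  have hinv : ‖u⁻¹‖ = 1 := by rw [norm_inv, hu, inv_one]
  have hqu : ∀ v : ℂ, ‖v‖ = 1 → ∀ r : ℝ, 0 < r → r < 1 → ‖(r : ℂ) * v‖ < 1 := fun v hv r h0 h1 =>
    norm_ofReal_mul_lt h0 (by rw [hv, mul_one]; exact h1)
  refine mul_ne_zero (div_ne_zero (qPochInf_ne_zero_of_norm_eq hq0 hq1 hu hu1) ?_)
    (div_ne_zero ?_ ?_)
  · rw [mul_comm]; exact qPochInf_ne_zero_of_norm_lt hq0 hq1 (hqu _ hu t ht0 ht1)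
  · exact qPochInf_ne_zero_of_norm_lt hq0 hq1 (hqu _ hinv q hq0 hq1)
  · refine qPochInf_ne_zero_of_norm_lt hq0 hq1 ?_
    have := hqu _ hinv (q * t) (mul_pos hq0 ht0) (by nlinarith)
    convert this using 2
    push_cast; ring

end InfiniteProducts

/-! ### The weight function -/

section Weight

variable {n : ℕ} {q t : ℝ}

theorem weight_eq_prod (q t : ℝ) (x : Fin n → ℂ) :
    weight q t x = ∏ i, ∏ j, if i < j then pairWeight q t (x i / x j) else 1 := by
  refine Finset.prod_congr rfl fun i _ => ?_
  rw [← Finset.prod_filter]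
  refine Finset.prod_congr (by ext j; simp) fun j _ => ?_
  rw [pairWeight, inv_div]

/-- The points near which the weight is analytic. -/
def IsRegularPoint (q t : ℝ) (x : Fin n → ℂ) : Prop :=
  (∀ i, x i ≠ 0) ∧ ∀ i j, i < j → t * ‖x i‖ < ‖x j‖ ∧ q * t * ‖x j‖ < ‖x i‖

theorem isRegularPoint_of_norm_eq_one (hq0 : 0 < q) (hq1 : q < 1) (ht1 : t < 1)
    {x : Fin n → ℂ} (hx : ∀ i, ‖x i‖ = 1) : IsRegularPoint q t x := by
  refine ⟨fun i => norm_ne_zero_iff.mp (by rw [hx]; exact one_ne_zero), fun i j _ => ?_⟩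
  rw [hx, hx]
  constructor <;> nlinarith

theorem isRegularPoint_cons (hq0 : 0 < q) (hq1 : q < 1) (ht0 : 0 < t) (ht1 : t < 1) {m : ℕ}
    {z : ℂ} (hz : q ≤ ‖z‖) (hz1 : ‖z‖ ≤ 1) {y : Fin m → ℂ} (hy : ∀ i, ‖y i‖ = 1) :
    IsRegularPoint q t (Fin.cons z y : Fin (m + 1) → ℂ) := by
  refine ⟨fun i => ?_, fun i j hij => ?_⟩
  · rw [← norm_ne_zero_iff]
    cases i using Fin.cases with
    | zero => rw [Fin.cons_zero]; linarith
    | succ i => rw [Fin.cons_succ, hy]; exact one_ne_zero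
  · cases j using Fin.cases with
    | zero => exact absurd hij (Fin.not_lt_zero i)
    | succ j =>
      rw [Fin.cons_succ, hy]
      cases i using Fin.cases with
      | zero => rw [Fin.cons_zero]; constructor <;> nlinarith
      | succ i => rw [Fin.cons_succ, hy]; constructor <;> nlinarith

theorem differentiableAt_finset_prod {ι E : Type*} [NormedAddCommGroup E] [NormedSpace ℂ E]
    (s : Finset ι) {f : ι → E → ℂ} {x : E} (h : ∀ i ∈ s, DifferentiableAt ℂ (f i) x) :
    DifferentiableAt ℂ (fun y => ∏ i ∈ s, f i y) x := by
  classical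
  induction s using Finset.induction_on with
  | empty => simp
  | insert i s hi ih =>
    simp only [Finset.prod_insert hi]
    exact (h i (Finset.mem_insert_self i s)).mul
      (ih fun j hj => h j (Finset.mem_insert_of_mem hj))

theorem differentiableAt_weight (hq0 : 0 < q) (hq1 : q < 1) (ht0 : 0 < t) {x : Fin n → ℂ}
    (hx : IsRegularPoint q t x) : DifferentiableAt ℂ (weight q t) x := by
  have h : weight q t = fun x : Fin n → ℂ =>
      ∏ i, ∏ j, if i < j then pairWeight q t (x i / x j) else 1 := funext (weight_eq_prod q t)
  rw [h]
  refine differentiableAt_finset_prod _ fun i _ => differentiableAt_finset_prod _ fun j _ => ?_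
  by_cases hij : i < j
  · simp only [hij, if_true]
    obtain ⟨h1, h2⟩ := hx.2 i j hij
    have hj : 0 < ‖x j‖ := norm_pos_iff.mpr (hx.1 j)
    have hd : DifferentiableAt ℂ (fun x : Fin n → ℂ => x i / x j) x := by
      simp only [div_eq_mul_inv]
      exact DifferentiableAt.fun_mul (by fun_prop) (DifferentiableAt.fun_inv (by fun_prop) (hx.1 j))
    refine (differentiableAt_pairWeight hq0 hq1 ht0 (div_ne_zero (hx.1 i) (hx.1 j)) ?_ ?_).comp x hd
    · rwa [norm_div, ← mul_div_assoc, div_lt_one hj]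
    · rwa [norm_div, lt_div_iff₀ hj]
  · simp only [hij, if_false]
    exact differentiableAt_const _

theorem weight_ne_zero (hq0 : 0 < q) (hq1 : q < 1) (ht0 : 0 < t) (ht1 : t < 1) {x : Fin n → ℂ}
    (hx : ∀ i, ‖x i‖ = 1) (hinj : Function.Injective x) : weight q t x ≠ 0 := by
  rw [weight_eq_prod]
  refine Finset.prod_ne_zero_iff.mpr fun i _ => Finset.prod_ne_zero_iff.mpr fun j _ => ?_
  split_ifs with hij
  · refine pairWeight_ne_zero hq0 hq1 ht0 ht1 (by rw [norm_div, hx, hx, div_one]) fun h => ?_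
    rw [div_eq_one_iff_eq (norm_ne_zero_iff.mp (by rw [hx]; exact one_ne_zero))] at h
    exact hij.ne (hinj h)
  · exact one_ne_zero

theorem weight_cons {m : ℕ} (q t : ℝ) (z : ℂ) (y : Fin m → ℂ) :
    weight q t (Fin.cons z y : Fin (m + 1) → ℂ) =
      (∏ j, pairWeight q t (z / y j)) * weight q t y := by
  rw [weight_eq_prod, Fin.prod_univ_succ, weight_eq_prod]
  congr 1
  · rw [Fin.prod_univ_succ]; simp
  · refine Finset.prod_congr rfl fun i _ => ?_
    rw [Fin.prod_univ_succ]; simp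

theorem weight_eq_snoc {m : ℕ} (q t : ℝ) (x : Fin (m + 1) → ℂ) :
    weight q t x = (∏ j : Fin m, pairWeight q t (x j.castSucc / x (Fin.last m))) *
      weight q t fun i : Fin m => x i.castSucc := by
  rw [weight_eq_prod, Fin.prod_univ_castSucc, weight_eq_prod, mul_comm, ← Finset.prod_mul_distrib]
  have h1 : ∏ j, (if Fin.last m < j then pairWeight q t (x (Fin.last m) / x j) else 1) = 1 :=
    Finset.prod_eq_one fun j _ => if_neg (Fin.le_last j).not_gt
  rw [h1, one_mul]
  refine Finset.prod_congr rfl fun i _ => ?_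
  rw [Fin.prod_univ_castSucc, if_pos (Fin.castSucc_lt_last i), mul_comm]
  simp

/-- `W(q x_n, x_1, …, x_{n-1}) = W(x_1, …, x_n)`. -/
theorem weight_cons_mul (hq0 : 0 < q) {m : ℕ} (t : ℝ) (x : Fin (m + 1) → ℂ) :
    weight q t (Fin.cons (q * x (Fin.last m)) fun i : Fin m => x i.castSucc) = weight q t x := by
  rw [weight_cons, weight_eq_snoc]
  congr 1
  refine Finset.prod_congr rfl fun j _ => ?_
  rw [mul_div_assoc, pairWeight_mul hq0, inv_div]

/-- The product of the factors of the weight other than that of the adjacent pair `k`. -/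
noncomputable def weightRest {m : ℕ} (q t : ℝ) (k : Fin m) (x : Fin (m + 1) → ℂ) : ℂ :=
  ∏ p : Fin (m + 1) × Fin (m + 1), if p.1 < p.2 ∧ ¬ (p.1 = k.castSucc ∧ p.2 = k.succ) then
    pairWeight q t (x p.1 / x p.2) else 1

theorem weight_eq_mul_weightRest {m : ℕ} (q t : ℝ) (k : Fin m) (x : Fin (m + 1) → ℂ) :
    weight q t x = pairWeight q t (x k.castSucc / x k.succ) * weightRest q t k x := by
  rw [weight_eq_prod, ← Fintype.prod_prod_type', weightRest,
    ← Finset.mul_prod_erase _ _ (Finset.mem_univ (k.castSucc, k.succ))]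
  rw [← Finset.mul_prod_erase Finset.univ (fun p : Fin (m + 1) × Fin (m + 1) =>
    if p.1 < p.2 ∧ ¬ (p.1 = k.castSucc ∧ p.2 = k.succ) then
    pairWeight q t (x p.1 / x p.2) else 1) (Finset.mem_univ (k.castSucc, k.succ))]
  simp only [k.castSucc_lt_succ, if_true, and_self, not_true_eq_false, and_false, if_false, one_mul]
  congr 1
  refine Finset.prod_congr rfl fun p hp => ?_
  have : ¬ (p.1 = k.castSucc ∧ p.2 = k.succ) := fun h =>
    (Finset.mem_erase.mp hp).1 (Prod.ext h.1 h.2)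
  simp [this]

/-- An adjacent transposition permutes the pairs i < j other than (k, k + 1). -/
theorem weightRest_comp_adjSwap {m : ℕ} (q t : ℝ) (k : Fin m) (x : Fin (m + 1) → ℂ) :
    weightRest q t k (x ∘ adjSwap k) = weightRest q t k x := by
  rw [weightRest, weightRest, ← Equiv.prod_comp ((adjSwap k).prodCongr (adjSwap k))
    fun p : Fin (m + 1) × Fin (m + 1) => if p.1 < p.2 ∧ ¬ (p.1 = k.castSucc ∧ p.2 = k.succ) then
    pairWeight q t (x p.1 / x p.2) else 1]
  refine Finset.prod_congr rfl fun p _ => if_congr ?_ rfl rfl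
  simp only [Equiv.prodCongr_apply, Prod.map]
  simp only [Fin.lt_def, adjSwap_val, Fin.ext_iff, Fin.val_castSucc, Fin.val_succ]
  split_ifs <;> omega

end Weight

/-! ### The constant term -/

section ConstantTerm

open MeasureTheory

variable {n m : ℕ}

/-- The point of the torus with the given arguments. -/
noncomputable def torusPoint (θ : Fin n → ℝ) : Fin n → ℂ :=
  fun i => Complex.exp (2 * Real.pi * Complex.I * θ i)

theorem constantTerm_eq (F : (Fin n → ℂ) → ℂ) :
    constantTerm F = ∫ θ in Set.Icc (0 : Fin n → ℝ) 1, F (torusPoint θ) := rfl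

theorem norm_torusPoint (θ : Fin n → ℝ) (i : Fin n) : ‖torusPoint θ i‖ = 1 := by
  rw [torusPoint, show (2 * Real.pi * Complex.I * θ i : ℂ) = ((2 * Real.pi * θ i : ℝ) : ℂ) *
    Complex.I by push_cast; ring, Complex.norm_exp_ofReal_mul_I]

theorem continuous_torusPoint : Continuous (torusPoint (n := n)) := by
  unfold torusPoint
  fun_prop

theorem constantTerm_congr {F G : (Fin n → ℂ) → ℂ} (h : ∀ x, (∀ i, ‖x i‖ = 1) → F x = G x) :
    constantTerm F = constantTerm G := by
  rw [constantTerm_eq, constantTerm_eq]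
  congr 1
  funext θ
  exact h _ (norm_torusPoint θ)

theorem constantTerm_comp_perm (F : (Fin n → ℂ) → ℂ) (σ : Equiv.Perm (Fin n)) :
    constantTerm (fun x => F (x ∘ σ)) = constantTerm F := by
  rw [constantTerm_eq, constantTerm_eq]
  have hmp := volume_measurePreserving_piCongrLeft (fun _ : Fin n => ℝ) σ.symm
  have hcoe : ∀ θ : Fin n → ℝ, MeasurableEquiv.piCongrLeft (fun _ : Fin n => ℝ) σ.symm θ = θ ∘ σ := by
    intro θ
    funext i
    have := Equiv.piCongrLeft_apply (fun _ : Fin n => ℝ) σ.symm θ i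
    rw [MeasurableEquiv.coe_piCongrLeft]
    simpa using this
  have hpre : (MeasurableEquiv.piCongrLeft (fun _ : Fin n => ℝ) σ.symm) ⁻¹'
      Set.Icc (0 : Fin n → ℝ) 1 = Set.Icc 0 1 := by
    ext θ
    rw [Set.mem_preimage, hcoe]
    simp only [Set.mem_Icc, Pi.le_def, Function.comp_apply, Pi.zero_apply, Pi.one_apply]
    exact and_congr (σ.forall_congr_right (q := fun i => 0 ≤ θ i))
      (σ.forall_congr_right (q := fun i => θ i ≤ 1))
  have h := hmp.setIntegral_preimage_emb (MeasurableEquiv.measurableEmbedding _)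
    (fun θ => F (torusPoint θ)) (Set.Icc 0 1)
  rw [hpre] at h
  rw [← h]
  congr 1
  funext θ
  rw [hcoe]
  rfl

/-- Regularity on the torus that suffices for the manipulation of constant terms. -/
def ContinuousAtTorus (F : (Fin n → ℂ) → ℂ) : Prop := ∀ x, (∀ i, ‖x i‖ = 1) → ContinuousAt F x

theorem ContinuousAtTorus.continuous {F : (Fin n → ℂ) → ℂ} (hF : ContinuousAtTorus F) :
    Continuous fun θ => F (torusPoint θ) :=
  continuous_iff_continuousAt.mpr fun θ =>
    ContinuousAt.comp (f := torusPoint) (hF _ (norm_torusPoint θ)) continuous_torusPoint.continuousAt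

theorem ContinuousAtTorus.integrableOn {F : (Fin n → ℂ) → ℂ} (hF : ContinuousAtTorus F) :
    IntegrableOn (fun θ => F (torusPoint θ)) (Set.Icc (0 : Fin n → ℝ) 1) :=
  hF.continuous.continuousOn.integrableOn_compact isCompact_Icc

theorem constantTerm_add {F G : (Fin n → ℂ) → ℂ} (hF : ContinuousAtTorus F)
    (hG : ContinuousAtTorus G) :
    constantTerm (fun x => F x + G x) = constantTerm F + constantTerm G :=
  integral_add hF.integrableOn hG.integrableOn

theorem constantTerm_const_mul (c : ℂ) (F : (Fin n → ℂ) → ℂ) :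
    constantTerm (fun x => c * F x) = c * constantTerm F :=
  integral_const_mul c _

theorem integral_unit_eq_circleAverage (φ : ℂ → ℂ) (r : ℝ) :
    ∫ s in Set.Icc (0 : ℝ) 1, φ (r * Complex.exp (2 * Real.pi * Complex.I * s)) =
      Real.circleAverage φ 0 r := by
  rw [integral_Icc_eq_integral_Ioc, ← intervalIntegral.integral_of_le zero_le_one,
    Real.circleAverage_def]
  have h := intervalIntegral.integral_comp_mul_left (a := 0) (b := 1)
    (fun θ : ℝ => φ (circleMap 0 r θ)) (c := 2 * Real.pi) (by positivity)
  rw [mul_zero, mul_one] at h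
  rw [← h]
  congr 1
  funext s
  rw [circleMap_zero]
  congr 3
  push_cast
  ring

/-- The mean over a circle is a contour integral of φ(z)/z, and Cauchy's theorem on the annulus
applies. -/
theorem circleAverage_eq_of_differentiableAt {q : ℝ} (hq0 : 0 < q) (hq1 : q < 1) {φ : ℂ → ℂ}
    (h : ∀ z, q ≤ ‖z‖ → ‖z‖ ≤ 1 → DifferentiableAt ℂ φ z) :
    Real.circleAverage φ 0 q = Real.circleAverage φ 0 1 := by
  rw [Real.circleAverage_eq_circleIntegral hq0.ne', Real.circleAverage_eq_circleIntegral one_ne_zero]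
  congr 1
  refine (Complex.circleIntegral_sub_center_inv_smul_eq_of_differentiable_on_annulus_off_countable
    hq0 hq1.le Set.countable_empty (fun z hz => ?_) fun z hz => ?_).symm
  · refine (h z ?_ ?_).continuousAt.continuousWithinAt
    · simpa using hz.2
    · simpa using hz.1
  · refine h z ?_ ?_
    · have := hz.1.2
      simp only [Metric.mem_closedBall, dist_zero_right, not_le] at this
      exact this.le
    · have := hz.1.1
      simp only [Metric.mem_ball, dist_zero_right] at this
      exact this.le

theorem torusPoint_cons (s : ℝ) (θ : Fin m → ℝ) : torusPoint (Fin.cons s θ : Fin (m + 1) → ℝ) =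
    Fin.cons (Complex.exp (2 * Real.pi * Complex.I * s)) (torusPoint θ) := by
  funext i
  cases i using Fin.cases <;> simp [torusPoint]

theorem constantTerm_eq_integral_integral {F : (Fin (m + 1) → ℂ) → ℂ}
    (hF : ContinuousAtTorus F) : constantTerm F = ∫ θ in Set.Icc (0 : Fin m → ℝ) 1,
      ∫ s in Set.Icc (0 : ℝ) 1, F (Fin.cons (Complex.exp (2 * Real.pi * Complex.I * s))
        (torusPoint θ)) := by
  have hmp := (volume_preserving_piFinSuccAbove (fun _ : Fin (m + 1) => ℝ) 0).symm
  have hcoe : ∀ p : ℝ × (Fin m → ℝ),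
      (MeasurableEquiv.piFinSuccAbove (fun _ : Fin (m + 1) => ℝ) 0).symm p = Fin.cons p.1 p.2 := by
    intro p
    funext i
    cases i using Fin.cases <;> simp [MeasurableEquiv.piFinSuccAbove]
  have hpre : (MeasurableEquiv.piFinSuccAbove (fun _ : Fin (m + 1) => ℝ) 0).symm ⁻¹'
      Set.Icc (0 : Fin (m + 1) → ℝ) 1 = Set.Icc 0 1 ×ˢ Set.Icc 0 1 := by
    ext p
    rw [Set.mem_preimage, hcoe]
    simp only [Set.mem_Icc, Pi.le_def, Fin.forall_fin_succ, Fin.cons_zero, Fin.cons_succ,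
      Set.mem_prod, Pi.zero_apply, Pi.one_apply]
    tauto
  have hint : IntegrableOn (fun p : ℝ × (Fin m → ℝ) => F (torusPoint (Fin.cons p.1 p.2)))
      (Set.Icc 0 1 ×ˢ Set.Icc 0 1) (volume.prod volume) := by
    refine ContinuousOn.integrableOn_compact (isCompact_Icc.prod isCompact_Icc)
      (Continuous.continuousOn ?_)
    exact hF.continuous.comp (by fun_prop)
  rw [constantTerm_eq, ← hmp.setIntegral_preimage_emb (MeasurableEquiv.measurableEmbedding _), hpre]
  simp only [hcoe]
  rw [Measure.volume_eq_prod, ← Measure.prod_restrict, integral_prod_symm]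
  · simp only [torusPoint_cons]
  · rw [Measure.prod_restrict]; exact hint

/-- Shift of the contour `|x_1| = 1` to `|x_1| = q`. -/
theorem constantTerm_shift {q : ℝ} (hq0 : 0 < q) (hq1 : q < 1) {F : (Fin (m + 1) → ℂ) → ℂ}
    (hF : ∀ (z : ℂ) (y : Fin m → ℂ), q ≤ ‖z‖ → ‖z‖ ≤ 1 → (∀ i, ‖y i‖ = 1) →
      DifferentiableAt ℂ F (Fin.cons z y)) :
    constantTerm (fun x => F (Fin.cons (q * x 0) fun i : Fin m => x i.succ)) =
      constantTerm F := by
  have hcons : ∀ y : Fin m → ℂ, Differentiable ℂ fun z : ℂ => (Fin.cons z y : Fin (m + 1) → ℂ) := by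
    intro y
    rw [differentiable_pi]
    intro i
    cases i using Fin.cases with
    | zero => simp only [Fin.cons_zero]; fun_prop
    | succ i => simp only [Fin.cons_succ]; fun_prop
  have h1 : ContinuousAtTorus F := fun x hx => by
    have := (hF (x 0) (fun i => x i.succ) (by rw [hx]; exact hq1.le) (hx 0).le
      fun i => hx _).continuousAt
    rwa [show (Fin.cons (x 0) fun i : Fin m => x i.succ : Fin (m + 1) → ℂ) = x from
      Fin.cons_self_tail x] at this
  have hc2 : Continuous fun x : Fin (m + 1) → ℂ =>
      (Fin.cons ((q : ℂ) * x 0) fun i : Fin m => x i.succ : Fin (m + 1) → ℂ) := by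
    fun_prop
  have h2 : ContinuousAtTorus fun x =>
      F (Fin.cons (q * x 0) fun i : Fin m => x i.succ) := fun x hx => by
    refine ContinuousAt.comp (f := fun x : Fin (m + 1) → ℂ =>
      (Fin.cons ((q : ℂ) * x 0) fun i : Fin m => x i.succ : Fin (m + 1) → ℂ)) ?_ hc2.continuousAt
    have hz : ‖(q : ℂ) * x 0‖ = q := by
      rw [norm_mul, hx, mul_one, Complex.norm_real, Real.norm_of_nonneg hq0.le]
    exact (hF _ _ hz.ge (hz.trans_le hq1.le) fun i => hx _).continuousAt
  rw [constantTerm_eq_integral_integral h1, constantTerm_eq_integral_integral h2]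
  congr 1
  funext θ
  simp only [Fin.cons_zero, Fin.cons_succ]
  have e1 := integral_unit_eq_circleAverage (fun z => F (Fin.cons z (torusPoint θ))) q
  have e2 := integral_unit_eq_circleAverage (fun z => F (Fin.cons z (torusPoint θ))) 1
  simp only [Complex.ofReal_one, one_mul] at e2
  rw [e2, ← circleAverage_eq_of_differentiableAt hq0 hq1 fun z hz hz1 => ?_, ← e1]
  exact (hF z _ hz hz1 (norm_torusPoint θ)).comp z (hcons (torusPoint θ) z)

end ConstantTerm

/-! ### The bilinear form -/

section BilinearForm

variable {n m : ℕ} {q t : ℝ}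

/-- The integrand of the scalar product. -/
noncomputable def pairingIntegrand (q t : ℝ) (f g : MvPolynomial (Fin n) ℝ) (x : Fin n → ℂ) : ℂ :=
  aeval x f * aeval (fun i => (x i)⁻¹) g * weight q t x

/-- `CT (f(x) g(1/x) W(x))`. -/
noncomputable def pairing (q t : ℝ) (f g : MvPolynomial (Fin n) ℝ) : ℂ :=
  constantTerm (pairingIntegrand q t f g)

theorem differentiable_aeval (f : MvPolynomial (Fin n) ℝ) :
    Differentiable ℂ fun x : Fin n → ℂ => (aeval x f : ℂ) := by
  induction f using MvPolynomial.induction_on with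
  | C a => simp
  | add p r hp hr => simp only [map_add]; exact hp.add hr
  | mul_X p i hp =>
    simp only [map_mul, aeval_X]
    exact hp.mul (by fun_prop)

theorem differentiableAt_pairingIntegrand (hq0 : 0 < q) (hq1 : q < 1) (ht0 : 0 < t)
    (f g : MvPolynomial (Fin n) ℝ) {x : Fin n → ℂ} (hx : IsRegularPoint q t x) :
    DifferentiableAt ℂ (pairingIntegrand q t f g) x := by
  have hinv : DifferentiableAt ℂ (fun (x : Fin n → ℂ) i => (x i)⁻¹) x := by
    rw [differentiableAt_pi]
    exact fun i => DifferentiableAt.fun_inv (by fun_prop) (hx.1 i)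
  have h2 : DifferentiableAt ℂ (fun x : Fin n → ℂ => (aeval (fun i => (x i)⁻¹) g : ℂ)) x :=
    DifferentiableAt.comp x (g := fun y : Fin n → ℂ => (aeval y g : ℂ))
      (differentiable_aeval g _) hinv
  exact ((differentiable_aeval f x).mul h2).mul (differentiableAt_weight hq0 hq1 ht0 hx)

theorem continuousAtTorus_pairingIntegrand (hq0 : 0 < q) (hq1 : q < 1) (ht0 : 0 < t) (ht1 : t < 1)
    (f g : MvPolynomial (Fin n) ℝ) : ContinuousAtTorus (pairingIntegrand q t f g) := fun _ hx =>
  (differentiableAt_pairingIntegrand hq0 hq1 ht0 f g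
    (isRegularPoint_of_norm_eq_one hq0 hq1 ht1 hx)).continuousAt

theorem pairing_add_left (hq0 : 0 < q) (hq1 : q < 1) (ht0 : 0 < t) (ht1 : t < 1)
    (f f' g : MvPolynomial (Fin n) ℝ) :
    pairing q t (f + f') g = pairing q t f g + pairing q t f' g := by
  rw [pairing, pairing, pairing, ← constantTerm_add
    (continuousAtTorus_pairingIntegrand hq0 hq1 ht0 ht1 f g)
    (continuousAtTorus_pairingIntegrand hq0 hq1 ht0 ht1 f' g)]
  congr 1
  funext x
  simp only [pairingIntegrand, map_add]; ring

theorem pairing_add_right (hq0 : 0 < q) (hq1 : q < 1) (ht0 : 0 < t) (ht1 : t < 1)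
    (f g g' : MvPolynomial (Fin n) ℝ) :
    pairing q t f (g + g') = pairing q t f g + pairing q t f g' := by
  rw [pairing, pairing, pairing, ← constantTerm_add
    (continuousAtTorus_pairingIntegrand hq0 hq1 ht0 ht1 f g)
    (continuousAtTorus_pairingIntegrand hq0 hq1 ht0 ht1 f g')]
  congr 1
  funext x
  simp only [pairingIntegrand, map_add]; ring

theorem pairing_smul_left (c : ℝ) (f g : MvPolynomial (Fin n) ℝ) :
    pairing q t (c • f) g = c * pairing q t f g := by
  rw [pairing, pairing, ← constantTerm_const_mul]
  congr 1
  funext x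
  simp only [pairingIntegrand, map_smul, Complex.real_smul]; ring

theorem pairing_smul_right (c : ℝ) (f g : MvPolynomial (Fin n) ℝ) :
    pairing q t f (c • g) = c * pairing q t f g := by
  rw [pairing, pairing, ← constantTerm_const_mul]
  congr 1
  funext x
  simp only [pairingIntegrand, map_smul, Complex.real_smul]; ring

theorem aeval_opOmega (r : ℝ) (f : MvPolynomial (Fin (m + 1)) ℝ) (x : Fin (m + 1) → ℂ) :
    (aeval x (opOmega r f) : ℂ) =
      aeval (Fin.cons ((r : ℂ) * x (Fin.last m)) fun i : Fin m => x i.castSucc :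
        Fin (m + 1) → ℂ) f := by
  rw [opOmega_apply, ← AlgHom.comp_apply]
  congr 1
  refine algHom_ext fun j => ?_
  rw [AlgHom.comp_apply, aeval_X]
  cases j using Fin.cases with
  | zero => simp [cyclicShift_X_zero]
  | succ j => simp [cyclicShift_X_succ]

/-- With 1/q in the second argument and the cyclic invariance of W, the new integrand is the old one
evaluated at (q x_n, x_1, …, x_{n-1}). A rotation of the variables and the contour shift remove this
substitution. -/
theorem pairing_opOmega (hq0 : 0 < q) (hq1 : q < 1) (ht0 : 0 < t) (ht1 : t < 1)
    (f g : MvPolynomial (Fin (m + 1)) ℝ) :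
    pairing q t (opOmega q f) (opOmega q⁻¹ g) = pairing q t f g := by
  have h1 : pairingIntegrand q t (opOmega q f) (opOmega q⁻¹ g) = fun x : Fin (m + 1) → ℂ =>
      (fun y : Fin (m + 1) → ℂ => pairingIntegrand q t f g
        (Fin.cons (q * y 0) fun i : Fin m => y i.succ)) (x ∘ (finRotate (m + 1)).symm) := by
    funext x
    have e0 : (finRotate (m + 1)).symm 0 = Fin.last m := by
      rw [Equiv.symm_apply_eq, finRotate_last]
    have es : ∀ i : Fin m, (finRotate (m + 1)).symm i.succ = i.castSucc := fun i => by
      rw [Equiv.symm_apply_eq, finRotate_castSucc]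
    simp only [Function.comp_apply, e0, es]
    rw [pairingIntegrand, pairingIntegrand, aeval_opOmega, aeval_opOmega, weight_cons_mul hq0]
    congr 4
    funext j
    cases j using Fin.cases with
    | zero => simp [mul_comm]
    | succ j => simp
  rw [pairing, h1, constantTerm_comp_perm (fun y : Fin (m + 1) → ℂ => pairingIntegrand q t f g
    (Fin.cons (q * y 0) fun i : Fin m => y i.succ)), constantTerm_shift hq0 hq1, pairing]
  intro z y hz hz1 hy
  exact differentiableAt_pairingIntegrand hq0 hq1 ht0 f g
    (isRegularPoint_cons hq0 hq1 ht0 ht1 hz hz1 hy)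

theorem aeval_opT (s : ℝ) (k : Fin m) (f : MvPolynomial (Fin (m + 1)) ℝ) (x : Fin (m + 1) → ℂ) :
    (x k.castSucc - x k.succ) * (aeval x (opT s k f) : ℂ) =
      (s * x k.castSucc - x k.succ) * aeval (x ∘ adjSwap k) f +
        (1 - s) * x k.succ * aeval x f := by
  rw [adjSwap]
  have h := congrArg (aeval x : MvPolynomial (Fin (m + 1)) ℝ →ₐ[ℝ] ℂ)
    (pairT_spec s k.castSucc_lt_succ.ne f)
  simpa only [opT_eq_pairT, map_mul, map_sub, map_add, map_one, aeval_X, aeval_rename, aeval_C,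
    Complex.coe_algebraMap] using h

/-- After removal of the common symmetric factors this is a rational identity in x_k, x_{k+1}, t and
the values of f, g at x and s_k x. The individual summands on the two sides need not agree. -/
theorem pairingIntegrand_opT_symm (hq0 : 0 < q) (hq1 : q < 1) (ht0 : 0 < t) (ht1 : t < 1)
    (k : Fin m) (f g : MvPolynomial (Fin (m + 1)) ℝ) {x : Fin (m + 1) → ℂ}
    (hx : ∀ i, ‖x i‖ = 1) :
    pairingIntegrand q t (opT t k f) (opT t⁻¹ k g) x +
      pairingIntegrand q t (opT t k f) (opT t⁻¹ k g) (x ∘ adjSwap k) =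
    pairingIntegrand q t f g x + pairingIntegrand q t f g (x ∘ adjSwap k) := by
  have hinv : (fun i => ((x ∘ adjSwap k) i)⁻¹) = (fun i => (x i)⁻¹) ∘ adjSwap k := rfl
  have e1 := aeval_opT t k f x
  have e2 := aeval_opT t k f (x ∘ adjSwap k)
  have e3 := aeval_opT t⁻¹ k g fun i => (x i)⁻¹
  have e4 := aeval_opT t⁻¹ k g ((fun i => (x i)⁻¹) ∘ adjSwap k)
  rw [comp_adjSwap_comp_adjSwap] at e2 e4
  simp only [Function.comp_apply, adjSwap_castSucc, adjSwap_succ] at e2 e4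
  simp only [pairingIntegrand, hinv, weight_eq_mul_weightRest q t k, weightRest_comp_adjSwap]
  simp only [Function.comp_apply, adjSwap_castSucc, adjSwap_succ]
  have ha : x k.castSucc ≠ 0 := norm_ne_zero_iff.mp (by rw [hx]; exact one_ne_zero)
  have hb : x k.succ ≠ 0 := norm_ne_zero_iff.mp (by rw [hx]; exact one_ne_zero)
  have hn : ‖x k.castSucc / x k.succ‖ = 1 := by rw [norm_div, hx, hx, div_one]
  have hn' : ‖x k.succ / x k.castSucc‖ = 1 := by rw [norm_div, hx, hx, div_one]
  rw [pairWeight_eq hq0 hq1 ht0 ht1 hn, pairWeight_eq hq0 hq1 ht0 ht1 hn',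
    ← pairWeightSymm_inv q t (x k.castSucc / x k.succ), inv_div, inv_div]
  generalize x k.castSucc = a at *
  generalize x k.succ = b at *
  generalize pairWeightSymm q t (b / a) = v at *
  generalize weightRest q t k x = w at *
  generalize (aeval x f : ℂ) = F at *
  generalize (aeval (x ∘ adjSwap k) f : ℂ) = F' at *
  generalize (aeval (fun i => (x i)⁻¹) g : ℂ) = G at *
  generalize (aeval ((fun i => (x i)⁻¹) ∘ adjSwap k) g : ℂ) = G' at *
  generalize (aeval x (opT t k f) : ℂ) = P at *
  generalize (aeval (x ∘ adjSwap k) (opT t k f) : ℂ) = P' at *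
  generalize (aeval (fun i => (x i)⁻¹) (opT t⁻¹ k g) : ℂ) = R at *
  generalize (aeval ((fun i => (x i)⁻¹) ∘ adjSwap k) (opT t⁻¹ k g) : ℂ) = R' at *
  -- On the diagonal the weight of the pair contains 1 − u = 0, so both sides vanish; elsewhere the
  -- divided differences can be solved for.
  by_cases hab : a = b
  · subst hab
    rw [div_self ha]; ring
  have hab' : a - b ≠ 0 := sub_ne_zero.mpr hab
  have hba' : b - a ≠ 0 := sub_ne_zero.mpr (Ne.symm hab)
  have ht : (t : ℂ) ≠ 0 := by exact_mod_cast ht0.ne'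
  have hP : P = ((t * a - b) * F' + (1 - t) * b * F) / (a - b) := by
    rw [eq_div_iff hab', ← e1, mul_comm]
  have hP' : P' = ((t * b - a) * F + (1 - t) * a * F') / (b - a) := by
    rw [eq_div_iff hba', ← e2, mul_comm]
  have hR : R = (((t : ℂ)⁻¹ * b - a) * G' + (1 - (t : ℂ)⁻¹) * a * G) / (b - a) := by
    rw [eq_div_iff hba']
    rw [Complex.ofReal_inv] at e3
    field_simp at e3 ⊢
    linear_combination e3
  have hR' : R' = (((t : ℂ)⁻¹ * a - b) * G + (1 - (t : ℂ)⁻¹) * b * G') / (a - b) := by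
    rw [eq_div_iff hab']
    rw [Complex.ofReal_inv] at e4
    field_simp at e4 ⊢
    linear_combination e4
  rw [hP, hP', hR, hR', ← neg_sub a b]
  field_simp
  ring

theorem pairing_opT (hq0 : 0 < q) (hq1 : q < 1) (ht0 : 0 < t) (ht1 : t < 1) (k : Fin m)
    (f g : MvPolynomial (Fin (m + 1)) ℝ) :
    pairing q t (opT t k f) (opT t⁻¹ k g) = pairing q t f g := by
  have hsymm : ∀ f g : MvPolynomial (Fin (m + 1)) ℝ, 2 * pairing q t f g =
      constantTerm fun x => pairingIntegrand q t f g x +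
        pairingIntegrand q t f g (x ∘ adjSwap k) := by
    intro f g
    have hc := continuousAtTorus_pairingIntegrand hq0 hq1 ht0 ht1 f g
    have hc' : ContinuousAtTorus fun x => pairingIntegrand q t f g (x ∘ adjSwap k) :=
      fun x hx => ContinuousAt.comp (f := fun x : Fin (m + 1) → ℂ => x ∘ adjSwap k)
        (hc _ fun i => hx _) (continuous_pi fun i => continuous_apply _).continuousAt
    rw [constantTerm_add hc hc', constantTerm_comp_perm, pairing, two_mul]
  have h := hsymm (opT t k f) (opT t⁻¹ k g)
  rw [constantTerm_congr fun x hx => pairingIntegrand_opT_symm hq0 hq1 ht0 ht1 k f g hx,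
    ← hsymm] at h
  exact mul_left_cancel₀ two_ne_zero h

end BilinearForm

/-! ### Orthogonality and recurrences for the norms -/

section Norms

variable {m : ℕ} {q t : ℝ}

theorem pairing_opTinv (hq0 : 0 < q) (hq1 : q < 1) (ht0 : 0 < t) (ht1 : t < 1) (k : Fin m)
    (f g : MvPolynomial (Fin (m + 1)) ℝ) :
    pairing q t (opTinv t k f) (opTinv t⁻¹ k g) = pairing q t f g := by
  have h := pairing_opT hq0 hq1 ht0 ht1 k (opTinv t k f) (opTinv t⁻¹ k g)
  rw [← Module.End.mul_apply, ← Module.End.mul_apply, opT_mul_opTinv ht0.ne',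
    opT_mul_opTinv (inv_ne_zero ht0.ne')] at h
  exact h.symm

theorem pairing_list_prod {ι : Type*} (A B : ι → Module.End ℝ (MvPolynomial (Fin (m + 1)) ℝ))
    (h : ∀ k f g, pairing q t (A k f) (B k g) = pairing q t f g) (l : List ι)
    (f g : MvPolynomial (Fin (m + 1)) ℝ) :
    pairing q t ((l.map A).prod f) ((l.map B).prod g) = pairing q t f g := by
  induction l with
  | nil => rfl
  | cons k l ih =>
    rw [List.map_cons, List.map_cons, List.prod_cons, List.prod_cons, Module.End.mul_apply,
      Module.End.mul_apply, h, ih]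

theorem pairing_opY (hq0 : 0 < q) (hq1 : q < 1) (ht0 : 0 < t) (ht1 : t < 1) (i : Fin (m + 1))
    (f g : MvPolynomial (Fin (m + 1)) ℝ) :
    pairing q t (opY q t i f) (opY q⁻¹ t⁻¹ i g) = pairing q t f g := by
  rw [opY, opY, LinearMap.smul_apply, LinearMap.smul_apply, pairing_smul_left, pairing_smul_right]
  simp only [Module.End.mul_apply]
  rw [pairing_list_prod _ _ (pairing_opT hq0 hq1 ht0 ht1), pairing_opOmega hq0 hq1 ht0 ht1,
    pairing_list_prod _ _ (pairing_opTinv hq0 hq1 ht0 ht1), ← mul_assoc, ← Complex.ofReal_mul,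
    inv_zpow, mul_inv_cancel₀ (zpow_ne_zero _ ht0.ne'), Complex.ofReal_one, one_mul]

theorem pairing_opPsi (hq0 : 0 < q) (hq1 : q < 1) (ht0 : 0 < t) (ht1 : t < 1)
    (f g : MvPolynomial (Fin (m + 1)) ℝ) :
    pairing q t (opPsi q f) (opPsi q⁻¹ g) = pairing q t f g := by
  rw [← pairing_opOmega hq0 hq1 ht0 ht1 f g]
  refine constantTerm_congr fun x hx => ?_
  have h0 : x (Fin.last m) ≠ 0 := norm_ne_zero_iff.mp (by rw [hx]; exact one_ne_zero)
  simp only [pairingIntegrand, opPsi, mulX, Module.End.mul_apply, LinearMap.mulLeft_apply, map_mul,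
    aeval_X]
  field_simp

/-- Invariance under Y_i multiplies the pairing by the quotient of the eigenvalues, since the second
one is inverted. If the pairing is non-zero, all quotients are 1, and the spectrum separates. -/
theorem pairing_macdonaldE_of_ne (hq0 : 0 < q) (hq1 : q < 1) (ht0 : 0 < t) (ht1 : t < 1)
    {η ν : Fin (m + 1) → ℕ} (hne : η ≠ ν) :
    pairing q t (macdonaldE η q t) (macdonaldE ν q⁻¹ t⁻¹) = 0 := by
  have hsep := separatesSpectrum (m := m) hq0 hq1 ht0 ht1
  have hE := isMacdonaldE_macdonaldE hq0.ne' ht0.ne' hsep η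
  have hE' := isMacdonaldE_macdonaldE (inv_ne_zero hq0.ne') (inv_ne_zero ht0.ne') hsep.inv ν
  by_contra h
  refine hne (hsep (funext fun i => ?_))
  have hp := pairing_opY hq0 hq1 ht0 ht1 i (macdonaldE η q t) (macdonaldE ν q⁻¹ t⁻¹)
  rw [hE.eigen, hE'.eigen, pairing_smul_left, pairing_smul_right, eigenvalue_inv, ← mul_assoc,
    mul_eq_right₀ h, ← Complex.ofReal_mul, Complex.ofReal_eq_one,
    mul_inv_eq_one₀ (eigenvalue_ne_zero hq0.ne' ht0.ne' ν i)] at hp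
  exact hp

theorem normE_eq_pairing (η : Fin (m + 1) → ℕ) :
    normE η q t = pairing q t (macdonaldE η q t) (macdonaldE η q⁻¹ t⁻¹) := rfl

/-- The normalising factors of Φ E_η at (q,t) and at the inverted parameters are mutually inverse
powers of q. -/
theorem normE_raise (hq0 : 0 < q) (hq1 : q < 1) (ht0 : 0 < t) (ht1 : t < 1)
    (η : Fin (m + 1) → ℕ) : normE (raise η) q t = normE η q t := by
  have hsep := separatesSpectrum (m := m) hq0 hq1 ht0 ht1
  have hq := hq0.ne'
  have ht := ht0.ne'
  have h1 := isMacdonaldE_raise hq ht hsep (isMacdonaldE_macdonaldE hq ht hsep η)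
  have h2 := isMacdonaldE_raise (inv_ne_zero hq) (inv_ne_zero ht) hsep.inv
    (isMacdonaldE_macdonaldE (inv_ne_zero hq) (inv_ne_zero ht) hsep.inv η)
  rw [normE_eq_pairing, normE_eq_pairing, h1.eq_macdonaldE hq ht hsep,
    h2.eq_macdonaldE (inv_ne_zero hq) (inv_ne_zero ht) hsep.inv, pairing_smul_left,
    pairing_smul_right, pairing_opPsi hq0 hq1 ht0 ht1, ← mul_assoc, ← Complex.ofReal_mul,
    inv_pow, inv_inv, inv_mul_cancel₀ (pow_ne_zero _ hq), Complex.ofReal_one, one_mul]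

/-- Expand T_k E_η = t E_{s_k η} − c E_η, and likewise at inverted parameters. By orthogonality,
invariance under T_k reads N_η = N_{s_k η} + c c' N_η. -/
theorem normE_comp_adjSwap (hq0 : 0 < q) (hq1 : q < 1) (ht0 : 0 < t) (ht1 : t < 1)
    {η : Fin (m + 1) → ℕ} {k : Fin m} (hk : η k.castSucc < η k.succ) :
    normE (η ∘ adjSwap k) q t =
      ((1 - swapCoeff q t η k * swapCoeff q⁻¹ t⁻¹ η k : ℝ) : ℂ) * normE η q t := by
  have hsep := separatesSpectrum (m := m) hq0 hq1 ht0 ht1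
  have hq := hq0.ne'
  have ht := ht0.ne'
  have hq' := inv_ne_zero hq
  have ht' := inv_ne_zero ht
  have h1 := (isMacdonaldE_swap hq ht hsep hk
    (isMacdonaldE_macdonaldE hq ht hsep η)).eq_macdonaldE hq ht hsep
  have h2 := (isMacdonaldE_swap hq' ht' hsep.inv hk
    (isMacdonaldE_macdonaldE hq' ht' hsep.inv η)).eq_macdonaldE hq' ht' hsep.inv
  have hne : η ≠ η ∘ adjSwap k := fun h => by
    have := congrFun h k.castSucc
    rw [Function.comp_apply, adjSwap_castSucc] at this
    exact hk.ne this
  have hp := pairing_opT hq0 hq1 ht0 ht1 k (macdonaldE η q t) (macdonaldE η q⁻¹ t⁻¹)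
  have e1 : opT t k (macdonaldE η q t) = t • macdonaldE (η ∘ adjSwap k) q t +
      (-swapCoeff q t η k) • macdonaldE η q t := by
    rw [h1, smul_smul, mul_inv_cancel₀ ht, one_smul, neg_smul, add_neg_cancel_right]
  have e2 : opT t⁻¹ k (macdonaldE η q⁻¹ t⁻¹) = t⁻¹ • macdonaldE (η ∘ adjSwap k) q⁻¹ t⁻¹ +
      (-swapCoeff q⁻¹ t⁻¹ η k) • macdonaldE η q⁻¹ t⁻¹ := by
    rw [h2, smul_smul, mul_inv_cancel₀ ht', one_smul, neg_smul, add_neg_cancel_right]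
  rw [e1, e2, pairing_add_left hq0 hq1 ht0 ht1, pairing_add_right hq0 hq1 ht0 ht1,
    pairing_add_right hq0 hq1 ht0 ht1] at hp
  simp only [pairing_smul_left, pairing_smul_right,
    pairing_macdonaldE_of_ne hq0 hq1 ht0 ht1 hne,
    pairing_macdonaldE_of_ne hq0 hq1 ht0 ht1 hne.symm, ← normE_eq_pairing] at hp
  have htc : (t : ℂ) ≠ 0 := by exact_mod_cast ht
  have e3 : ((t⁻¹ : ℝ) : ℂ) * (t * normE (η ∘ adjSwap k) q t) = normE (η ∘ adjSwap k) q t := by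
    rw [Complex.ofReal_inv, inv_mul_cancel_left₀ htc]
  rw [e3] at hp
  push_cast at hp ⊢
  linear_combination hp

end Norms

/-! ### Recurrences for the combinatorial constants -/

section Boxes

variable {m : ℕ}

/-- Row `k` contributes to the leg length of the node `(i, j)`. -/
def InLeg {n : ℕ} (η : Fin n → ℕ) (i : Fin n) (j : ℕ) (k : Fin n) : Prop :=
  (i < k ∧ j ≤ η k ∧ η k ≤ η i) ∨ (k < i ∧ j ≤ η k + 1 ∧ η k + 1 ≤ η i)

instance {n : ℕ} (η : Fin n → ℕ) (i : Fin n) (j : ℕ) (k : Fin n) : Decidable (InLeg η i j k) := by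
  unfold InLeg; infer_instance

theorem legLength_eq_card {n : ℕ} (η : Fin n → ℕ) (i : Fin n) (j : ℕ) :
    legLength η i j = (Finset.univ.filter fun k => InLeg η i j k).card := by
  rw [legLength, ← Finset.card_union_of_disjoint]
  · congr 1
    ext k
    simp only [Finset.mem_union, Finset.mem_filter, Finset.mem_univ, true_and]
    rfl
  · rw [Finset.disjoint_filter]
    rintro k - ⟨h1, -⟩ ⟨h2, -⟩
    exact h1.asymm h2

theorem card_filter_of_equiv {n : ℕ} {p r : Fin n → Prop} [DecidablePred p] [DecidablePred r]
    (σ : Equiv.Perm (Fin n)) (h : ∀ k, p k ↔ r (σ k)) :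
    (Finset.univ.filter p).card = (Finset.univ.filter r).card := by
  rw [← Finset.card_map σ.toEmbedding]
  congr 1
  ext k
  simp only [Finset.mem_map_equiv, Finset.mem_filter, Finset.mem_univ, true_and, h,
    Equiv.apply_symm_apply]

theorem legLength_raise_castSucc (η : Fin (m + 1) → ℕ) (i : Fin m) (j : ℕ) :
    legLength (raise η) i.castSucc j = legLength η i.succ j := by
  rw [legLength_eq_card, legLength_eq_card]
  refine card_filter_of_equiv (finRotate (m + 1)) fun k => ?_
  induction k using Fin.lastCases with
  | last =>
    simp [InLeg, Fin.castSucc_lt_last, (Fin.castSucc_lt_last i).asymm]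
  | cast k => simp [InLeg]

/-- The other rows pass from below the first row to above the last one; the clauses of the leg
length for rows below and above differ by just the unit that raising adds. -/
theorem legLength_raise_last (η : Fin (m + 1) → ℕ) (j : ℕ) :
    legLength (raise η) (Fin.last m) (j + 1) = legLength η 0 j := by
  rw [legLength_eq_card, legLength_eq_card]
  refine card_filter_of_equiv (finRotate (m + 1)) fun k => ?_
  induction k using Fin.lastCases with
  | last => simp [InLeg]
  | cast k => simp [InLeg, (Fin.castSucc_lt_last k).asymm, Fin.castSucc_lt_last]

/-- Each of the other m rows is counted in exactly one of the two. Column 0 is no node of η, but its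
leg length is that of the first node of the last row after raising. -/
theorem legLength_zero_add_legColength_zero (η : Fin (m + 1) → ℕ) :
    legLength η 0 0 + legColength η 0 = m := by
  simp only [legLength, legColength, Finset.card_filter, Fin.sum_univ_succ, lt_irrefl,
    Fin.not_lt_zero, Fin.succ_pos, false_and, true_and, if_false, Finset.sum_const_zero, zero_add,
    add_zero, Nat.zero_le]
  rw [← Finset.sum_add_distrib, Finset.sum_congr rfl (g := fun _ => 1)]
  · simp
  · intro k _
    by_cases h : η k.succ ≤ η 0
    · rw [if_pos h, if_neg (by omega)]
    · rw [if_neg h, if_pos (by omega)]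

variable {M : Type*} [CommMonoid M]

/-- The old nodes of the first row move one column to the right, keeping arm and leg, and the new
node enters in column 1. A general F covers d and d' at once. -/
theorem prod_legLength_raise (F : ℕ → ℕ → M) (η : Fin (m + 1) → ℕ) :
    ∏ i, ∏ j ∈ Finset.Icc 1 (raise η i), F (armLength (raise η) i j) (legLength (raise η) i j) =
      (∏ i, ∏ j ∈ Finset.Icc 1 (η i), F (armLength η i j) (legLength η i j)) *
        F (η 0) (legLength η 0 0) := by
  have hlast : ∏ j ∈ Finset.Icc 1 (η 0 + 1), F (η 0 + 1 - j)
      (legLength (raise η) (Fin.last m) j) = F (η 0) (legLength η 0 0) *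
        ∏ j ∈ Finset.Icc 1 (η 0), F (η 0 - j) (legLength η 0 j) := by
    have hIcc : ∀ (f : ℕ → M) (n : ℕ),
        ∏ j ∈ Finset.Icc 1 n, f j = ∏ j ∈ Finset.range n, f (j + 1) := fun f n => by
      induction n with
      | zero => rfl
      | succ n ih => rw [Finset.prod_Icc_succ_top (by omega), Finset.prod_range_succ, ih]
    rw [hIcc, hIcc, Finset.prod_range_succ', mul_comm, zero_add, Nat.add_sub_cancel,
      legLength_raise_last η 0]
    refine congrArg _ (Finset.prod_congr rfl fun j _ => ?_)
    rw [legLength_raise_last, Nat.add_sub_add_right]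
  rw [Fin.prod_univ_castSucc, Fin.prod_univ_succ]
  simp only [armLength, raise_castSucc, raise_last, legLength_raise_castSucc, hlast]
  simp only [mul_comm, mul_assoc]

theorem prod_legColength_raise (F : ℕ → ℕ → M) (η : Fin (m + 1) → ℕ) :
    ∏ i, ∏ j ∈ Finset.Icc 1 (raise η i), F (armColength j) (legColength (raise η) i) =
      (∏ i, ∏ j ∈ Finset.Icc 1 (η i), F (armColength j) (legColength η i)) *
        F (η 0) (legColength η 0) := by
  rw [Fin.prod_univ_castSucc, Fin.prod_univ_succ]
  simp only [raise_castSucc, raise_last, legColength_raise_castSucc, legColength_raise_last]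
  rw [Finset.prod_Icc_succ_top (by omega)]
  simp only [armColength, Nat.add_sub_cancel, mul_comm, mul_assoc]

theorem prod_legColength_comp_adjSwap (F : ℕ → ℕ → M) {η : Fin (m + 1) → ℕ} {k : Fin m}
    (hk : η k.castSucc ≠ η k.succ) :
    ∏ i, ∏ j ∈ Finset.Icc 1 ((η ∘ adjSwap k) i), F (armColength j)
        (legColength (η ∘ adjSwap k) i) =
      ∏ i, ∏ j ∈ Finset.Icc 1 (η i), F (armColength j) (legColength η i) := by
  simp only [legColength_comp_adjSwap hk, Function.comp_apply]
  exact Equiv.prod_comp (adjSwap k) fun i =>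
    ∏ j ∈ Finset.Icc 1 (η i), F (armColength j) (legColength η i)

/-- Only the contribution of the shorter of rows k, k + 1 to the leg of the longer depends on their
order: from above it reaches column η_k + 1, from below only column η_k. -/
theorem legLength_comp_adjSwap {η : Fin (m + 1) → ℕ} {k : Fin m}
    (hk : η k.castSucc < η k.succ) (i : Fin (m + 1)) (j : ℕ) :
    legLength η (adjSwap k i) j = legLength (η ∘ adjSwap k) i j +
      if i = k.castSucc ∧ j = η k.castSucc + 1 then 1 else 0 := by
  have hne : k.castSucc < k.succ := k.castSucc_lt_succ
  have hsum : ∑ l, (if i = k.castSucc ∧ l = k.succ ∧ j = η k.castSucc + 1 then 1 else 0) =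
      if i = k.castSucc ∧ j = η k.castSucc + 1 then 1 else 0 := by
    by_cases h : i = k.castSucc ∧ j = η k.castSucc + 1
    · simp [h]
    · rw [if_neg h]
      refine Finset.sum_eq_zero fun l _ => if_neg ?_
      tauto
  rw [legLength_eq_card, legLength_eq_card, Finset.card_filter, Finset.card_filter,
    ← Equiv.sum_comp (adjSwap k), ← hsum, ← Finset.sum_add_distrib]
  refine Finset.sum_congr rfl fun l _ => ?_
  by_cases h1 : i = k.castSucc ∧ l = k.succ
  · obtain ⟨rfl, rfl⟩ := h1
    simp only [InLeg, adjSwap_castSucc, adjSwap_succ, Function.comp_apply, hne, hne.asymm,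
      false_and, false_or, true_and, or_false]
    split_ifs <;> omega
  · have h3 : ¬ (i = k.castSucc ∧ l = k.succ ∧ j = η k.castSucc + 1) := by tauto
    rw [if_neg h3, add_zero]
    refine if_congr ?_ rfl rfl
    by_cases h2 : i = k.succ ∧ l = k.castSucc
    · obtain ⟨rfl, rfl⟩ := h2
      simp only [InLeg, adjSwap_castSucc, adjSwap_succ, Function.comp_apply, hne, hne.asymm,
        false_and, false_or, true_and, or_false]
      omega
    · simp only [InLeg, Function.comp_apply]
      rw [adjSwap_lt_iff k h1 h2, adjSwap_lt_iff k (by tauto) (by tauto)]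

theorem legColength_castSucc_eq {η : Fin (m + 1) → ℕ} {k : Fin m}
    (hk : η k.castSucc < η k.succ) :
    legColength η k.castSucc = legColength η k.succ + legLength η k.succ (η k.castSucc + 1) := by
  have hne : k.castSucc < k.succ := k.castSucc_lt_succ
  -- The two diagonal indicators balance row k, which lies in the leg without preceding itself, and
  -- row k + 1, which precedes row k but is not in its own leg.
  have h : ∑ l, ((if RowPrecedes η l k.castSucc then 1 else 0) +
      if l = k.castSucc then 1 else 0) =
      ∑ l, ((if RowPrecedes η l k.succ then 1 else 0) +
        (if InLeg η k.succ (η k.castSucc + 1) l then 1 else 0) +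
          if l = k.succ then 1 else 0) := by
    refine Finset.sum_congr rfl fun l _ => ?_
    by_cases h1 : l = k.castSucc
    · subst h1
      simp only [RowPrecedes, InLeg, hne, hne.ne, hne.asymm, lt_irrefl, and_false, or_false,
        if_false, if_true, true_and, false_and, false_or]
      rw [if_neg (by omega), if_pos (by omega)]
    · by_cases h2 : l = k.succ
      · subst h2
        simp only [RowPrecedes, InLeg, hne.ne', hne.asymm, lt_irrefl, and_false, or_false,
          if_false, if_true, false_and, hk]
      · simp only [RowPrecedes, InLeg, h1, h2, if_false, add_zero]
        have h3 : (l : ℕ) ≠ k := fun h => h1 (Fin.ext h)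
        have h4 : (l : ℕ) ≠ k + 1 := fun h => h2 (Fin.ext h)
        simp only [Fin.lt_def, Fin.val_castSucc, Fin.val_succ]
        split_ifs <;> omega
  simp only [Finset.sum_add_distrib, Finset.sum_ite_eq', Finset.mem_univ, if_true,
    ← Finset.card_filter] at h
  rw [legColength_eq_card, legColength_eq_card, legLength_eq_card]
  omega

/-- Cross-multiplied, so that no division is needed: the two products differ in one node of the
longer row. -/
theorem prod_legLength_comp_adjSwap (F : ℕ → ℕ → M) {η : Fin (m + 1) → ℕ} {k : Fin m}
    (hk : η k.castSucc < η k.succ) {L : ℕ}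
    (hL : legLength η k.succ (η k.castSucc + 1) = L + 1) :
    (∏ i, ∏ j ∈ Finset.Icc 1 (η i), F (armLength η i j) (legLength η i j)) *
        F (η k.succ - (η k.castSucc + 1)) L =
      (∏ i, ∏ j ∈ Finset.Icc 1 ((η ∘ adjSwap k) i), F (armLength (η ∘ adjSwap k) i j)
        (legLength (η ∘ adjSwap k) i j)) * F (η k.succ - (η k.castSucc + 1)) (L + 1) := by
  -- Spreads the exceptional factor over all nodes, which reduces the identity to one for each node.
  have hspec : ∀ x : M, ∏ i, ∏ j ∈ Finset.Icc 1 (η (adjSwap k i)),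
      (if i = k.castSucc ∧ j = η k.castSucc + 1 then x else 1) = x := by
    intro x
    rw [Finset.prod_eq_single k.castSucc]
    · simp only [true_and, adjSwap_castSucc, Finset.prod_ite_eq',
        Finset.mem_Icc]
      rw [if_pos ⟨by omega, by omega⟩]
    · intro i _ hi
      simp [hi]
    · simp
  rw [← Equiv.prod_comp (adjSwap k) fun i => ∏ j ∈ Finset.Icc 1 (η i), _,
    ← hspec (F (η k.succ - (η k.castSucc + 1)) L),
    ← hspec (F (η k.succ - (η k.castSucc + 1)) (L + 1))]
  simp only [Function.comp_apply, ← Finset.prod_mul_distrib]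
  refine Finset.prod_congr rfl fun i _ => Finset.prod_congr rfl fun j _ => ?_
  have h := legLength_comp_adjSwap hk i j
  by_cases hij : i = k.castSucc ∧ j = η k.castSucc + 1
  · obtain ⟨rfl, rfl⟩ := hij
    rw [adjSwap_castSucc, hL] at h
    simp only [and_self, if_true] at h ⊢
    simp only [armLength, Function.comp_apply, adjSwap_castSucc, hL]
    rw [← Nat.succ_injective h, mul_comm]
  · rw [if_neg hij, add_zero] at h
    rw [if_neg hij, if_neg hij, h]
    rfl

end Boxes

/-! ### The quotient of the norms -/

section NormRatio

variable {m : ℕ} {q t : ℝ}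

theorem one_sub_pow_mul_pow_pos (hq0 : 0 < q) (hq1 : q < 1) (ht0 : 0 < t) (ht1 : t < 1)
    {a : ℕ} (ha : a ≠ 0) (l : ℕ) : 0 < 1 - q ^ a * t ^ l := by
  have h1 : q ^ a < 1 := pow_lt_one₀ hq0.le hq1 ha
  have h2 : t ^ l ≤ 1 := pow_le_one₀ ht0.le ht1.le
  have h3 : q ^ a * t ^ l < 1 := mul_lt_one_of_nonneg_of_lt_one_left (by positivity) h1 h2
  linarith

theorem legColength_lt {n : ℕ} (η : Fin n → ℕ) (i : Fin n) : legColength η i < n := by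
  rw [legColength_eq_card]
  calc _ < (Finset.univ : Finset (Fin n)).card := Finset.card_lt_card (by
        refine Finset.filter_ssubset.mpr ⟨i, Finset.mem_univ i, ?_⟩
        simp [RowPrecedes])
    _ = n := Finset.card_fin n

theorem dConst_pos (hq0 : 0 < q) (hq1 : q < 1) (ht0 : 0 < t) (ht1 : t < 1) {n : ℕ}
    (η : Fin n → ℕ) : 0 < dConst q t η :=
  Finset.prod_pos fun _ _ => Finset.prod_pos fun _ _ =>
    one_sub_pow_mul_pow_pos hq0 hq1 ht0 ht1 (Nat.succ_ne_zero _) _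

theorem eConst'_pos (hq0 : 0 < q) (hq1 : q < 1) (ht0 : 0 < t) (ht1 : t < 1) {n : ℕ}
    (η : Fin n → ℕ) : 0 < eConst' q t η :=
  Finset.prod_pos fun i _ => Finset.prod_pos fun j _ => by
    have h := legColength_lt η i
    have e : (n : ℤ) - 1 - legColength η i = ((n - 1 - legColength η i : ℕ) : ℤ) := by omega
    rw [e, zpow_natCast]
    exact one_sub_pow_mul_pow_pos hq0 hq1 ht0 ht1 (Nat.succ_ne_zero _) _

/-- The quotient `d'_η e_η / (d_η e'_η)`. -/
noncomputable def normRatio {n : ℕ} (q t : ℝ) (η : Fin n → ℕ) : ℝ :=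
  dConst' q t η * eConst q t η / (dConst q t η * eConst' q t η)

theorem normRatio_zero {n : ℕ} (q t : ℝ) : normRatio q t (0 : Fin n → ℕ) = 1 := by
  simp [normRatio, dConst, dConst', eConst, eConst']

/-- Since leg length and leg colength add up to n − 1, the new factor of d equals that of e, and the
new factor of d' equals that of e'. -/
theorem normRatio_raise (hq0 : 0 < q) (hq1 : q < 1) (ht0 : 0 < t) (ht1 : t < 1)
    (η : Fin (m + 1) → ℕ) : normRatio q t (raise η) = normRatio q t η := by
  have hd := prod_legLength_raise (fun a l => 1 - q ^ (a + 1) * t ^ (l + 1)) η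
  have hd' := prod_legLength_raise (fun a l => 1 - q ^ (a + 1) * t ^ l) η
  have he := prod_legColength_raise
    (fun a l => 1 - q ^ (a + 1) * t ^ (((m + 1 : ℕ) : ℤ) - l)) η
  have he' := prod_legColength_raise
    (fun a l => 1 - q ^ (a + 1) * t ^ (((m + 1 : ℕ) : ℤ) - 1 - l)) η
  have h := legLength_zero_add_legColength_zero η
  have e1 : ((m + 1 : ℕ) : ℤ) - legColength η 0 = ((legLength η 0 0 + 1 : ℕ) : ℤ) := by omega
  have e2 : ((m + 1 : ℕ) : ℤ) - 1 - legColength η 0 = ((legLength η 0 0 : ℕ) : ℤ) := by omega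
  rw [e1, zpow_natCast] at he
  rw [e2, zpow_natCast] at he'
  have p1 := one_sub_pow_mul_pow_pos hq0 hq1 ht0 ht1 (Nat.succ_ne_zero (η 0)) (legLength η 0 0)
  have p2 := one_sub_pow_mul_pow_pos hq0 hq1 ht0 ht1 (Nat.succ_ne_zero (η 0))
    (legLength η 0 0 + 1)
  rw [normRatio, normRatio, dConst, dConst', eConst, eConst', hd, hd', he, he', ← dConst, ← dConst',
    ← eConst, ← eConst']
  have p3 := (dConst_pos hq0 hq1 ht0 ht1 η).ne'
  have p4 := (eConst'_pos hq0 hq1 ht0 ht1 η).ne'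
  rw [div_eq_div_iff (by positivity) (by positivity)]
  ring

/-- Put y = q^{c+1} t^L for the exceptional node. The quotient of the eigenvalues is yt, and 1 − c
c' becomes (1 − y)(1 − y t²)/(1 − y t)². The change of d' gives (1 − y)/(1 − y t), that of 1/d gives
(1 − y t²)/(1 − y t), and e, e' do not change. -/
theorem normRatio_comp_adjSwap (hq0 : 0 < q) (hq1 : q < 1) (ht0 : 0 < t) (ht1 : t < 1)
    {η : Fin (m + 1) → ℕ} {k : Fin m} (hk : η k.castSucc < η k.succ) :
    normRatio q t (η ∘ adjSwap k) =
      (1 - swapCoeff q t η k * swapCoeff q⁻¹ t⁻¹ η k) * normRatio q t η := by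
  -- The leg of this node contains row k, so its length is positive.
  obtain ⟨L, hL⟩ : ∃ L, legLength η k.succ (η k.castSucc + 1) = L + 1 := by
    have h := legLength_comp_adjSwap hk k.castSucc (η k.castSucc + 1)
    rw [adjSwap_castSucc, if_pos ⟨rfl, rfl⟩] at h
    exact ⟨_, h⟩
  have hc := legColength_castSucc_eq hk
  rw [hL] at hc
  obtain ⟨c, hb⟩ : ∃ c, η k.succ = η k.castSucc + 1 + c := ⟨_, (Nat.add_sub_of_le hk).symm⟩
  have hq := hq0.ne'
  have ht := ht0.ne'
  have hδ : eigenvalue q t η k.succ / eigenvalue q t η k.castSucc = q ^ (c + 1) * t ^ (L + 1) := by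
    rw [div_eq_iff (eigenvalue_ne_zero hq ht η _), eigenvalue, eigenvalue, hc, hb,
      ← zpow_natCast t (L + 1), mul_mul_mul_comm, ← zpow_add₀ ht]
    congr 1
    · ring
    · congr 1; push_cast; ring
  have hd := prod_legLength_comp_adjSwap (fun a l => 1 - q ^ (a + 1) * t ^ (l + 1)) hk hL
  have hd' := prod_legLength_comp_adjSwap (fun a l => 1 - q ^ (a + 1) * t ^ l) hk hL
  have he : eConst q t (η ∘ adjSwap k) = eConst q t η := prod_legColength_comp_adjSwap
    (fun a l => 1 - q ^ (a + 1) * t ^ (((m + 1 : ℕ) : ℤ) - l)) hk.ne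
  have he' : eConst' q t (η ∘ adjSwap k) = eConst' q t η := prod_legColength_comp_adjSwap
    (fun a l => 1 - q ^ (a + 1) * t ^ (((m + 1 : ℕ) : ℤ) - 1 - l)) hk.ne
  have hb' : η k.succ - (η k.castSucc + 1) = c := by omega
  rw [← dConst, ← dConst, hb'] at hd
  rw [← dConst', ← dConst', hb'] at hd'
  have p0 := one_sub_pow_mul_pow_pos hq0 hq1 ht0 ht1 (Nat.succ_ne_zero c) L
  have p1 := one_sub_pow_mul_pow_pos hq0 hq1 ht0 ht1 (Nat.succ_ne_zero c) (L + 1)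
  have p2 := one_sub_pow_mul_pow_pos hq0 hq1 ht0 ht1 (Nat.succ_ne_zero c) (L + 1 + 1)
  have p3 := (dConst_pos hq0 hq1 ht0 ht1 η).ne'
  have p4 := (eConst'_pos hq0 hq1 ht0 ht1 η).ne'
  have p5 := (dConst_pos hq0 hq1 ht0 ht1 (η ∘ adjSwap k)).ne'
  have hcoef : 1 - swapCoeff q t η k * swapCoeff q⁻¹ t⁻¹ η k =
      (1 - q ^ (c + 1) * t ^ L) * (1 - q ^ (c + 1) * t ^ (L + 1 + 1)) /
        (1 - q ^ (c + 1) * t ^ (L + 1)) ^ 2 := by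
    have hinv : (eigenvalue q t η k.succ)⁻¹ / (eigenvalue q t η k.castSucc)⁻¹ =
        (eigenvalue q t η k.succ / eigenvalue q t η k.castSucc)⁻¹ := by
      rw [inv_div, inv_div_inv]
    rw [swapCoeff, swapCoeff, eigenvalue_inv, eigenvalue_inv, hinv, hδ]
    have hy : q ^ (c + 1) * t ^ L ≠ 0 := by positivity
    have hyt : 1 - q ^ (c + 1) * t ^ L * t ≠ 0 := by
      rw [mul_assoc, ← pow_succ]; exact p1.ne'
    have e1 : q ^ (c + 1) * t ^ (L + 1) = q ^ (c + 1) * t ^ L * t := by ring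
    have e2 : q ^ (c + 1) * t ^ (L + 1 + 1) = q ^ (c + 1) * t ^ L * t * t := by ring
    rw [e1, e2]
    generalize q ^ (c + 1) * t ^ L = y at *
    have e : 1 - (y * t)⁻¹ = -((1 - y * t) / (y * t)) := by
      field_simp
      ring
    rw [e, eq_div_iff (pow_ne_zero 2 hyt)]
    have e3 : (1 - t) / (1 - y * t) * ((1 - t⁻¹) / -((1 - y * t) / (y * t))) =
        (1 - t) ^ 2 * y / (1 - y * t) ^ 2 := by
      field_simp
      ring
    rw [e3, sub_mul, div_mul_cancel₀ _ (pow_ne_zero 2 hyt)]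
    ring
  rw [normRatio, normRatio, he, he', hcoef]
  rw [Nat.succ_eq_add_one] at p0 p1 p2
  rw [div_mul_div_comm, div_eq_div_iff (by positivity) (by positivity)]
  linear_combination eConst q t η * eConst' q t η *
    (dConst' q t η * (1 - q ^ (c + 1) * t ^ L) * hd -
      dConst q t η * (1 - q ^ (c + 1) * t ^ (L + 1)) * hd')

theorem normE_eq (hq0 : 0 < q) (hq1 : q < 1) (ht0 : 0 < t) (ht1 : t < 1)
    (η : Fin (m + 1) → ℕ) :
    normE η q t = (normRatio q t η : ℂ) * normE (0 : Fin (m + 1) → ℕ) q t := by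
  induction η using composition_induction with
  | zero => rw [normRatio_zero, Complex.ofReal_one, one_mul]
  | raise η ih => rw [normE_raise hq0 hq1 ht0 ht1, normRatio_raise hq0 hq1 ht0 ht1, ih]
  | swap η k hk ih =>
    rw [normE_comp_adjSwap hq0 hq1 ht0 ht1 hk, normRatio_comp_adjSwap hq0 hq1 ht0 ht1 hk, ih,
      Complex.ofReal_mul, mul_assoc]

end NormRatio

/-! ### Non-vanishing of the constant term of the weight -/

section Nonvanishing

open MeasureTheory

variable {n m : ℕ} {q t : ℝ}

theorem span_macdonaldE (hq : q ≠ 0) (ht : t ≠ 0) (hsep : SeparatesSpectrum m q t) :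
    Submodule.span ℝ (Set.range fun η : Fin (m + 1) → ℕ => macdonaldE η q t) = ⊤ := by
  have hmon : ∀ (η : Fin (m + 1) → ℕ) (c : ℝ),
      monomial (Finsupp.equivFunOnFinite.symm η) c ∈
        Submodule.span ℝ (Set.range fun η : Fin (m + 1) → ℕ => macdonaldE η q t) := by
    intro η
    induction η using wellFounded_prec.induction with
    | _ η ih =>
    intro c
    have hE := isMacdonaldE_macdonaldE hq ht hsep η
    have hmem : Finsupp.equivFunOnFinite.symm η ∈ (macdonaldE η q t).support := by
      rw [mem_support_iff, hE.coeff_self]; exact one_ne_zero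
    have hsum := support_sum_monomial_coeff (macdonaldE η q t)
    rw [← Finset.add_sum_erase _ _ hmem, hE.coeff_self] at hsum
    have h1 : monomial (Finsupp.equivFunOnFinite.symm η) (1 : ℝ) ∈
        Submodule.span ℝ (Set.range fun η : Fin (m + 1) → ℕ => macdonaldE η q t) := by
      rw [eq_sub_of_add_eq hsum]
      refine Submodule.sub_mem _ (Submodule.subset_span ⟨η, rfl⟩)
        (Submodule.sum_mem _ fun ν hν => ?_)
      obtain ⟨hne, hν⟩ := Finset.mem_erase.mp hν
      have hlt := (hE.triangular ν hν).resolve_left fun h => hne (by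
        rw [← h]; exact (Finsupp.equivFunOnFinite.symm_apply_apply ν).symm)
      have := ih ν hlt (coeff ν (macdonaldE η q t))
      rwa [Finsupp.equivFunOnFinite_symm_coe] at this
    have h2 := Submodule.smul_mem _ c h1
    rwa [smul_monomial, smul_eq_mul, mul_one] at h2
  refine eq_top_iff.mpr fun f _ => ?_
  rw [← support_sum_monomial_coeff f]
  refine Submodule.sum_mem _ fun ν _ => ?_
  have := hmon ν (coeff ν f)
  rwa [Finsupp.equivFunOnFinite_symm_coe] at this

/-- The two families at (q,t) and at the inverted parameters span and are mutually orthogonal, and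
each diagonal value is a multiple of N_0. -/
theorem pairing_eq_zero_of_normE_zero (hq0 : 0 < q) (hq1 : q < 1) (ht0 : 0 < t) (ht1 : t < 1)
    (h0 : normE (0 : Fin (m + 1) → ℕ) q t = 0) (f g : MvPolynomial (Fin (m + 1)) ℝ) :
    pairing q t f g = 0 := by
  have hsep := separatesSpectrum (m := m) hq0 hq1 ht0 ht1
  have hf : f ∈ Submodule.span ℝ (Set.range fun η : Fin (m + 1) → ℕ => macdonaldE η q t) := by
    rw [span_macdonaldE hq0.ne' ht0.ne' hsep]; trivial
  have hg : g ∈ Submodule.span ℝ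
      (Set.range fun η : Fin (m + 1) → ℕ => macdonaldE η q⁻¹ t⁻¹) := by
    rw [span_macdonaldE (inv_ne_zero hq0.ne') (inv_ne_zero ht0.ne') hsep.inv]; trivial
  induction hf using Submodule.span_induction with
  | mem f hf =>
    obtain ⟨η, rfl⟩ := hf
    induction hg using Submodule.span_induction with
    | mem g hg =>
      obtain ⟨ν, rfl⟩ := hg
      by_cases h : η = ν
      · subst h
        exact (normE_eq hq0 hq1 ht0 ht1 η).trans (by rw [h0, mul_zero])
      · exact pairing_macdonaldE_of_ne hq0 hq1 ht0 ht1 h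
    | zero => simpa using pairing_smul_right (q := q) (t := t) 0 (macdonaldE η q t) 0
    | add g g' _ _ hg hg' => rw [pairing_add_right hq0 hq1 ht0 ht1, hg, hg', add_zero]
    | smul c g _ hg => rw [pairing_smul_right, hg, mul_zero]
  | zero => simpa using pairing_smul_left (q := q) (t := t) 0 0 g
  | add f f' _ _ hf hf' => rw [pairing_add_left hq0 hq1 ht0 ht1, hf, hf', add_zero]
  | smul c f _ hf => rw [pairing_smul_left, hf, mul_zero]

/-- The point of `ℂⁿ` that corresponds to a point of the additive torus. -/
noncomputable def circlePoint (x : UnitAddTorus (Fin n)) : Fin n → ℂ := fun i => fourier 1 (x i)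

theorem norm_circlePoint (x : UnitAddTorus (Fin n)) (i : Fin n) : ‖circlePoint x i‖ = 1 := by
  rw [circlePoint, fourier_one, Circle.norm_coe]

theorem continuous_circlePoint : Continuous (circlePoint (n := n)) := by
  unfold circlePoint
  fun_prop

theorem circlePoint_coe (θ : Fin n → ℝ) :
    circlePoint (fun i => (θ i : UnitAddCircle)) = torusPoint θ := by
  funext i
  rw [circlePoint, torusPoint, fourier_coe_apply]
  congr 1
  simp

theorem continuous_weight_circlePoint (hq0 : 0 < q) (hq1 : q < 1) (ht0 : 0 < t) (ht1 : t < 1) :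
    Continuous fun x : UnitAddTorus (Fin n) => weight q t (circlePoint x) :=
  continuous_iff_continuousAt.mpr fun x => ContinuousAt.comp (f := circlePoint)
    (differentiableAt_weight hq0 hq1 ht0
      (isRegularPoint_of_norm_eq_one hq0 hq1 ht1 (norm_circlePoint x))).continuousAt
    continuous_circlePoint.continuousAt

theorem continuous_coe_unitAddTorus :
    Continuous fun (θ : Fin n → ℝ) i => (θ i : UnitAddCircle) :=
  continuous_pi fun i => (AddCircle.continuous_mk' 1).comp (continuous_apply i)

/-- A continuous function on the torus whose Fourier coefficients all vanish is orthogonal to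
all continuous functions. -/
theorem setIntegral_mul_eq_zero {w : UnitAddTorus (Fin n) → ℂ} (hw : Continuous w)
    (h : ∀ k : Fin n → ℤ, ∫ θ in Set.Icc (0 : Fin n → ℝ) 1,
      UnitAddTorus.mFourier k (fun i => (θ i : UnitAddCircle)) *
        w (fun i => (θ i : UnitAddCircle)) = 0) (F : C(UnitAddTorus (Fin n), ℂ)) :
    ∫ θ in Set.Icc (0 : Fin n → ℝ) 1,
      F (fun i => (θ i : UnitAddCircle)) * w (fun i => (θ i : UnitAddCircle)) = 0 := by
  have hint : ∀ F : C(UnitAddTorus (Fin n), ℂ), IntegrableOn (fun θ : Fin n → ℝ =>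
      F (fun i => (θ i : UnitAddCircle)) * w (fun i => (θ i : UnitAddCircle)))
      (Set.Icc (0 : Fin n → ℝ) 1) := fun F =>
    (((F.continuous.mul hw).comp continuous_coe_unitAddTorus).continuousOn).integrableOn_compact
      isCompact_Icc
  have hnorm : IntegrableOn (fun θ : Fin n → ℝ => ‖w (fun i => (θ i : UnitAddCircle))‖)
      (Set.Icc (0 : Fin n → ℝ) 1) :=
    ((hw.comp continuous_coe_unitAddTorus).norm.continuousOn).integrableOn_compact isCompact_Icc
  let Φ : C(UnitAddTorus (Fin n), ℂ) →L[ℂ] ℂ := LinearMap.mkContinuous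
    { toFun := fun F => ∫ θ in Set.Icc (0 : Fin n → ℝ) 1,
        F (fun i => (θ i : UnitAddCircle)) * w (fun i => (θ i : UnitAddCircle))
      map_add' := fun F G => by
        rw [← integral_add (hint F) (hint G)]
        simp only [ContinuousMap.add_apply, add_mul]
      map_smul' := fun c F => by
        rw [RingHom.id_apply, smul_eq_mul, ← integral_const_mul]
        simp only [ContinuousMap.smul_apply, smul_eq_mul, mul_assoc] }
    (∫ θ in Set.Icc (0 : Fin n → ℝ) 1, ‖w (fun i => (θ i : UnitAddCircle))‖) fun F => by
      rw [mul_comm, ← integral_const_mul]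
      refine norm_integral_le_of_norm_le (hnorm.const_mul _) (Filter.Eventually.of_forall
        fun θ => ?_)
      rw [norm_mul]
      exact mul_le_mul_of_nonneg_right (F.norm_coe_le_norm _) (norm_nonneg _)
  -- Integration against w is continuous for the supremum norm, and trigonometric polynomials are
  -- dense.
  have hle : (Submodule.span ℂ (Set.range (UnitAddTorus.mFourier (d := Fin n)))).topologicalClosure
      ≤ LinearMap.ker Φ.toLinearMap := by
    refine Submodule.topologicalClosure_minimal _ (Submodule.span_le.mpr ?_) Φ.isClosed_ker
    rintro _ ⟨k, rfl⟩
    exact h k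
  rw [UnitAddTorus.span_mFourier_closure_eq_top] at hle
  exact hle (Submodule.mem_top (x := F))

theorem torusPoint_injective {θ : Fin n → ℝ} (hθ : Function.Injective θ)
    (h : ∀ i, θ i ∈ Set.Ioo (0 : ℝ) 1) : Function.Injective (torusPoint θ) := by
  intro i j hij
  obtain ⟨k, hk⟩ := Complex.exp_eq_exp_iff_exists_int.mp hij
  have h1 : (θ i : ℂ) = θ j + k := by
    have : (2 * Real.pi * Complex.I : ℂ) ≠ 0 := Complex.two_pi_I_ne_zero
    apply mul_left_cancel₀ this
    linear_combination hk
  have h2 : θ i = θ j + k := by exact_mod_cast h1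
  have hi := h i
  have hj := h j
  simp only [Set.mem_Ioo] at hi hj
  have h3 : k < 1 := by
    have : (k : ℝ) < 1 := by linarith
    exact_mod_cast this
  have h4 : -1 < k := by
    have : (-1 : ℝ) < k := by linarith
    exact_mod_cast this
  have h5 : k = 0 := by omega
  subst h5
  refine hθ ?_
  simpa using h2

theorem normE_zero_ne_zero (hq0 : 0 < q) (hq1 : q < 1) (ht0 : 0 < t) (ht1 : t < 1) :
    normE (0 : Fin (m + 1) → ℕ) q t ≠ 0 := by
  intro h0
  have hw := continuous_weight_circlePoint (n := m + 1) hq0 hq1 ht0 ht1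
  -- Testing against the complex conjugate of W turns the vanishing of all Fourier coefficients into
  -- ∫ |W|² = 0.
  have hzero := setIntegral_mul_eq_zero hw (fun k => ?_) ⟨_, hw.star⟩
  · simp only [ContinuousMap.coe_mk, circlePoint_coe] at hzero
    have hcont : Continuous fun θ : Fin (m + 1) → ℝ => ‖weight q t (torusPoint θ)‖ ^ 2 := by
      simp only [← circlePoint_coe]
      exact ((hw.comp continuous_coe_unitAddTorus).norm).pow 2
    have hreal : ∫ θ in Set.Icc (0 : Fin (m + 1) → ℝ) 1, ‖weight q t (torusPoint θ)‖ ^ 2 = 0 := by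
      rw [← Complex.ofReal_eq_zero, ← integral_complex_ofReal, ← hzero]
      congr 1
      funext θ
      rw [Complex.star_def, Complex.conj_mul']
      push_cast
      rfl
    have hpos : 0 < ∫ θ in Set.Icc (0 : Fin (m + 1) → ℝ) 1, ‖weight q t (torusPoint θ)‖ ^ 2 := by
      rw [setIntegral_pos_iff_support_of_nonneg_ae
        (Filter.Eventually.of_forall fun θ => sq_nonneg _)
        (hcont.continuousOn.integrableOn_compact isCompact_Icc)]
      have hopen : IsOpen ((Function.support fun θ : Fin (m + 1) → ℝ =>
          ‖weight q t (torusPoint θ)‖ ^ 2) ∩ Set.univ.pi fun _ => Set.Ioo (0 : ℝ) 1) :=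
        hcont.isOpen_support.inter (isOpen_set_pi Set.finite_univ fun _ _ => isOpen_Ioo)
      refine (hopen.measure_pos volume ?_).trans_le (measure_mono ?_)
      -- An interior point of the cube with distinct coordinates, where the weight does not vanish.
      · have hi : ∀ i : Fin (m + 1), ((i : ℕ) + 1 : ℝ) / (m + 2) ∈ Set.Ioo (0 : ℝ) 1 := fun i => by
          refine ⟨by positivity, (div_lt_one (by positivity)).mpr ?_⟩
          have : ((i : ℕ) : ℝ) < m + 1 := by exact_mod_cast i.isLt
          linarith
        refine ⟨fun i => ((i : ℕ) + 1 : ℝ) / (m + 2), ?_, fun i _ => hi i⟩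
        rw [Function.mem_support]
        refine pow_ne_zero _ (norm_ne_zero_iff.mpr (weight_ne_zero hq0 hq1 ht0 ht1
          (norm_torusPoint _) (torusPoint_injective (fun i j hij => ?_) hi)))
        have h1 : (m + 2 : ℝ) ≠ 0 := by positivity
        have h2 := (div_left_inj' h1).mp hij
        exact Fin.ext (by exact_mod_cast add_right_cancel h2)
      · rintro θ ⟨h1, h2⟩
        exact ⟨h1, fun i => (h2 i trivial).1.le, fun i => (h2 i trivial).2.le⟩
    exact hpos.ne' hreal
  -- The Fourier mode x^k is f(x) g(1/x), where f and g are the monomials with exponents the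
  -- positive and negative parts of k.
  · have hp := pairing_eq_zero_of_normE_zero hq0 hq1 ht0 ht1 h0
      (monomial (Finsupp.equivFunOnFinite.symm fun i => (k i).toNat) 1)
      (monomial (Finsupp.equivFunOnFinite.symm fun i => (-k i).toNat) 1)
    rw [pairing, constantTerm_eq] at hp
    rw [← hp]
    congr 1
    funext θ
    rw [pairingIntegrand, circlePoint_coe]
    congr 1
    simp only [aeval_monomial, map_one, one_mul]
    rw [Finsupp.prod_fintype _ _ (by simp), Finsupp.prod_fintype _ _ (by simp),
      ← Finset.prod_mul_distrib]
    change ∏ i, fourier (k i) (θ i : UnitAddCircle) = _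
    refine Finset.prod_congr rfl fun i _ => ?_
    have h1 : torusPoint θ i ≠ 0 := norm_ne_zero_iff.mp (by
      rw [norm_torusPoint]; exact one_ne_zero)
    have h2 : fourier (k i) (θ i : UnitAddCircle) = torusPoint θ i ^ k i := by
      rw [fourier_coe_apply, torusPoint, ← Complex.exp_int_mul]
      congr 1
      push_cast
      ring
    rw [h2]
    simp only [Finsupp.equivFunOnFinite_symm_apply_apply]
    rw [inv_pow, ← zpow_natCast, ← zpow_natCast, ← zpow_neg, ← zpow_add₀ h1]
    congr 1
    omega

end Nonvanishing

end NonsymMacdonald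

theorem mainTheorem10 (m : ℕ) (q t : ℝ) (hq0 : 0 < q) (hq1 : q < 1) (ht0 : 0 < t) (ht1 : t < 1)
    (η : Fin (m + 1) → ℕ) :
    (∃! E : MvPolynomial (Fin (m + 1)) ℝ, IsMacdonaldE η q t E) ∧
    (∃! E : MvPolynomial (Fin (m + 1)) ℝ, IsMacdonaldE η q⁻¹ t⁻¹ E) ∧
    normE (0 : Fin (m + 1) → ℕ) q t ≠ 0 ∧
    normE η q t / normE (0 : Fin (m + 1) → ℕ) q t =
      ((dConst' q t η * eConst q t η / (dConst q t η * eConst' q t η) : ℝ) : ℂ) := by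
  have hsep := separatesSpectrum (m := m) hq0 hq1 ht0 ht1
  have h0 := normE_zero_ne_zero (m := m) hq0 hq1 ht0 ht1
  exact ⟨existsUnique_isMacdonaldE hq0.ne' ht0.ne' hsep η,
    existsUnique_isMacdonaldE (inv_ne_zero hq0.ne') (inv_ne_zero ht0.ne') hsep.inv η, h0,
    (div_eq_iff h0).mpr (normE_eq hq0 hq1 ht0 ht1 η)⟩
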